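/- **Theorem (Eikonal equation).** Let $n\ge 1$, let $V_\kappa\subset\mathbb R^{n-1}$ be open, $R_{\mathcal M}>0$, $\nu>0$, and let $dr^2+r^2g_{jk}(r,\theta)\,d\theta_j d\theta_k$ on $(R_{\mathcal M},\infty)\times V_\kappa$ be the coordinate expression, in a chart at infinity, of an asymptotically conic metric in normal form. That is, $(g_{jk}(r,\theta))$ and $\bar g(\theta)=(\bar g_{jk}(\theta))$ are smooth, symmetric and positive definite on $(R_{\mathcal M},\infty)\times V_\kappa$ and on $V_\kappa$ respectively, and for all $j,\alpha$ and every compact $K\subset V_\kappa$, $|\partial_r^j\partial_\theta^\alpha(g-\bar g)(r,\theta)|\le C_{j\alpha K}\,r^{-\nu-j}$ for $r>R_{\mathcal M}$, $\theta\in K$. For $\epsilon\in(0,1]$ put $$p_{\epsilon,\kappa}(r,\theta,\rho,\eta)=\rho^2+r^{-2}g^{jk}(r/\epsilon,\theta)\eta_j\eta_k ,\qquad (g^{jk})=(g_{jk})^{-1},$$ on $\{r>\epsilon R_{\mathcal M},\ \theta\in V_\kappa\}$. Let $\phi^s_{\epsilon,\kappa}$ be its Hamiltonian flow, and let $\phi_0^s(r,\vartheta,\varrho,\eta)=(r+2s\varrho,\vartheta,\varrho,\eta)$.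 For $R>R_{\mathcal M}$, $V\subset V_\kappa$, $\varepsilon>0$ and $0<\varepsilon'<1$ put $$\Theta(R,V,\varepsilon)=\{(r,\theta,\vartheta):\ r>R,\ \theta\in V,\ |\theta-\vartheta|<\varepsilon\},$$ $$\widetilde\Gamma^\pm_{\rm st}(R,V,\varepsilon')=\{(r,\theta,\rho,\eta):\ r>R,\ \theta\in V,\ \pm\rho>(1-\varepsilon'^2)\,p_{\epsilon,\kappa}^{1/2}\}.$$ For $\mu\in\mathbb R$, $S_\mu$ denotes the families $(a_\epsilon)_{\epsilon\in(0,1]}$ of smooth functions on $\Theta(R,V,\varepsilon)$ such that, for all $j,\alpha,\beta$, $|\partial_r^j\partial_\theta^\alpha\partial_\vartheta^\beta a_\epsilon|\le C r^{\mu-j}$ on $\Theta(R,V,\varepsilon)$ with $C$ independent of $\epsilon$. For an integer $m\ge0$, $S_\mu(\vartheta-\theta)^m$ denotes the families $\sum_{|\gamma|=m}a_{\epsilon,\gamma}(\vartheta-\theta)^\gamma$ with $a_{\epsilon,\gamma}\in S_\mu$. Let $V$ be a convex open set whose closure is compact and contained in $V_\kappa$. Then there are $R>R_{\mathcal M}$,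 which can be taken arbitrarily large, $\varepsilon>0$, which can be taken arbitrarily small, and $\varepsilon'\in(0,1)$ such that for every $\epsilon\in(0,1]$ there is a smooth function $\psi_\epsilon:\Theta(R,V,\varepsilon)\to\mathbb R$ for which $\varphi_\epsilon(r,\theta,\varrho,\vartheta):=\varrho\,\psi_\epsilon(r,\theta,\vartheta)$ has the following properties. 1. For $(r,\theta,\vartheta)\in\Theta(R,V,\varepsilon)$ and $\varrho\in\mathbb R$, $\ p_{\epsilon,\kappa}(r,\theta,\partial_r\varphi_\epsilon,\partial_\theta\varphi_\epsilon)=\varrho^2$. 2. For each sign $\pm$ and every point of $\widetilde\Gamma^\pm_{\rm st}(R,V,\varepsilon')$, the flow $\phi^s_{\epsilon,\kappa}$ starting there is defined for all $\pm s\ge0$ and the limit $F^\pm_{\epsilon,\kappa}:=\lim_{s\to\pm\infty}\phi_0^{-s}\circ\phi^s_{\epsilon,\kappa}$ exists. For $(r,\theta,\vartheta)\in\Theta(R,V,\varepsilon)$ and $\pm\varrho>0$, the point $(r,\theta,\partial_r\varphi_\epsilon,\partial_\theta\varphi_\epsilon)$ belongs to $\widetilde\Gamma^\pm_{\rm st}(R,V,\varepsilon')$,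 and $$F^\pm_{\epsilon,\kappa}(r,\theta,\partial_r\varphi_\epsilon,\partial_\theta\varphi_\epsilon)=(\partial_\varrho\varphi_\epsilon,\vartheta,\varrho,-\partial_\vartheta\varphi_\epsilon).$$ 3. On $\Theta(R,V,\varepsilon)$, as $\epsilon$-dependent families (hence uniformly in $\epsilon\in(0,1]$), $$\psi_\epsilon=r+S_{1-\nu}(\vartheta-\theta)+S_1(\vartheta-\theta)^2,$$ $$\partial_r\psi_\epsilon=1+S_{-\nu}(\vartheta-\theta)+S_0(\vartheta-\theta)^2,$$ $$\partial_\theta\psi_\epsilon=r\,\bar g(\theta)(\vartheta-\theta)+S_{1-\nu}(\vartheta-\theta)+S_1(\vartheta-\theta)^2,$$ $$\partial_\vartheta\psi_\epsilon=-r\,\bar g(\theta)(\vartheta-\theta)+S_{1-\nu}(\vartheta-\theta)+S_1(\vartheta-\theta)^2 .$$ -/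

import Mathlib

open Filter Topology
open scoped ContDiff

noncomputable section

namespace ConicScattering

/-- Angular space `ℝ^d` with its Euclidean norm; the manifold has dimension `n = d + 1`. -/
abbrev Ang (d : ℕ) := EuclideanSpace ℝ (Fin d)

/-- Points `(r, θ)`. -/
abbrev Base (d : ℕ) := ℝ × Ang d

/-- Points `(r, θ, ρ, η)` of phase space. -/
abbrev Phase (d : ℕ) := ℝ × Ang d × ℝ × Ang d

/-- Points `(r, θ, ϑ)`. -/
abbrev Triple (d : ℕ) := ℝ × Ang d × Ang d

/-- The unit coordinate vector of index `i`. -/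
def unitVec {d : ℕ} (i : Fin d) : Ang d := EuclideanSpace.single i 1

/-- The iterated partial derivative `∂_{v₁} ∂_{v₂} ⋯ ∂_{vₖ} f` for a list `[v₁, …, vₖ]` of
directions. -/
def iterPartial {X : Type*} [NormedAddCommGroup X] [NormedSpace ℝ X]
    (L : List X) (f : X → ℝ) : X → ℝ :=
  L.foldr (fun v h x => fderiv ℝ h x v) f

/-- `∂_r^j ∂_θ^α` for functions of `(r, θ)`. The multi-index `α` is listed as a sequence of
coordinate indices. -/
def basePartial {d : ℕ} (j : ℕ) (α : List (Fin d)) : (Base d → ℝ) → Base d → ℝ :=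
  iterPartial (List.replicate j ((1, 0) : Base d) ++ α.map (fun i => ((0, unitVec i) : Base d)))

/-- `∂_r^j ∂_θ^α ∂_ϑ^β` for functions of `(r, θ, ϑ)`. -/
def triplePartial {d : ℕ} (j : ℕ) (α β : List (Fin d)) : (Triple d → ℝ) → Triple d → ℝ :=
  iterPartial (List.replicate j ((1, 0, 0) : Triple d)
    ++ α.map (fun i => ((0, unitVec i, 0) : Triple d))
    ++ β.map (fun i => ((0, 0, unitVec i) : Triple d)))

/-- The expression, in one chart at infinity `(RM, ∞) × U` with `U ⊆ ℝ^d` open, of an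
asymptotically conic metric in normal form `dr² + r² g(r)`, where `g(r) - gbar ∈ S^{-ν}`:
every `∂_r^j ∂_θ^α (g - gbar)_{lm}` is `O(r^{-ν-j})`, locally uniformly in `θ`. -/
structure ConicChart (d : ℕ) where
  /-- the range of the angular chart -/
  U : Set (Ang d)
  /-- the chart at infinity is `{r > RM}` -/
  RM : ℝ
  /-- the decay rate -/
  ν : ℝ
  /-- the matrix of the limiting metric on the angular manifold -/
  gbar : Ang d → Matrix (Fin d) (Fin d) ℝ
  /-- the matrix of the angular metric at `r` -/
  g : ℝ → Ang d → Matrix (Fin d) (Fin d) ℝ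
  isOpen_U : IsOpen U
  RM_pos : 0 < RM
  ν_pos : 0 < ν
  gbar_posDef : ∀ θ ∈ U, (gbar θ).PosDef
  g_posDef : ∀ r, RM < r → ∀ θ ∈ U, (g r θ).PosDef
  gbar_smooth : ∀ l m, ContDiffOn ℝ ∞ (fun θ => gbar θ l m) U
  g_smooth : ∀ l m, ContDiffOn ℝ ∞ (fun x : Base d => g x.1 x.2 l m) (Set.Ioi RM ×ˢ U)
  decay : ∀ K : Set (Ang d), IsCompact K → K ⊆ U →
    ∀ (l m : Fin d) (j : ℕ) (α : List (Fin d)), ∃ C : ℝ, ∀ r, RM < r → ∀ θ ∈ K,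
      |basePartial j α (fun x => g x.1 x.2 l m - gbar x.2 l m) (r, θ)| ≤ C * r ^ (-ν - (j : ℝ))

/-- The rescaled principal symbol
`p_ε(r, θ, ρ, η) = ρ² + r⁻² ∑_{j,k} g^{jk}(r/ε, θ) η_j η_k`, where `(g^{jk})` is the inverse
matrix of `(g_{jk})`. -/
def symbolP {d : ℕ} (M : ConicChart d) (ε : ℝ) (z : Phase d) : ℝ :=
  z.2.2.1 ^ 2
    + (z.1 ^ 2)⁻¹ * ∑ j, ∑ k, (M.g (z.1 / ε) z.2.1)⁻¹ j k * z.2.2.2 j * z.2.2.2 k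

/-- The region of phase space above the rescaled chart, on which `symbolP` lives. -/
def phaseDomain {d : ℕ} (M : ConicChart d) (ε : ℝ) : Set (Phase d) :=
  {z | ε * M.RM < z.1 ∧ z.2.1 ∈ M.U}

/-- The Hamiltonian vector field `(∂_ρ p, ∂_η p, -∂_r p, -∂_θ p)`. -/
def hamField {d : ℕ} (p : Phase d → ℝ) (z : Phase d) : Phase d :=
  (deriv (fun ρ => p (z.1, z.2.1, ρ, z.2.2.2)) z.2.2.1,
   gradient (fun η => p (z.1, z.2.1, z.2.2.1, η)) z.2.2.2,
   - deriv (fun r => p (r, z.2.1, z.2.2.1, z.2.2.2)) z.1,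
   - gradient (fun θ => p (z.1, θ, z.2.2.1, z.2.2.2)) z.2.1)

/-- `γ s = φ^s(z)` for all `s` with `0 ≤ σ s`, where `φ^s` is the Hamiltonian flow of `p_ε` and
`σ` is `1` or `-1`; in particular the flow starting at `z` is defined for all these times.
The values of `γ` at other times are irrelevant. -/
def IsHalfTrajectory {d : ℕ} (M : ConicChart d) (ε σ : ℝ) (z : Phase d) (γ : ℝ → Phase d) :
    Prop :=
  γ 0 = z ∧ ∀ s : ℝ, 0 ≤ σ * s → γ s ∈ phaseDomain M ε ∧
    HasDerivWithinAt γ (hamField (symbolP M ε) (γ s)) {t : ℝ | 0 ≤ σ * t} s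

/-- The Hamiltonian flow of `ϱ²`: `φ₀^s(r, ϑ, ϱ, η) = (r + 2 s ϱ, ϑ, ϱ, η)`. -/
def freeFlow {d : ℕ} (s : ℝ) (z : Phase d) : Phase d :=
  (z.1 + 2 * s * z.2.2.1, z.2)

/-- `F_ε^±(z) = w` (sign `σ`): the flow `φ^s(z)` is defined for all `s` with `0 ≤ σ s`, and
`φ₀^{-s}(φ^s(z)) → w` as `s → σ ∞`. -/
def IsScatteringLimit {d : ℕ} (M : ConicChart d) (ε σ : ℝ) (z w : Phase d) : Prop :=
  ∃ γ : ℝ → Phase d, IsHalfTrajectory M ε σ z γ ∧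
    Tendsto (fun t : ℝ => freeFlow (-(σ * t)) (γ (σ * t))) atTop (𝓝 w)

/-- The strongly outgoing (`σ = 1`) or incoming (`σ = -1`) region
`{r > R, θ ∈ V, σ ρ > (1 - κ²) p_ε^{1/2}}`. -/
def strongRegion {d : ℕ} (M : ConicChart d) (ε σ R : ℝ) (V : Set (Ang d)) (κ : ℝ) :
    Set (Phase d) :=
  {z | R < z.1 ∧ z.2.1 ∈ V ∧ (1 - κ ^ 2) * √(symbolP M ε z) < σ * z.2.2.1}

/-- `Θ(R, V, δ) = {(r, θ, ϑ) : r > R, θ ∈ V, |θ - ϑ| < δ}`. -/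
def Theta {d : ℕ} (R : ℝ) (V : Set (Ang d)) (δ : ℝ) : Set (Triple d) :=
  {x | R < x.1 ∧ x.2.1 ∈ V ∧ ‖x.2.1 - x.2.2‖ < δ}

/-- The class `S_μ` on a set `D` of triples (an open `Theta R V δ` in practice): families
`(a_ε)`, `0 < ε ≤ 1`, of smooth functions with
`|∂_r^j ∂_θ^α ∂_ϑ^β a_ε| ≤ C r^{μ-j}` on `D`, the constants being independent of `ε`. -/
def IsSymbol {d : ℕ} (D : Set (Triple d)) (μ : ℝ) (a : ℝ → Triple d → ℝ) : Prop :=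
  (∀ ε ∈ Set.Ioc (0 : ℝ) 1, ContDiffOn ℝ ∞ (a ε) D) ∧
  ∀ (j : ℕ) (α β : List (Fin d)), ∃ C : ℝ, ∀ ε ∈ Set.Ioc (0 : ℝ) 1, ∀ x ∈ D,
    |triplePartial j α β (a ε) x| ≤ C * x.1 ^ (μ - (j : ℝ))

/-- The class `S_μ (ϑ - θ)^m`: families of the form `∑_{|γ| = m} a_{ε,γ} (ϑ - θ)^γ` on `D`
with every `a_γ` in `S_μ`. -/
def IsSymbolPow {d : ℕ} (D : Set (Triple d)) (μ : ℝ) (m : ℕ) (f : ℝ → Triple d → ℝ) : Prop :=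
  ∃ a : (Fin d → ℕ) → ℝ → Triple d → ℝ,
    (∀ γ ∈ Finset.piAntidiag Finset.univ m, IsSymbol D μ (a γ)) ∧
    ∀ ε ∈ Set.Ioc (0 : ℝ) 1, ∀ x ∈ D,
      f ε x = ∑ γ ∈ Finset.piAntidiag Finset.univ m,
        a γ ε x * ∏ i, (x.2.2 i - x.2.1 i) ^ γ i

/-- `f = b + S_{μ₁} (ϑ - θ)^{m₁} + S_{μ₂} (ϑ - θ)^{m₂}` on `D`. -/
def HasExpansion {d : ℕ} (D : Set (Triple d)) (f b : ℝ → Triple d → ℝ)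
    (μ₁ : ℝ) (m₁ : ℕ) (μ₂ : ℝ) (m₂ : ℕ) : Prop :=
  ∃ u v : ℝ → Triple d → ℝ, IsSymbolPow D μ₁ m₁ u ∧ IsSymbolPow D μ₂ m₂ v ∧
    ∀ ε ∈ Set.Ioc (0 : ℝ) 1, ∀ x ∈ D, f ε x - b ε x = u ε x + v ε x

/-- The phase `φ(r, θ, ϱ, ϑ) = ϱ ψ(r, θ, ϑ)`. -/
def phase {d : ℕ} (ψ : Triple d → ℝ) (r : ℝ) (θ : Ang d) (ϱ : ℝ) (ϑ : Ang d) : ℝ :=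
  ϱ * ψ (r, θ, ϑ)

/-- The point `(r, θ, ∂_r φ, ∂_θ φ)`, the derivatives being taken at `(r, θ, ϱ, ϑ)`. -/
def initialPoint {d : ℕ} (ψ : Triple d → ℝ) (r : ℝ) (θ : Ang d) (ϱ : ℝ) (ϑ : Ang d) : Phase d :=
  (r, θ, deriv (fun r' => phase ψ r' θ ϱ ϑ) r, gradient (fun θ' => phase ψ r θ' ϱ ϑ) θ)

/-- The point `(∂_ϱ φ, ϑ, ϱ, -∂_ϑ φ)`, the derivatives being taken at `(r, θ, ϱ, ϑ)`. -/
def finalPoint {d : ℕ} (ψ : Triple d → ℝ) (r : ℝ) (θ : Ang d) (ϱ : ℝ) (ϑ : Ang d) : Phase d :=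
  (deriv (fun ϱ' => phase ψ r θ ϱ' ϑ) ϱ, ϑ, ϱ, - gradient (fun ϑ' => phase ψ r θ ϱ ϑ') ϑ)

end ConicScattering

end

/-! The function ψ is a renormalised distance to infinity (a Busemann function). A geodesic ray from
(r, θ) with asymptotic angle ϑ is written as a graph over τ = r/r', where r' is the running radius,
so that it joins ϑ at τ = 0 to θ at τ = 1. With v the τ-velocity and q = g(r/τ)(v, v), its length
minus its radial displacement is r ∫₀¹ q / (1 + √(1 + τ²q)) dτ. This Lagrangian is regular at τ = 0,
so infinity becomes an ordinary end point, and ψ is r times one minus the integral.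

The first variation formula (`fderiv_psiFam`) gives ∂_θψ = -r · (momentum at τ = 1) and ∂_ϑψ = r ·
(momentum at τ = 0). A tail of a ray is again a ray with the same ϑ, so ψ is known along it, and
differentiating there gives ∂_rψ = 1/√(1 + q) at τ = 1 (`fderiv_psi_radial`). These formulas contain
the eikonal equation. Reparametrised by time, the same ray is a Hamiltonian trajectory of energy
one, and R - 2sρ tends to ψ along it (`IsAsymptoticPath.isScatteringLimit`).

Uniformity comes from solving for all base points (r, θ) at once. Bounded continuous functions of a
base point and of τ form a Banach algebra. In it the metric along a path is ḡ + μ · dev with μ =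
r^{-ν}, and the symbol decay of g - ḡ says exactly that dev is bounded with all its derivatives in
the relative radius and the angles (`devFam_bound`). The integrated Euler–Lagrange equation together
with the end condition is a smooth equation `bvp` = 0 with finitely many parameters: μ, the relative
displacement s of the radius, and the displacements h, k of θ, ϑ. Constant paths solve it on the
diagonal, its linearisation at the origin is explicitly invertible (`exists_bvp_equiv`), and one
application of the implicit function theorem gives solutions smooth in the parameters, uniformly
over base points. Uniqueness of small solutions shows that different base points give the same ray
for the same data (`eq_of_isAsymptoticPath`, `Consistent`), so that r∂_r becomes ∂_s and bounds on a
compact set of parameters become symbol estimates (`Consistent.isSymbol`).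

The general ε and both signs follow from homogeneity of the symbol: radius scaled by ε, momenta by a
factor β, time by ε/β, with β < 0 for incoming rays. Points of the strong regions are reached
because ϑ ↦ end momentum is locally onto, uniformly in the base point (`exists_endMom_eq`). The
expansions are Hadamard's lemma applied twice in ϑ - θ. The first-order coefficient of the remainder
vanishes at μ = 0, hence is divisible by μ, which yields the gain r^{-ν}
(`Consistent.hasExpansion`). -/

noncomputable section

namespace ConicScattering

/-! ### Calculus of iterated partial derivatives. -/

section IterPartial

variable {X Y : Type*} [NormedAddCommGroup X] [NormedSpace ℝ X]
  [NormedAddCommGroup Y] [NormedSpace ℝ Y]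

@[simp] theorem iterPartial_nil (f : X → ℝ) : iterPartial [] f = f := rfl

theorem iterPartial_cons (v : X) (L : List X) (f : X → ℝ) :
    iterPartial (v :: L) f = fun x => fderiv ℝ (iterPartial L f) x v := rfl

theorem iterPartial_append (L L' : List X) (f : X → ℝ) :
    iterPartial (L ++ L') f = iterPartial L (iterPartial L' f) := by
  simp [iterPartial, List.foldr_append]

theorem contDiffOn_fderiv_apply {f : X → Y} {O : Set X} (hO : IsOpen O)
    (hf : ContDiffOn ℝ ∞ f O) (v : X) : ContDiffOn ℝ ∞ (fun x => fderiv ℝ f x v) O :=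
  ((contDiffOn_infty_iff_fderiv_of_isOpen hO).1 hf).2.clm_apply contDiffOn_const

theorem contDiffOn_iterPartial {f : X → ℝ} {O : Set X} (hO : IsOpen O)
    (hf : ContDiffOn ℝ ∞ f O) (L : List X) : ContDiffOn ℝ ∞ (iterPartial L f) O := by
  induction L with
  | nil => exact hf
  | cons v L ih => exact contDiffOn_fderiv_apply hO ih v

theorem iterPartial_congr {f g : X → ℝ} {O : Set X} (hO : IsOpen O) (h : Set.EqOn f g O)
    (L : List X) : Set.EqOn (iterPartial L f) (iterPartial L g) O := by
  induction L with
  | nil => exact h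
  | cons v L ih =>
    intro x hx
    have : iterPartial L f =ᶠ[𝓝 x] iterPartial L g :=
      Filter.eventuallyEq_of_mem (hO.mem_nhds hx) ih
    simp only [iterPartial_cons, this.fderiv_eq]

/-- Iterated partial derivatives of smooth functions commute. -/
theorem iterPartial_perm {f : X → ℝ} {O : Set X} (hO : IsOpen O) (hf : ContDiffOn ℝ ∞ f O)
    {L L' : List X} (h : L.Perm L') : Set.EqOn (iterPartial L f) (iterPartial L' f) O := by
  induction h with
  | nil => exact fun _ _ => rfl
  | cons v _ ih =>
    intro x hx
    exact iterPartial_congr hO ih [v] hx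
  | swap v w L =>
    intro x hx
    have hc := contDiffOn_iterPartial hO hf L
    have hat : ContDiffAt ℝ ∞ (iterPartial L f) x := hc.contDiffAt (hO.mem_nhds hx)
    have hs : IsSymmSndFDerivAt ℝ (iterPartial L f) x := hat.isSymmSndFDerivAt (by simpa using WithTop.coe_le_coe.2 (le_top : (2 : ℕ∞) ≤ ⊤))
    have hd : DifferentiableAt ℝ (fderiv ℝ (iterPartial L f)) x :=
      (((contDiffOn_infty_iff_fderiv_of_isOpen hO).1 hc).2.contDiffAt
        (hO.mem_nhds hx)).differentiableAt (by simp)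
    simp only [iterPartial_cons]
    rw [fderiv_clm_apply hd (differentiableAt_const _),
      fderiv_clm_apply hd (differentiableAt_const _)]
    simpa using hs w v
  | trans _ _ ih₁ ih₂ => exact ih₁.trans ih₂

theorem iterPartial_comp_affine {f : X → ℝ} {O : Set X} (hO : IsOpen O)
    (hf : ContDiffOn ℝ ∞ f O) (T : Y →L[ℝ] X) (c : X) (L : List Y) :
    Set.EqOn (iterPartial L (fun y => f (T y + c)))
      (fun y => iterPartial (L.map T) f (T y + c)) ((fun y => T y + c) ⁻¹' O) := by
  have hO' : IsOpen ((fun y => T y + c) ⁻¹' O) := hO.preimage (by fun_prop)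
  induction L with
  | nil => exact fun _ _ => rfl
  | cons v L ih =>
    intro y hy
    have h1 : iterPartial L (fun y => f (T y + c)) =ᶠ[𝓝 y]
        fun y => iterPartial (L.map T) f (T y + c) :=
      Filter.eventuallyEq_of_mem (hO'.mem_nhds hy) ih
    simp only [iterPartial_cons, List.map_cons, h1.fderiv_eq]
    have hd : DifferentiableAt ℝ (iterPartial (L.map T) f) (T y + c) :=
      ((contDiffOn_iterPartial hO hf _).contDiffAt (hO.mem_nhds hy)).differentiableAt (by simp)
    have h2 : HasFDerivAt (fun y => T y + c) T y := T.hasFDerivAt.add_const c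
    have h3 := HasFDerivAt.comp y hd.hasFDerivAt h2
    have h4 := h3.fderiv
    simp only [Function.comp_def] at h4
    rw [h4]; rfl

theorem iterPartial_const_mul {f : X → ℝ} {O : Set X} (hO : IsOpen O)
    (hf : ContDiffOn ℝ ∞ f O) (c : ℝ) (L : List X) :
    Set.EqOn (iterPartial L (fun x => c * f x)) (fun x => c * iterPartial L f x) O := by
  induction L with
  | nil => exact fun _ _ => rfl
  | cons v L ih =>
    intro x hx
    have h1 := Filter.eventuallyEq_of_mem (hO.mem_nhds hx) ih
    simp only [iterPartial_cons, h1.fderiv_eq]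
    have hd : DifferentiableAt ℝ (iterPartial L f) x :=
      ((contDiffOn_iterPartial hO hf _).contDiffAt (hO.mem_nhds hx)).differentiableAt (by simp)
    rw [fderiv_const_mul hd]; simp

/-- Scaling the directions of an iterated partial derivative. -/
theorem iterPartial_map_smul {ι : Type*} {f : X → ℝ} {O : Set X} (hO : IsOpen O)
    (hf : ContDiffOn ℝ ∞ f O) (c : ι → ℝ) (e : ι → X) (L : List ι) :
    Set.EqOn (iterPartial (L.map fun a => c a • e a) f)
      (fun x => (L.map c).prod * iterPartial (L.map e) f x) O := by
  induction L with
  | nil => intro x _; simp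
  | cons a L ih =>
    intro x hx
    have h1 := Filter.eventuallyEq_of_mem (hO.mem_nhds hx) ih
    simp only [iterPartial_cons, List.map_cons, h1.fderiv_eq, List.prod_cons]
    have hd : DifferentiableAt ℝ (iterPartial (L.map e) f) x :=
      ((contDiffOn_iterPartial hO hf _).contDiffAt (hO.mem_nhds hx)).differentiableAt (by simp)
    rw [fderiv_const_mul hd]; simp; ring

/-- Derivatives commute with the functional, so a bound on the vector-valued derivatives of `A` over
a compact set serves every functional of norm at most one. Applied to evaluation functionals, this
is the source of uniformity in the base point and in ε. -/
theorem exists_bound_iterPartial_clm_comp {A : X → Y} {O K : Set X} (hO : IsOpen O)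
    (hA : ContDiffOn ℝ ∞ A O) (hK : IsCompact K) (hKO : K ⊆ O) (L : List X) :
    ∃ C : ℝ, ∀ φ : Y →L[ℝ] ℝ, ‖φ‖ ≤ 1 → ∀ x ∈ K, |iterPartial L (fun x => φ (A x)) x| ≤ C := by
  induction L using List.reverseRecOn generalizing A with
  | nil =>
    obtain ⟨C, hC⟩ := hK.bddAbove_image (hA.continuousOn.mono hKO).norm
    refine ⟨C, fun φ hφ x hx => ?_⟩
    calc |φ (A x)| ≤ ‖φ‖ * ‖A x‖ := φ.le_opNorm _
      _ ≤ 1 * C := by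
        gcongr
        exact hC ⟨x, hx, rfl⟩
      _ = C := one_mul C
  | append_singleton L v ih =>
    obtain ⟨C, hC⟩ := ih (contDiffOn_fderiv_apply hO hA v)
    refine ⟨C, fun φ hφ x hx => ?_⟩
    rw [iterPartial_append]
    have h : Set.EqOn (iterPartial [v] fun x => φ (A x)) (fun x => φ (fderiv ℝ A x v)) O := by
      intro x hx
      have hd : DifferentiableAt ℝ A x :=
        (hA.contDiffAt (hO.mem_nhds hx)).differentiableAt (by simp)
      have := (φ.hasFDerivAt.comp x hd.hasFDerivAt).fderiv
      simp only [Function.comp_def] at this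
      simp [iterPartial_cons, this]
    rw [iterPartial_congr hO h L (hKO hx)]
    exact hC φ hφ x hx

end IterPartial

/-! ### Smooth dependence of integrals on parameters. -/

section ParametricIntegral

variable {E Y : Type} [NormedAddCommGroup E] [NormedSpace ℝ E]
  [NormedAddCommGroup Y] [NormedSpace ℝ Y]

/-- Differentiation under the integral sign. The dominating constant comes from compactness of `[0,
1]`: the tube lemma extends the bound on the derivative from the segment over `p` to a product
neighbourhood. -/
theorem hasFDerivAt_integral_unitInterval {F : E × ℝ → Y} {W : Set (E × ℝ)}
    (hW : IsOpen W) (hF : ContDiffOn ℝ 1 F W) (p : E)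
    (hp : ∀ t ∈ Set.Icc (0 : ℝ) 1, (p, t) ∈ W) :
    HasFDerivAt (fun q => ∫ t in (0 : ℝ)..1, F (q, t))
      (∫ t in (0 : ℝ)..1, (fderiv ℝ F (p, t)).comp (ContinuousLinearMap.inl ℝ E ℝ)) p := by
  have hF' : ContinuousOn (fderiv ℝ F) W := hF.continuousOn_fderiv_of_isOpen hW le_rfl
  obtain ⟨C, hC⟩ : ∃ C, ∀ t ∈ Set.Icc (0 : ℝ) 1, ‖fderiv ℝ F (p, t)‖ < C := by
    have hc : ContinuousOn (fun t => ‖fderiv ℝ F (p, t)‖) (Set.Icc (0 : ℝ) 1) :=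
      (hF'.comp (by fun_prop) hp).norm
    obtain ⟨C, hC⟩ := isCompact_Icc.bddAbove_image hc
    exact ⟨C + 1, fun t ht => lt_of_le_of_lt (hC ⟨t, ht, rfl⟩) (by linarith)⟩
  have hopen : IsOpen (W ∩ (fun x => ‖fderiv ℝ F x‖) ⁻¹' Set.Iio C) :=
    hF'.norm.isOpen_inter_preimage hW isOpen_Iio
  obtain ⟨u, w, hu, hw, hpu, hIw, huw⟩ := generalized_tube_lemma (isCompact_singleton (x := p))
    (isCompact_Icc (a := (0 : ℝ)) (b := 1)) hopen (by
      rintro ⟨q, t⟩ ⟨hq, ht⟩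
      obtain rfl : q = p := hq
      exact ⟨hp t ht, hC t ht⟩)
  have hpu' : p ∈ u := hpu rfl
  have hsub : ∀ t ∈ Set.uIoc (0 : ℝ) 1, t ∈ Set.Icc (0 : ℝ) 1 := by
    intro t ht
    rw [Set.uIoc_of_le zero_le_one] at ht
    exact ⟨ht.1.le, ht.2⟩
  have hcont : ∀ q ∈ u, ContinuousOn (fun t => F (q, t)) (Set.uIcc (0 : ℝ) 1) := by
    intro q hq
    rw [Set.uIcc_of_le zero_le_one]
    exact hF.continuousOn.comp (by fun_prop) fun t ht => (huw ⟨hq, hIw ht⟩).1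
  refine (intervalIntegral.hasFDerivAt_integral_of_dominated_of_fderiv_le
    (bound := fun _ => C) (F' := fun q t => (fderiv ℝ F (q, t)).comp
      (ContinuousLinearMap.inl ℝ E ℝ)) (hu.mem_nhds hpu') ?_ ?_ ?_ ?_ ?_ ?_)
  · filter_upwards [hu.mem_nhds hpu'] with q hq
    exact (hcont q hq).intervalIntegrable.def'.aestronglyMeasurable
  · exact (hcont p hpu').intervalIntegrable
  · have : ContinuousOn (fun t => (fderiv ℝ F (p, t)).comp (ContinuousLinearMap.inl ℝ E ℝ))
        (Set.uIcc (0 : ℝ) 1) := by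
      rw [Set.uIcc_of_le zero_le_one]
      exact (hF'.comp (by fun_prop) hp).clm_comp continuousOn_const
    exact this.intervalIntegrable.def'.aestronglyMeasurable
  · refine Filter.Eventually.of_forall fun t ht q hq => ?_
    calc _ ≤ ‖fderiv ℝ F (q, t)‖ * ‖ContinuousLinearMap.inl ℝ E ℝ‖ :=
          ContinuousLinearMap.opNorm_comp_le _ _
      _ ≤ C * 1 := by
          have := (huw (Set.mk_mem_prod hq (hIw (hsub t ht)))).2
          gcongr
          · exact (norm_nonneg _).trans this.le
          · exact this.le
          · exact ContinuousLinearMap.norm_inl_le_one ℝ E ℝ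
      _ = C := mul_one C
  · exact intervalIntegrable_const
  · refine Filter.Eventually.of_forall fun t ht q hq => ?_
    have hm : (q, t) ∈ W := (huw (Set.mk_mem_prod hq (hIw (hsub t ht)))).1
    have h1 := ((hF.contDiffAt (hW.mem_nhds hm)).differentiableAt (by simp)).hasFDerivAt
    have h2 : HasFDerivAt (fun q : E => (q, t)) (ContinuousLinearMap.inl ℝ E ℝ) q := by
      simpa using hasFDerivAt_prodMk_left q t
    exact h1.comp q h2

/-- Integrals over `[0, 1]` depend smoothly on parameters. -/
theorem contDiffOn_integral_unitInterval {F : E × ℝ → Y} {W : Set (E × ℝ)} {O : Set E}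
    (hW : IsOpen W) (hO : IsOpen O) (hF : ContDiffOn ℝ ∞ F W)
    (hOW : ∀ p ∈ O, ∀ t ∈ Set.Icc (0 : ℝ) 1, (p, t) ∈ W) :
    ContDiffOn ℝ ∞ (fun q => ∫ t in (0 : ℝ)..1, F (q, t)) O := by
  rw [contDiffOn_infty]
  intro n
  induction n generalizing Y with
  | zero =>
    refine contDiffOn_zero.2 fun p hp => ?_
    exact (hasFDerivAt_integral_unitInterval hW (hF.of_le (by simp)) p
      (hOW p hp)).continuousAt.continuousWithinAt
  | succ n ih =>
    have hd : ∀ p ∈ O, HasFDerivAt (fun q => ∫ t in (0 : ℝ)..1, F (q, t))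
      (∫ t in (0 : ℝ)..1, (fderiv ℝ F (p, t)).comp (ContinuousLinearMap.inl ℝ E ℝ)) p :=
      fun p hp => hasFDerivAt_integral_unitInterval hW (hF.of_le (by simp)) p (hOW p hp)
    push_cast
    rw [contDiffOn_succ_iff_hasFDerivWithinAt_of_uniqueDiffOn hO.uniqueDiffOn]
    refine ⟨by simp, _, ?_, fun p hp => (hd p hp).hasFDerivWithinAt⟩
    refine ih (F := fun x => (fderiv ℝ F x).comp (ContinuousLinearMap.inl ℝ E ℝ)) ?_
    exact ((contDiffOn_infty_iff_fderiv_of_isOpen hW).1 hF).2.clm_comp contDiffOn_const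

end ParametricIntegral

end ConicScattering

namespace ConicScattering

/-! ### Superposition operators on bounded continuous functions. -/

section Superposition

open BoundedContinuousFunction

variable {J ι : Type} [TopologicalSpace J] [Fintype ι] [DecidableEq ι]

/-- A family of functions on the ball of radius `b` of `ℝ^ι`, indexed by a topological space, all
of whose iterated partial derivatives are bounded uniformly in the index and jointly continuous. -/
structure UnifSmooth (b : ℝ) (f : J → (ι → ℝ) → ℝ) : Prop where
  smooth : ∀ j, ContDiffOn ℝ ∞ (f j) (Metric.ball 0 b)
  bdd : ∀ L : List ι, ∃ C : ℝ, ∀ j, ∀ y ∈ Metric.ball (0 : ι → ℝ) b,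
    |iterPartial (L.map fun a => (Pi.single a 1 : ι → ℝ)) (f j) y| ≤ C
  cont : ∀ L : List ι, ContinuousOn
    (fun q : J × (ι → ℝ) => iterPartial (L.map fun a => (Pi.single a 1 : ι → ℝ)) (f q.1) q.2)
    (Set.univ ×ˢ Metric.ball 0 b)

/-- The partial derivative of every member of a family. -/
def partialFam (f : J → (ι → ℝ) → ℝ) (a : ι) : J → (ι → ℝ) → ℝ :=
  fun j y => fderiv ℝ (f j) y (Pi.single a 1)

theorem UnifSmooth.partialFam {b : ℝ} {f : J → (ι → ℝ) → ℝ} (hf : UnifSmooth b f) (a : ι) :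
    UnifSmooth b (partialFam f a) := by
  have key : ∀ (L : List ι) (j : J),
      iterPartial (L.map fun a => (Pi.single a 1 : ι → ℝ)) (ConicScattering.partialFam f a j)
        = iterPartial ((L ++ [a]).map fun a => (Pi.single a 1 : ι → ℝ)) (f j) := by
    intro L j
    rw [List.map_append, iterPartial_append]; rfl
  refine ⟨fun j => contDiffOn_fderiv_apply Metric.isOpen_ball (hf.smooth j) _, fun L => ?_,
    fun L => ?_⟩
  · simpa only [key] using hf.bdd (L ++ [a])
  · simpa only [key] using hf.cont (L ++ [a])

theorem clm_pi_apply_eq_sum (T : (ι → ℝ) →L[ℝ] ℝ) (h : ι → ℝ) :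
    T h = ∑ a, T (Pi.single a 1) * h a := by
  conv_lhs => rw [pi_eq_sum_univ' h]
  simp [map_sum, mul_comm]

theorem clm_pi_opNorm_le (T : (ι → ℝ) →L[ℝ] ℝ) : ‖T‖ ≤ ∑ a, |T (Pi.single a 1)| := by
  refine T.opNorm_le_bound (Finset.sum_nonneg fun _ _ => abs_nonneg _) fun h => ?_
  rw [clm_pi_apply_eq_sum T h, Finset.sum_mul]
  refine (Finset.abs_sum_le_sum_abs _ _).trans (Finset.sum_le_sum fun a _ => ?_)
  rw [abs_mul]
  gcongr
  exact norm_le_pi_norm h a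

theorem UnifSmooth.lipschitz {b : ℝ} {f : J → (ι → ℝ) → ℝ} (hf : UnifSmooth b f) :
    ∃ C : ℝ, 0 ≤ C ∧ ∀ j, ∀ x ∈ Metric.ball (0 : ι → ℝ) b, ∀ y ∈ Metric.ball (0 : ι → ℝ) b,
      |f j y - f j x| ≤ C * ‖y - x‖ := by
  choose C hC using fun a => hf.bdd [a]
  refine ⟨∑ a, |C a|, Finset.sum_nonneg fun _ _ => abs_nonneg _, fun j x hx y hy => ?_⟩
  refine (convex_ball (0 : ι → ℝ) b).norm_image_sub_le_of_norm_fderiv_le (𝕜 := ℝ) (f := f j)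
    (fun z hz => ((hf.smooth j).contDiffAt (Metric.isOpen_ball.mem_nhds hz)).differentiableAt
      (by simp)) (fun z hz => ?_) hx hy
  exact (clm_pi_opNorm_le _).trans (Finset.sum_le_sum fun a _ => (hC a j z hz).trans (le_abs_self _))

/-- The remainder is controlled by the Lipschitz constants of the first partial derivatives, which
do not depend on the index. -/
theorem UnifSmooth.taylor {b : ℝ} {f : J → (ι → ℝ) → ℝ} (hf : UnifSmooth b f) :
    ∃ C : ℝ, 0 ≤ C ∧ ∀ j, ∀ x ∈ Metric.ball (0 : ι → ℝ) b, ∀ y ∈ Metric.ball (0 : ι → ℝ) b,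
      |f j y - f j x - ∑ a, ConicScattering.partialFam f a j x * (y a - x a)|
        ≤ C * ‖y - x‖ * ‖y - x‖ := by
  choose C hC0 hC using fun a => (hf.partialFam a).lipschitz
  refine ⟨∑ a, C a, Finset.sum_nonneg fun a _ => hC0 a, fun j x hx y hy => ?_⟩
  have hs : segment ℝ x y ⊆ Metric.ball (0 : ι → ℝ) b := (convex_ball _ _).segment_subset hx hy
  have h := (convex_segment x y).norm_image_sub_le_of_norm_hasFDerivWithin_le' (𝕜 := ℝ)
    (f := f j) (f' := fun z => fderiv ℝ (f j) z) (φ := fderiv ℝ (f j) x)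
    (C := (∑ a, C a) * ‖y - x‖)
    (fun z hz => (((hf.smooth j).contDiffAt (Metric.isOpen_ball.mem_nhds (hs hz))).differentiableAt
      (by simp)).hasFDerivAt.hasFDerivWithinAt) (fun z hz => ?_)
    (left_mem_segment ℝ x y) (right_mem_segment ℝ x y)
  · rw [clm_pi_apply_eq_sum] at h
    simpa [ConicScattering.partialFam] using h
  · refine (clm_pi_opNorm_le _).trans ?_
    rw [Finset.sum_mul]
    refine Finset.sum_le_sum fun a _ => ?_
    refine (hC a j x hx z (hs hz)).trans ?_
    gcongr
    · exact hC0 a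
    · exact norm_sub_le_of_mem_segment hz

open Classical in
/-- The superposition operator `x ↦ (j ↦ f j (x j))` of a family of functions. -/
def superpose (f : J → (ι → ℝ) → ℝ) (x : ι → J →ᵇ ℝ) : J →ᵇ ℝ :=
  -- The value `0` is a default; it does not occur for uniformly smooth `f` and `x` in the ball, by
  -- `superpose_apply`.
  if h : Continuous (fun j => f j fun a => x a j) ∧ ∃ C, ∀ j, ‖f j fun a => x a j‖ ≤ C then
    BoundedContinuousFunction.ofNormedAddCommGroup (fun j => f j fun a => x a j) h.1
      h.2.choose h.2.choose_spec
  else 0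

theorem eval_mem_ball {b : ℝ} {x : ι → J →ᵇ ℝ} (hx : x ∈ Metric.ball 0 b) (j : J) :
    (fun a => x a j) ∈ Metric.ball (0 : ι → ℝ) b := by
  rw [mem_ball_zero_iff] at hx ⊢
  refine lt_of_le_of_lt ?_ hx
  refine (pi_norm_le_iff_of_nonneg (norm_nonneg _)).2 fun a => ?_
  exact ((x a).norm_coe_le_norm j).trans (norm_le_pi_norm x a)

theorem superpose_apply {b : ℝ} {f : J → (ι → ℝ) → ℝ} (hf : UnifSmooth b f)
    {x : ι → J →ᵇ ℝ} (hx : x ∈ Metric.ball 0 b) (j : J) :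
    superpose f x j = f j fun a => x a j := by
  have h : Continuous (fun j => f j fun a => x a j) ∧ ∃ C, ∀ j, ‖f j fun a => x a j‖ ≤ C := by
    constructor
    · have h1 : Continuous fun j : J => (j, fun a => x a j) := by fun_prop
      have h2 := hf.cont []
      simp only [List.map_nil, iterPartial_nil] at h2
      have h3 := h2.comp (f := fun j : J => (j, fun a => x a j)) (s := Set.univ) h1.continuousOn
        fun j _ => Set.mk_mem_prod (Set.mem_univ _) (eval_mem_ball hx j)
      exact continuousOn_univ.1 h3
    · obtain ⟨C, hC⟩ := hf.bdd []
      exact ⟨C, fun j => hC j _ (eval_mem_ball hx j)⟩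
  rw [superpose, dif_pos h]; rfl

/-- Fréchet differentiability in the sup norm is the Taylor estimate with a remainder uniform in the
index. The derivative is again built from superposition operators, so smoothness of every order
follows by induction. -/
theorem UnifSmooth.hasFDerivAt_superpose {b : ℝ} {f : J → (ι → ℝ) → ℝ} (hf : UnifSmooth b f)
    {x : ι → J →ᵇ ℝ} (hx : x ∈ Metric.ball 0 b) :
    HasFDerivAt (superpose f)
      (∑ a, (ContinuousLinearMap.mul ℝ (J →ᵇ ℝ)
        (superpose (ConicScattering.partialFam f a) x)).comp
          (ContinuousLinearMap.proj (R := ℝ) (φ := fun _ : ι => J →ᵇ ℝ) a)) x := by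
  obtain ⟨C, hC0, hC⟩ := hf.taylor
  rw [hasFDerivAt_iff_isLittleO]
  have hO : (fun y : ι → J →ᵇ ℝ => superpose f y - superpose f x -
      (∑ a, (ContinuousLinearMap.mul ℝ (J →ᵇ ℝ)
        (superpose (ConicScattering.partialFam f a) x)).comp
          (ContinuousLinearMap.proj (R := ℝ) (φ := fun _ : ι => J →ᵇ ℝ) a)) (y - x)) =O[𝓝 x]
      fun y => ‖y - x‖ ^ 2 := by
    refine Asymptotics.IsBigO.of_bound C ?_
    filter_upwards [Metric.isOpen_ball.mem_nhds hx] with y hy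
    rw [norm_pow, norm_norm]
    refine (BoundedContinuousFunction.norm_le (by positivity)).2 fun j => ?_
    have h := hC j _ (eval_mem_ball hx j) _ (eval_mem_ball hy j)
    have hn : ‖(fun a => y a j) - fun a => x a j‖ ≤ ‖y - x‖ := by
      refine (pi_norm_le_iff_of_nonneg (norm_nonneg _)).2 fun a => ?_
      exact ((y a - x a).norm_coe_le_norm j).trans (norm_le_pi_norm (y - x) a)
    have e : (superpose f y - superpose f x -
      (∑ a, (ContinuousLinearMap.mul ℝ (J →ᵇ ℝ)
        (superpose (ConicScattering.partialFam f a) x)).comp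
          (ContinuousLinearMap.proj (R := ℝ) (φ := fun _ : ι => J →ᵇ ℝ) a)) (y - x)) j
        = (f j fun a => y a j) - (f j fun a => x a j)
          - ∑ a, ConicScattering.partialFam f a j (fun a => x a j) * (y a j - x a j) := by
      simp [superpose_apply hf hx, superpose_apply hf hy, superpose_apply (hf.partialFam _) hx]
    rw [e]
    calc _ ≤ C * ‖(fun a => y a j) - fun a => x a j‖ * ‖(fun a => y a j) - fun a => x a j‖ := h
      _ ≤ C * ‖y - x‖ * ‖y - x‖ := by gcongr
      _ = C * ‖y - x‖ ^ 2 := by ring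
  refine hO.trans_isLittleO ?_
  have := Asymptotics.isLittleO_norm_pow_id (E' := ι → J →ᵇ ℝ) one_lt_two
  exact (this.comp_tendsto (k := fun y => y - x)
    (by simpa using (continuous_id.sub continuous_const).tendsto (x := x) (f := fun y => y - x)))

/-- Superposition operators of uniformly smooth families are smooth. -/
theorem UnifSmooth.contDiffOn_superpose {b : ℝ} {f : J → (ι → ℝ) → ℝ} (hf : UnifSmooth b f) :
    ContDiffOn ℝ ∞ (superpose f : (ι → J →ᵇ ℝ) → J →ᵇ ℝ) (Metric.ball 0 b) := by
  rw [contDiffOn_infty]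
  intro n
  induction n generalizing f with
  | zero =>
    exact contDiffOn_zero.2 fun x hx =>
      (hf.hasFDerivAt_superpose hx).continuousAt.continuousWithinAt
  | succ n ih =>
    push_cast
    rw [contDiffOn_succ_iff_hasFDerivWithinAt_of_uniqueDiffOn Metric.isOpen_ball.uniqueDiffOn]
    refine ⟨by simp, _, ?_, fun x hx => (hf.hasFDerivAt_superpose hx).hasFDerivWithinAt⟩
    refine ContDiffOn.sum fun a _ => ?_
    refine ContDiffOn.clm_comp ?_ contDiffOn_const
    exact (ContinuousLinearMap.contDiff _).comp_contDiffOn (ih (hf.partialFam a))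

end Superposition

end ConicScattering

/-! ### The metric near infinity as a uniformly smooth family. -/

namespace ConicScattering

variable {d : ℕ}

/-- The angular part of a coordinate vector `(s, x)`, the index `none` standing for `s`. -/
def angPart : (Option (Fin d) → ℝ) →L[ℝ] Ang d :=
  ((EuclideanSpace.equiv (Fin d) ℝ).symm : (Fin d → ℝ) →L[ℝ] Ang d).comp
    (ContinuousLinearMap.pi fun a => ContinuousLinearMap.proj (some a))

@[simp] theorem angPart_apply (y : Option (Fin d) → ℝ) (a : Fin d) : angPart y a = y (some a) := rfl

theorem angPart_single_none : angPart (Pi.single none 1 : Option (Fin d) → ℝ) = 0 := by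
  ext a; simp

theorem angPart_single_some (a : Fin d) :
    angPart (Pi.single (some a) 1 : Option (Fin d) → ℝ) = unitVec a := by
  ext c
  by_cases h : c = a
  · subst h; simp [unitVec]
  · simp [unitVec, h]

/-- Base points `(r, θ)` with `r > 2 RM` and `θ ∈ K`, used as a discrete index set. -/
def Idx (M : ConicChart d) (K : Set (Ang d)) : Type := {i : ℝ × Ang d // 2 * M.RM < i.1 ∧ i.2 ∈ K}

/-- With the discrete topology no continuity in the base point has to be checked, only uniform
bounds. Regularity in (r, θ) is recovered later from uniqueness of the solutions. -/
instance (M : ConicChart d) (K : Set (Ang d)) : TopologicalSpace (Idx M K) := ⊥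

instance (M : ConicChart d) (K : Set (Ang d)) : DiscreteTopology (Idx M K) := ⟨rfl⟩

/-- Base points together with a rescaled time in `[0, 1]`. -/
abbrev PathIdx (M : ConicChart d) (K : Set (Ang d)) : Type := Idx M K × unitInterval

variable (M : ConicChart d) (K : Set (Ang d))

/-- Coefficients of the limiting metric near the base points. -/
def barFam (l m : Fin d) : PathIdx M K → (Option (Fin d) → ℝ) → ℝ :=
  fun j y => M.gbar (angPart y + j.1.1.2) l m

/-- The difference between the rescaled metric and the limiting metric, normalized by `r ^ ν`. -/
def devFam (l m : Fin d) : PathIdx M K → (Option (Fin d) → ℝ) → ℝ :=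
  -- At τ = 0 the radius r/τ is infinite. The value `0` is the limit there, since the family is
  -- O(τ^ν).
  fun j y => if (j.2 : ℝ) = 0 then 0 else
    j.1.1.1 ^ M.ν * (M.g (j.1.1.1 / j.2 * (1 + y none)) (angPart y + j.1.1.2) l m
      - M.gbar (angPart y + j.1.1.2) l m)

theorem continuous_radius : Continuous fun j : PathIdx M K => j.1.1.1 :=
  (continuous_of_discreteTopology (f := fun i : Idx M K => i.1.1)).comp continuous_fst

theorem continuous_angle : Continuous fun j : PathIdx M K => j.1.1.2 :=
  (continuous_of_discreteTopology (f := fun i : Idx M K => i.1.2)).comp continuous_fst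

variable {M K}

/-- Gives one radius `b` for all base points, with all displaced angles inside one compact subset of
the chart, on which the decay constants of the metric are available. The bound 1/2 on `b` keeps the
relative radius 1 + s away from zero. -/
theorem exists_compact_nhd (hK : IsCompact K) (hKU : K ⊆ M.U) :
    ∃ b : ℝ, 0 < b ∧ b ≤ 1 / 2 ∧ ∃ K' : Set (Ang d), IsCompact K' ∧ K' ⊆ M.U ∧
      ∀ θ ∈ K, ∀ y ∈ Metric.ball (0 : Option (Fin d) → ℝ) b, angPart y + θ ∈ K' := by
  obtain ⟨δ, hδ, hsub⟩ := hK.exists_cthickening_subset_open M.isOpen_U hKU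
  have hc : Tendsto (fun y : Option (Fin d) → ℝ => angPart y) (𝓝 0) (𝓝 0) := by
    simpa using (angPart (d := d)).continuous.tendsto 0
  obtain ⟨b, hb, hball⟩ := Metric.mem_nhds_iff.1 (hc (Metric.ball_mem_nhds (0 : Ang d) hδ))
  refine ⟨min b (1 / 2), by positivity, min_le_right _ _, _, hK.cthickening, hsub, ?_⟩
  intro θ hθ y hy
  have h1 : angPart y ∈ Metric.ball (0 : Ang d) δ :=
    hball (Metric.ball_subset_ball (min_le_left _ _) hy)
  refine Metric.mem_cthickening_of_dist_le _ θ δ K hθ ?_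
  rw [dist_eq_norm, add_sub_cancel_right]
  exact (mem_ball_zero_iff.1 h1).le

theorem unifSmooth_barFam {b : ℝ} {K' : Set (Ang d)} (hK' : IsCompact K') (hK'U : K' ⊆ M.U)
    (hb : ∀ θ ∈ K, ∀ y ∈ Metric.ball (0 : Option (Fin d) → ℝ) b, angPart y + θ ∈ K')
    (l m : Fin d) : UnifSmooth b (barFam M K l m) := by
  have hs := M.gbar_smooth l m
  have hmem : ∀ (j : PathIdx M K) (y), y ∈ Metric.ball (0 : Option (Fin d) → ℝ) b →
      angPart y + j.1.1.2 ∈ M.U := fun j y hy => hK'U (hb _ j.1.2.2 y hy)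
  have key : ∀ (L : List (Option (Fin d))) (j : PathIdx M K) (y),
      y ∈ Metric.ball (0 : Option (Fin d) → ℝ) b →
      iterPartial (L.map fun a => (Pi.single a 1 : Option (Fin d) → ℝ)) (barFam M K l m j) y
        = iterPartial ((L.map fun a => (Pi.single a 1 : Option (Fin d) → ℝ)).map angPart)
          (fun θ => M.gbar θ l m) (angPart y + j.1.1.2) := by
    intro L j y hy
    exact iterPartial_comp_affine M.isOpen_U hs angPart j.1.1.2 _ (hmem j y hy)
  have hL := fun L : List (Ang d) => (contDiffOn_iterPartial M.isOpen_U hs L).continuousOn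
  refine ⟨fun j => ?_, fun L => ?_, fun L => ?_⟩
  · exact hs.comp (t := M.U) (f := fun y => angPart y + j.1.1.2)
      (angPart.contDiff.add contDiff_const).contDiffOn fun y hy => hmem j y hy
  · obtain ⟨C, hC⟩ := hK'.bddAbove_image
      ((hL ((L.map fun a => (Pi.single a 1 : Option (Fin d) → ℝ)).map angPart)).mono hK'U).abs
    refine ⟨C, fun j y hy => ?_⟩
    rw [key L j y hy]
    exact hC ⟨_, hb _ j.1.2.2 y hy, rfl⟩
  · refine ContinuousOn.congr ?_ fun q hq => key L q.1 q.2 hq.2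
    refine (hL _).comp (f := fun q : PathIdx M K × (Option (Fin d) → ℝ) =>
      angPart q.2 + q.1.1.1.2) ?_ fun q hq => hmem q.1 q.2 hq.2
    exact ((angPart.continuous.comp continuous_snd).add
      ((continuous_angle M K).comp continuous_fst)).continuousOn

/-- Partial derivatives commute, so a mixed derivative may be brought to the radial-first order in
which the decay hypothesis is phrased. -/
theorem list_option_perm {α : Type*} (L : List (Option α)) :
    ∃ n : ℕ, ∃ l : List α, L.Perm (List.replicate n none ++ l.map some) := by
  induction L with
  | nil => exact ⟨0, [], by simp⟩
  | cons a L ih =>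
    obtain ⟨n, l, h⟩ := ih
    cases a with
    | none => exact ⟨n + 1, l, by simpa [List.replicate_succ] using h⟩
    | some a =>
      exact ⟨n, a :: l, (h.cons _).trans (by simpa using List.perm_middle.symm)⟩

/-- Scaling of the radial variable. -/
def scaleBase (c : ℝ) : (Option (Fin d) → ℝ) →L[ℝ] Base d :=
  (c • ContinuousLinearMap.proj (R := ℝ) (φ := fun _ : Option (Fin d) => ℝ) none).prod angPart

theorem devFam_eq {l m : Fin d} {j : PathIdx M K} (hj : (j.2 : ℝ) ≠ 0)
    (y : Option (Fin d) → ℝ) :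
    devFam M K l m j y = j.1.1.1 ^ M.ν *
      (fun x : Base d => M.g x.1 x.2 l m - M.gbar x.2 l m)
        (scaleBase (j.1.1.1 / j.2) y + (j.1.1.1 / j.2, j.1.1.2)) := by
  simp only [devFam, if_neg hj, scaleBase]
  simp [mul_add, add_comm]

theorem radius_pos (i : Idx M K) : 0 < i.1.1 := by
  have := i.2.1; have := M.RM_pos; linarith

/-- The base radius exceeds `2 * M.RM`, division by τ ≤ 1 increases it, and the relative
displacement costs at most a factor 1/2. -/
theorem dev_radius_gt {b : ℝ} (hb : b ≤ 1 / 2) (j : PathIdx M K) (hj : (j.2 : ℝ) ≠ 0)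
    {y : Option (Fin d) → ℝ} (hy : y ∈ Metric.ball (0 : Option (Fin d) → ℝ) b) :
    M.RM < j.1.1.1 / j.2 * (1 + y none) := by
  have hy' : |y none| < 1 / 2 :=
    lt_of_lt_of_le (lt_of_le_of_lt (norm_le_pi_norm y none) (mem_ball_zero_iff.1 hy)) hb
  have h1 : 1 / 2 < 1 + y none := by linarith [(abs_lt.1 hy').1]
  have h0 : 0 < (j.2 : ℝ) := lt_of_le_of_ne j.2.2.1 (Ne.symm hj)
  have h2 : j.1.1.1 ≤ j.1.1.1 / j.2 := by
    rw [le_div_iff₀ h0]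
    exact mul_le_of_le_one_right (radius_pos j.1).le j.2.2.2
  have := j.1.2.1
  have := M.RM_pos
  nlinarith

/-- Chain rule for the affine change of variables of `devFam_eq`: every relative radial derivative
produces a factor r/τ, every angular derivative a factor 1. -/
theorem iterPartial_devFam {b : ℝ} (hb2 : b ≤ 1 / 2)
    (hb : ∀ θ ∈ K, ∀ y ∈ Metric.ball (0 : Option (Fin d) → ℝ) b, angPart y + θ ∈ M.U)
    (l m : Fin d) (L : List (Option (Fin d))) :
    ∃ (n : ℕ) (α : List (Fin d)), ∀ j : PathIdx M K, (j.2 : ℝ) ≠ 0 →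
      ∀ y ∈ Metric.ball (0 : Option (Fin d) → ℝ) b,
      iterPartial (L.map fun a => (Pi.single a 1 : Option (Fin d) → ℝ)) (devFam M K l m j) y
        = j.1.1.1 ^ M.ν * ((j.1.1.1 / j.2) ^ n * basePartial n α
          (fun x => M.g x.1 x.2 l m - M.gbar x.2 l m)
            (j.1.1.1 / j.2 * (1 + y none), angPart y + j.1.1.2)) := by
  obtain ⟨n, α, hL⟩ := list_option_perm L
  refine ⟨n, α, fun j hj y hy => ?_⟩
  set H : Base d → ℝ := fun x => M.g x.1 x.2 l m - M.gbar x.2 l m with hH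
  have hO : IsOpen (Set.Ioi M.RM ×ˢ M.U) := isOpen_Ioi.prod M.isOpen_U
  have hHs : ContDiffOn ℝ ∞ H (Set.Ioi M.RM ×ˢ M.U) :=
    (M.g_smooth l m).sub ((M.gbar_smooth l m).comp contDiff_snd.contDiffOn fun x hx => hx.2)
  set c := j.1.1.1 / j.2 with hc
  have hpt : scaleBase c y + (c, j.1.1.2) = (c * (1 + y none), angPart y + j.1.1.2) := by
    simp [scaleBase, mul_add, add_comm]
  have hmem : scaleBase c y + (c, j.1.1.2) ∈ Set.Ioi M.RM ×ˢ M.U := by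
    rw [hpt]
    exact ⟨dev_radius_gt hb2 j hj hy, hb _ j.1.2.2 y hy⟩
  have hO' : IsOpen ((fun y => scaleBase c y + (c, j.1.1.2)) ⁻¹' (Set.Ioi M.RM ×ˢ M.U)) :=
    hO.preimage (by fun_prop)
  have hcomp : ContDiffOn ℝ ∞ (fun y => H (scaleBase c y + (c, j.1.1.2)))
      ((fun y => scaleBase c y + (c, j.1.1.2)) ⁻¹' (Set.Ioi M.RM ×ˢ M.U)) :=
    hHs.comp ((scaleBase c).contDiff.add contDiff_const).contDiffOn fun y hy => hy
  rw [show devFam M K l m j = fun y => j.1.1.1 ^ M.ν * H (scaleBase c y + (c, j.1.1.2)) from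
    funext fun y => devFam_eq hj y, iterPartial_const_mul hO' hcomp _ _ hmem]
  beta_reduce
  rw [iterPartial_comp_affine hO hHs _ _ _ hmem]
  beta_reduce
  have hvec : ∀ a : Option (Fin d), scaleBase c (Pi.single a 1) =
      (a.elim c fun _ => (1 : ℝ)) • (a.elim (1, 0) fun a => (0, unitVec a) : Base d) := by
    rintro (_ | a)
    · simp [scaleBase, angPart_single_none]
    · simp [scaleBase, angPart_single_some]
  rw [List.map_map, show (L.map ((scaleBase c) ∘ fun a => (Pi.single a 1 : Option (Fin d) → ℝ)))
    = L.map fun a => (a.elim c fun _ => (1 : ℝ)) •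
      (a.elim (1, 0) fun a => (0, unitVec a) : Base d) from List.map_congr_left fun a _ => hvec a,
    iterPartial_map_smul hO hHs _ _ _ hmem]
  beta_reduce
  rw [iterPartial_perm hO hHs (hL.map _) hmem, (hL.map _).prod_eq, hpt]
  simp [basePartial, Function.comp_def]

/-- The symbol estimate cancels the scaling: r^ν (r/τ)^n (r/τ)^{-ν-n} = τ^ν, and the remaining power
of 1 + s is bounded because 1 + s ≥ 1/2. -/
theorem devFam_bound {b : ℝ} (hb2 : b ≤ 1 / 2) {K' : Set (Ang d)} (hK' : IsCompact K')
    (hK'U : K' ⊆ M.U)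
    (hb : ∀ θ ∈ K, ∀ y ∈ Metric.ball (0 : Option (Fin d) → ℝ) b, angPart y + θ ∈ K')
    (l m : Fin d) (L : List (Option (Fin d))) : ∃ C : ℝ, 0 ≤ C ∧ ∀ j : PathIdx M K,
      ∀ y ∈ Metric.ball (0 : Option (Fin d) → ℝ) b,
      |iterPartial (L.map fun a => (Pi.single a 1 : Option (Fin d) → ℝ)) (devFam M K l m j) y|
        ≤ C * (j.2 : ℝ) ^ M.ν := by
  obtain ⟨n, α, h⟩ := iterPartial_devFam hb2 (fun θ hθ y hy => hK'U (hb θ hθ y hy)) l m L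
  obtain ⟨C, hC⟩ := M.decay K' hK' hK'U l m n α
  refine ⟨|C| * (1 / 2 : ℝ) ^ (-M.ν - n), by positivity, fun j y hy => ?_⟩
  by_cases hj : (j.2 : ℝ) = 0
  · have h0 : devFam M K l m j = fun _ => 0 * (0 : ℝ) := by
      funext y; simp [devFam, hj]
    rw [h0, iterPartial_const_mul isOpen_univ contDiffOn_const _ _ (Set.mem_univ y)]
    have := j.2.2.1
    simp only [zero_mul, abs_zero]
    positivity
  · have hτ : 0 < (j.2 : ℝ) := lt_of_le_of_ne j.2.2.1 (Ne.symm hj)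
    have hr := radius_pos j.1
    have hgt := dev_radius_gt hb2 j hj hy
    have hy' : |y none| < 1 / 2 :=
      lt_of_lt_of_le (lt_of_le_of_lt (norm_le_pi_norm y none) (mem_ball_zero_iff.1 hy)) hb2
    have h1 : 1 / 2 ≤ 1 + y none := by linarith [(abs_lt.1 hy').1]
    have h1' : 0 < 1 + y none := by linarith
    rw [h j hj y hy, abs_mul, abs_mul, abs_of_nonneg (Real.rpow_nonneg hr.le _),
      abs_of_nonneg (by positivity : (0 : ℝ) ≤ (j.1.1.1 / j.2) ^ n)]
    have hle := hC _ hgt _ (hb _ j.1.2.2 y hy)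
    have hc : 0 < j.1.1.1 / (j.2 : ℝ) := by positivity
    calc _ ≤ j.1.1.1 ^ M.ν * ((j.1.1.1 / j.2) ^ n *
          (|C| * (j.1.1.1 / j.2 * (1 + y none)) ^ (-M.ν - n))) := by
          gcongr
          refine hle.trans ?_
          gcongr
          exact le_abs_self C
      _ = |C| * (1 + y none) ^ (-M.ν - n) * (j.2 : ℝ) ^ M.ν := by
          rw [Real.mul_rpow hc.le h1'.le, Real.rpow_sub hc, Real.rpow_natCast,
            Real.rpow_neg hc.le, Real.div_rpow hr.le hτ.le]
          have := (Real.rpow_pos_of_pos hr M.ν).ne'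
          have := (Real.rpow_pos_of_pos hτ M.ν).ne'
          field_simp
      _ ≤ _ := by
          have hmono : (1 + y none) ^ (-M.ν - n) ≤ (1 / 2 : ℝ) ^ (-M.ν - n) := by
            refine Real.rpow_le_rpow_of_nonpos (by norm_num) h1 ?_
            have := M.ν_pos
            have : (0 : ℝ) ≤ n := n.cast_nonneg
            linarith
          gcongr

theorem unifSmooth_devFam {b : ℝ} (hb2 : b ≤ 1 / 2) {K' : Set (Ang d)} (hK' : IsCompact K')
    (hK'U : K' ⊆ M.U)
    (hb : ∀ θ ∈ K, ∀ y ∈ Metric.ball (0 : Option (Fin d) → ℝ) b, angPart y + θ ∈ K')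
    (l m : Fin d) : UnifSmooth b (devFam M K l m) := by
  have hO : IsOpen (Set.Ioi M.RM ×ˢ M.U) := isOpen_Ioi.prod M.isOpen_U
  have hHs : ContDiffOn ℝ ∞ (fun x : Base d => M.g x.1 x.2 l m - M.gbar x.2 l m)
      (Set.Ioi M.RM ×ˢ M.U) :=
    (M.g_smooth l m).sub ((M.gbar_smooth l m).comp contDiff_snd.contDiffOn fun x hx => hx.2)
  refine ⟨fun j => ?_, fun L => ?_, fun L => ?_⟩
  · by_cases hj : (j.2 : ℝ) = 0
    · rw [show devFam M K l m j = fun _ => 0 from funext fun y => by simp [devFam, hj]]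
      exact contDiffOn_const
    · rw [show devFam M K l m j = _ from funext fun y => devFam_eq hj y]
      refine contDiffOn_const.mul (hHs.comp
        ((scaleBase _).contDiff.add contDiff_const).contDiffOn fun y hy => ?_)
      simp only [scaleBase, ContinuousLinearMap.prod_apply, Prod.mk_add_mk]
      refine ⟨?_, hK'U (hb _ j.1.2.2 y hy)⟩
      have := dev_radius_gt hb2 j hj hy
      simpa [mul_add, add_comm] using this
  · obtain ⟨C, hC0, hC⟩ := devFam_bound hb2 hK' hK'U hb l m L
    refine ⟨C, fun j y hy => (hC j y hy).trans (mul_le_of_le_one_right hC0 ?_)⟩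
    exact Real.rpow_le_one j.2.2.1 j.2.2.2 M.ν_pos.le
  · rintro ⟨j₀, y₀⟩ ⟨-, hy₀⟩
    refine ContinuousAt.continuousWithinAt ?_
    have hnhd : (Set.univ ×ˢ Metric.ball 0 b : Set (PathIdx M K × (Option (Fin d) → ℝ)))
        ∈ 𝓝 (j₀, y₀) := (isOpen_univ.prod Metric.isOpen_ball).mem_nhds ⟨trivial, hy₀⟩
    have hτc : Continuous fun q : PathIdx M K × (Option (Fin d) → ℝ) => (q.1.2 : ℝ) := by
      fun_prop
    by_cases hj : (j₀.2 : ℝ) = 0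
    -- Continuity at τ = 0 comes from the bound C τ^ν, which forces every derivative to tend to the
    -- value zero taken there.
    · obtain ⟨C, hC0, hC⟩ := devFam_bound hb2 hK' hK'U hb l m L
      have hz : iterPartial (L.map fun a => (Pi.single a 1 : Option (Fin d) → ℝ))
          (devFam M K l m j₀) y₀ = 0 := by
        have := hC j₀ y₀ hy₀
        rw [hj, Real.zero_rpow M.ν_pos.ne', mul_zero] at this
        exact abs_nonpos_iff.1 this
      rw [ContinuousAt, hz]
      have ht : Tendsto (fun q : PathIdx M K × (Option (Fin d) → ℝ) => C * (q.1.2 : ℝ) ^ M.ν)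
          (𝓝 (j₀, y₀)) (𝓝 0) := by
        have h1 : ContinuousAt (fun q : PathIdx M K × (Option (Fin d) → ℝ) =>
            C * (q.1.2 : ℝ) ^ M.ν) (j₀, y₀) :=
          continuousAt_const.mul (hτc.continuousAt.rpow_const (Or.inr M.ν_pos.le))
        have h2 := h1.tendsto
        simpa [hj, Real.zero_rpow M.ν_pos.ne'] using h2
      refine squeeze_zero_norm' ?_ ht
      filter_upwards [hnhd] with q hq
      exact hC q.1 q.2 hq.2
    -- For τ ≠ 0 the formula of `iterPartial_devFam` holds on a neighbourhood and is visibly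
    -- continuous.
    · obtain ⟨n, α, h⟩ := iterPartial_devFam hb2 (fun θ hθ y hy => hK'U (hb θ hθ y hy)) l m L
      have hB := (contDiffOn_iterPartial hO hHs (List.replicate n ((1, 0) : Base d)
        ++ α.map fun i => ((0, unitVec i) : Base d))).continuousOn
      have hne : ∀ᶠ q : PathIdx M K × (Option (Fin d) → ℝ) in 𝓝 (j₀, y₀), (q.1.2 : ℝ) ≠ 0 :=
        hτc.continuousAt.eventually_ne hj
      have heq : (fun q : PathIdx M K × (Option (Fin d) → ℝ) =>
          iterPartial (L.map fun a => (Pi.single a 1 : Option (Fin d) → ℝ))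
            (devFam M K l m q.1) q.2) =ᶠ[𝓝 (j₀, y₀)] fun q =>
          q.1.1.1.1 ^ M.ν * ((q.1.1.1.1 / q.1.2) ^ n * basePartial n α
          (fun x => M.g x.1 x.2 l m - M.gbar x.2 l m)
            (q.1.1.1.1 / q.1.2 * (1 + q.2 none), angPart q.2 + q.1.1.1.2)) := by
        filter_upwards [hnhd, hne] with q hq hq'
        exact h q.1 hq' q.2 hq.2
      refine ContinuousAt.congr ?_ heq.symm
      have hr : Continuous fun q : PathIdx M K × (Option (Fin d) → ℝ) => q.1.1.1.1 :=
        (continuous_radius M K).comp continuous_fst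
      have hθ : Continuous fun q : PathIdx M K × (Option (Fin d) → ℝ) => q.1.1.1.2 :=
        (continuous_angle M K).comp continuous_fst
      have hdiv : ContinuousAt (fun q : PathIdx M K × (Option (Fin d) → ℝ) =>
          q.1.1.1.1 / (q.1.2 : ℝ)) (j₀, y₀) := hr.continuousAt.div hτc.continuousAt hj
      have hpair : ContinuousAt (fun q : PathIdx M K × (Option (Fin d) → ℝ) =>
          ((q.1.1.1.1 / q.1.2 * (1 + q.2 none), angPart q.2 + q.1.1.1.2) : Base d)) (j₀, y₀) := by
        refine ContinuousAt.prodMk (hdiv.mul (by fun_prop)) ?_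
        exact ((angPart.continuous.comp continuous_snd).add hθ).continuousAt
      have hBat := hB.continuousAt (x := (j₀.1.1.1 / j₀.2 * (1 + y₀ none),
        angPart y₀ + j₀.1.1.2)) (hO.mem_nhds ⟨dev_radius_gt hb2 j₀ hj hy₀,
          hK'U (hb _ j₀.1.2.2 y₀ hy₀)⟩)
      refine ContinuousAt.mul ?_ ((hdiv.pow n).mul ?_)
      · exact hr.continuousAt.rpow_const (Or.inl (radius_pos j₀.1).ne')
      · exact ContinuousAt.comp (f := fun q : PathIdx M K × (Option (Fin d) → ℝ) =>
          ((q.1.1.1.1 / q.1.2 * (1 + q.2 none), angPart q.2 + q.1.1.1.2) : Base d)) hBat hpair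

end ConicScattering

namespace ConicScattering

/-! ### The implicit function theorem on fixed balls. -/

section Implicit

variable {P X : Type*} [NormedAddCommGroup P] [NormedSpace ℝ P] [CompleteSpace P]
  [NormedAddCommGroup X] [NormedSpace ℝ X] [CompleteSpace X]

/-- The implicit function theorem for `C^∞` maps, with smoothness and uniqueness on fixed balls. -/
theorem exists_smooth_implicit {Φ : P × X → X} {O : Set (P × X)} (hO : IsOpen O)
    (hO0 : (0 : P × X) ∈ O) (hΦ : ContDiffOn ℝ ∞ Φ O) (h0 : Φ 0 = 0)
    (e : (P × X) ≃L[ℝ] (P × X))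
    (he : HasFDerivAt (fun z => (z.1, Φ z)) (e : (P × X) →L[ℝ] (P × X)) 0) :
    ∃ ρ η : ℝ, 0 < η ∧ η ≤ ρ ∧ Metric.ball 0 ρ ⊆ O ∧ ∃ w : P → X,
      ContDiffOn ℝ ∞ w (Metric.ball 0 η) ∧
      (∀ p ∈ Metric.ball (0 : P) η, ‖w p‖ < ρ ∧ Φ (p, w p) = 0) ∧
      ∀ p ∈ Metric.ball (0 : P) η, ∀ v : X, ‖v‖ < ρ → Φ (p, v) = 0 → v = w p := by
  set F : P × X → P × X := fun z => (z.1, Φ z) with hF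
  have hFs : ContDiffOn ℝ ∞ F O := contDiff_fst.contDiffOn.prodMk hΦ
  have hFat : ContDiffAt ℝ ∞ F 0 := hFs.contDiffAt (hO.mem_nhds hO0)
  have hF0 : F 0 = 0 := by simp [hF, h0]
  set φ := hFat.toOpenPartialHomeomorph F he (by simp) with hφ
  have hcoe : (φ : P × X → P × X) = F := hFat.toOpenPartialHomeomorph_coe he _
  have h0s : (0 : P × X) ∈ φ.source := hFat.mem_toOpenPartialHomeomorph_source he _
  have h0t : (0 : P × X) ∈ φ.target := by
    have := hFat.image_mem_toOpenPartialHomeomorph_target he (by simp)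
    rwa [hF0] at this
  have hsymm0 : φ.symm 0 = 0 := by
    have := φ.left_inv h0s
    rwa [hcoe, hF0] at this
  obtain ⟨ρ, hρ, hρsub⟩ := Metric.isOpen_iff.1 (φ.open_source.inter hO) 0 ⟨h0s, hO0⟩
  -- Invertible derivatives form an open set. The inverse is thus smooth on a whole neighbourhood,
  -- where a statement at the base point alone would give a neighbourhood depending on the order.
  have hG : O ∩ (fderiv ℝ F) ⁻¹' (Set.range ((↑) : ((P × X) ≃L[ℝ] (P × X)) → _)) ∈ 𝓝 (0 : P × X) := by
    have hc : ContinuousOn (fderiv ℝ F) O := hFs.continuousOn_fderiv_of_isOpen hO (by simp)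
    refine (hc.isOpen_inter_preimage hO ContinuousLinearEquiv.isOpen).mem_nhds ⟨hO0, ?_⟩
    exact ⟨e, he.fderiv.symm⟩
  have hcont : ContinuousAt φ.symm 0 := φ.symm.continuousAt h0t
  have hev : ∀ᶠ q in 𝓝 (0 : P × X), q ∈ φ.target ∧ φ.symm q ∈ Metric.ball (0 : P × X) ρ ∧
      φ.symm q ∈ O ∩ (fderiv ℝ F) ⁻¹' (Set.range ((↑) : ((P × X) ≃L[ℝ] (P × X)) → _)) := by
    have h2 : ∀ᶠ q in 𝓝 (0 : P × X), q ∈ φ.target := φ.open_target.mem_nhds h0t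
    refine h2.and ?_
    have h1 : Tendsto φ.symm (𝓝 0) (𝓝 0) := by
      have := hcont.tendsto
      rwa [hsymm0] at this
    have h3 : ∀ᶠ q in 𝓝 (0 : P × X), φ.symm q ∈ Metric.ball (0 : P × X) ρ :=
      h1 (Metric.ball_mem_nhds 0 hρ)
    exact h3.and (h1 hG)
  obtain ⟨η₀, hη₀, hη⟩ := Metric.eventually_nhds_iff_ball.1 hev
  have hη' : ∀ p ∈ Metric.ball (0 : P) (min η₀ ρ), (p, (0 : X)) ∈ Metric.ball (0 : P × X) η₀ := by
    intro p hp
    rw [mem_ball_zero_iff] at hp ⊢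
    simpa [Prod.norm_def] using hp.trans_le (min_le_left _ _)
  have hfst : ∀ p ∈ Metric.ball (0 : P) (min η₀ ρ),
      F (φ.symm (p, 0)) = (p, 0) := by
    intro p hp
    rw [← hcoe]
    exact φ.right_inv (hη _ (hη' p hp)).1
  have hpair : ∀ p ∈ Metric.ball (0 : P) (min η₀ ρ),
      φ.symm (p, 0) = (p, (φ.symm (p, 0)).2) := by
    intro p hp
    have := congrArg Prod.fst (hfst p hp)
    exact Prod.ext this rfl
  -- Taking η ≤ ρ puts (p, v) in the ball of radius ρ for every ‖v‖ < ρ, so injectivity of the local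
  -- inverse gives uniqueness among all such v.
  refine ⟨ρ, min η₀ ρ, lt_min hη₀ hρ, min_le_right _ _, fun z hz => (hρsub hz).2,
    fun p => (φ.symm (p, 0)).2, ?_, ?_, ?_⟩
  · intro p hp
    obtain ⟨ht, hball, hO1, e', he'⟩ := hη _ (hη' p hp)
    refine ContDiffAt.contDiffWithinAt ?_
    have hat : ContDiffAt ℝ ∞ F (φ.symm (p, 0)) := hFs.contDiffAt (hO.mem_nhds hO1)
    have h1 : ContDiffAt ℝ ∞ φ.symm (p, (0 : X)) := by
      refine φ.contDiffAt_symm ht (f₀' := e') ?_ ?_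
      · rw [hcoe, he']
        exact (hat.differentiableAt (by simp)).hasFDerivAt
      · rwa [hcoe]
    exact contDiffAt_snd.comp p (h1.comp p (contDiffAt_id.prodMk contDiffAt_const))
  · intro p hp
    obtain ⟨ht, hball, -⟩ := hη _ (hη' p hp)
    refine ⟨?_, ?_⟩
    · rw [mem_ball_zero_iff] at hball
      exact (norm_snd_le _).trans_lt hball
    · have := congrArg Prod.snd (hfst p hp)
      rw [hpair p hp] at this
      exact this
  · intro p hp v hv hΦv
    have hmem : (p, v) ∈ Metric.ball (0 : P × X) ρ := by
      rw [mem_ball_zero_iff] at hp ⊢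
      simpa [Prod.norm_def] using ⟨hp.trans_le (min_le_right _ _), hv⟩
    have h1 := φ.left_inv (hρsub hmem).1
    rw [hcoe] at h1
    have h2 : F (p, v) = (p, 0) := by simp [hF, hΦv]
    rw [h2] at h1
    exact (congrArg Prod.snd h1).symm

end Implicit

/-! ### Volterra, mean value and evaluation operators. -/

section Operators

open BoundedContinuousFunction

variable {I : Type} [TopologicalSpace I]

/-- Extension to the real line of the restriction of a function to `{i} × [0, 1]`. -/
def line (x : (I × unitInterval) →ᵇ ℝ) (i : I) (t : ℝ) : ℝ :=
  x (i, Set.projIcc 0 1 zero_le_one t)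

@[fun_prop]
theorem continuous_line (x : (I × unitInterval) →ᵇ ℝ) (i : I) : Continuous (line x i) :=
  x.continuous.comp (by fun_prop)

theorem line_of_mem (x : (I × unitInterval) →ᵇ ℝ) (i : I) {t : ℝ} (ht : t ∈ Set.Icc (0 : ℝ) 1) :
    line x i t = x (i, ⟨t, ht⟩) := by
  rw [line, Set.projIcc_of_mem zero_le_one ht]

theorem line_coe (x : (I × unitInterval) →ᵇ ℝ) (i : I) (t : unitInterval) :
    line x i t = x (i, t) := line_of_mem x i t.2

theorem abs_line_le (x : (I × unitInterval) →ᵇ ℝ) (i : I) (t : ℝ) : |line x i t| ≤ ‖x‖ :=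
  x.norm_coe_le_norm _

theorem intervalIntegrable_line (x : (I × unitInterval) →ᵇ ℝ) (i : I) (a b : ℝ) :
    IntervalIntegrable (line x i) MeasureTheory.volume a b :=
  (continuous_line x i).intervalIntegrable a b

theorem norm_integral_line_le (x : (I × unitInterval) →ᵇ ℝ) (j : I × unitInterval) :
    ‖∫ t in (0 : ℝ)..j.2, line x j.1 t‖ ≤ ‖x‖ := by
  refine (intervalIntegral.norm_integral_le_of_norm_le_const
    (C := ‖x‖) fun t _ => abs_line_le x j.1 t).trans ?_
  rw [sub_zero, abs_of_nonneg j.2.2.1]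
  exact mul_le_of_le_one_right (norm_nonneg _) j.2.2.2

/-- Evaluation at time `1`. -/
def atOne : ((I × unitInterval) →ᵇ ℝ) →L[ℝ] ((I × unitInterval) →ᵇ ℝ) :=
  LinearMap.mkContinuous
    { toFun := fun x => x.compContinuous ⟨fun j => (j.1, 1), by fun_prop⟩
      map_add' := fun x y => rfl
      map_smul' := fun c x => rfl }
    1 (fun x => by
      rw [one_mul]
      exact (BoundedContinuousFunction.norm_le (norm_nonneg _)).2 fun j => x.norm_coe_le_norm _)

theorem atOne_apply (x : (I × unitInterval) →ᵇ ℝ) (j : I × unitInterval) :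
    atOne x j = x (j.1, 1) := rfl

/-- The function `(i, τ) ↦ τ²`. -/
def timeSq : (I × unitInterval) →ᵇ ℝ :=
  BoundedContinuousFunction.ofNormedAddCommGroup (fun j => (j.2 : ℝ) ^ 2) (by fun_prop) 1
    (fun j => by
      rw [Real.norm_of_nonneg (by positivity)]
      exact pow_le_one₀ j.2.2.1 j.2.2.2)

theorem timeSq_apply (j : I × unitInterval) : timeSq j = (j.2 : ℝ) ^ 2 := rfl

variable [DiscreteTopology I]

/-- The Volterra operator `x ↦ ∫₀^τ x`. -/
def volterra : ((I × unitInterval) →ᵇ ℝ) →L[ℝ] ((I × unitInterval) →ᵇ ℝ) :=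
  LinearMap.mkContinuous
    { toFun := fun x => BoundedContinuousFunction.ofNormedAddCommGroup
        (fun j => ∫ t in (0 : ℝ)..j.2, line x j.1 t)
        -- Since the base points are discrete, continuity is needed in τ only.
        (continuous_prod_of_discrete_left.2 fun i =>
          (intervalIntegral.continuous_primitive (intervalIntegrable_line x i) 0).comp
            continuous_subtype_val)
        ‖x‖ (norm_integral_line_le x)
      map_add' := fun x y => by
        ext j
        exact intervalIntegral.integral_add (intervalIntegrable_line x _ _ _)
          (intervalIntegrable_line y _ _ _)
      map_smul' := fun c x => by
        ext j
        exact intervalIntegral.integral_const_mul c _ }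
    1 (fun x => by
      rw [one_mul]
      exact (BoundedContinuousFunction.norm_le (norm_nonneg _)).2 (norm_integral_line_le x))

theorem volterra_apply (x : (I × unitInterval) →ᵇ ℝ) (j : I × unitInterval) :
    volterra x j = ∫ t in (0 : ℝ)..j.2, line x j.1 t := rfl

/-- The mean value over `[0, 1]`. -/
def meanOp : ((I × unitInterval) →ᵇ ℝ) →L[ℝ] ((I × unitInterval) →ᵇ ℝ) :=
  atOne.comp volterra

theorem meanOp_apply (x : (I × unitInterval) →ᵇ ℝ) (j : I × unitInterval) :
    meanOp x j = ∫ t in (0 : ℝ)..1, line x j.1 t := rfl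

/-- Averaging is linear over time-independent coefficients. This is what makes the linearisation at
the limiting metric, whose coefficients are constant in τ along constant paths, invertible by hand.
-/
theorem meanOp_mul_of_const {c : (I × unitInterval) →ᵇ ℝ} (hc : ∀ i s t, c (i, s) = c (i, t))
    (x : (I × unitInterval) →ᵇ ℝ) : meanOp (c * x) = c * meanOp x := by
  ext ⟨i, τ⟩
  rw [BoundedContinuousFunction.mul_apply, meanOp_apply, meanOp_apply,
    ← intervalIntegral.integral_const_mul]
  refine intervalIntegral.integral_congr fun t _ => ?_
  simp only [line, BoundedContinuousFunction.mul_apply]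
  rw [hc i τ]

theorem meanOp_const {c : (I × unitInterval) →ᵇ ℝ} (hc : ∀ i s t, c (i, s) = c (i, t)) :
    meanOp c = c := by
  ext ⟨i, τ⟩
  rw [meanOp_apply]
  simp only [line, fun t => hc i (Set.projIcc 0 1 zero_le_one t) τ]
  simp

theorem meanOp_meanOp (x : (I × unitInterval) →ᵇ ℝ) : meanOp (meanOp x) = meanOp x :=
  meanOp_const fun _ _ _ => rfl

end Operators

/-! ### Square roots as superposition families, and smoothness of inverse matrices. -/

section ScalarFamilies

/-- The larger ball of radius `b'` supplies a compact closed ball on which all derivatives are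
bounded. -/
theorem unifSmooth_const {J ι : Type} [TopologicalSpace J] [Fintype ι] [DecidableEq ι]
    {b b' : ℝ} (hb : b < b') {φ : (ι → ℝ) → ℝ} (hφ : ContDiffOn ℝ ∞ φ (Metric.ball 0 b')) :
    UnifSmooth b (fun _ : J => φ) := by
  have hs : Metric.closedBall (0 : ι → ℝ) b ⊆ Metric.ball 0 b' :=
    Metric.closedBall_subset_ball hb
  have hs' : Metric.ball (0 : ι → ℝ) b ⊆ Metric.ball 0 b' := Metric.ball_subset_ball hb.le
  have hL := fun L => (contDiffOn_iterPartial Metric.isOpen_ball hφ L).continuousOn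
  refine ⟨fun _ => hφ.mono hs', fun L => ?_, fun L => ?_⟩
  · obtain ⟨C, hC⟩ := (isCompact_closedBall (0 : ι → ℝ) b).bddAbove_image
      ((hL (L.map fun a => (Pi.single a 1 : ι → ℝ))).mono hs).abs
    exact ⟨C, fun _ y hy => hC ⟨y, Metric.ball_subset_closedBall hy, rfl⟩⟩
  · exact ((hL _).mono hs').comp (f := fun q : J × (ι → ℝ) => q.2) continuousOn_snd
      fun q hq => hq.2

/-- `z ↦ (1 + z)^{-1/2}`, as a function of one variable. -/
def invSqrtFam {J : Type} : J → (Unit → ℝ) → ℝ := fun _ y => (√(1 + y ()))⁻¹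

/-- `z ↦ (1 + (1 + z)^{1/2})⁻¹`, as a function of one variable. -/
def lagrFam {J : Type} : J → (Unit → ℝ) → ℝ := fun _ y => (1 + √(1 + y ()))⁻¹

theorem one_add_pos_of_mem_ball {b : ℝ} (hb : b ≤ 1) {y : Unit → ℝ}
    (hy : y ∈ Metric.ball (0 : Unit → ℝ) b) : 0 < 1 + y () := by
  have : |y ()| < 1 := ((norm_le_pi_norm y ()).trans_lt (mem_ball_zero_iff.1 hy)).trans_le hb
  linarith [(abs_lt.1 this).1]

theorem unifSmooth_invSqrtFam {J : Type} [TopologicalSpace J] :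
    UnifSmooth (1 / 2) (invSqrtFam (J := J)) := by
  refine unifSmooth_const (b' := 1) (by norm_num) ?_
  refine ContDiffOn.inv (ContDiffOn.sqrt ?_ fun y hy => (one_add_pos_of_mem_ball le_rfl hy).ne')
    fun y hy => (Real.sqrt_pos.2 (one_add_pos_of_mem_ball le_rfl hy)).ne'
  fun_prop

theorem unifSmooth_lagrFam {J : Type} [TopologicalSpace J] :
    UnifSmooth (1 / 2) (lagrFam (J := J)) := by
  refine unifSmooth_const (b' := 1) (by norm_num) ?_
  refine ContDiffOn.inv (contDiffOn_const.add
    (ContDiffOn.sqrt ?_ fun y hy => (one_add_pos_of_mem_ball le_rfl hy).ne'))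
    fun y hy => (by positivity)
  fun_prop

end ScalarFamilies

section InverseMatrix

variable {E : Type*} [NormedAddCommGroup E] [NormedSpace ℝ E] {d : ℕ}

theorem contDiffOn_det {A : E → Matrix (Fin d) (Fin d) ℝ} {O : Set E}
    (hA : ∀ l m, ContDiffOn ℝ ∞ (fun x => A x l m) O) :
    ContDiffOn ℝ ∞ (fun x => (A x).det) O := by
  simp only [Matrix.det_apply]
  refine ContDiffOn.sum fun σ _ => ?_
  refine ContDiffOn.const_smul _ (contDiffOn_prod fun i _ => hA _ _)

theorem contDiffOn_inv_matrix {A : E → Matrix (Fin d) (Fin d) ℝ} {O : Set E}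
    (hA : ∀ l m, ContDiffOn ℝ ∞ (fun x => A x l m) O) (hdet : ∀ x ∈ O, (A x).det ≠ 0)
    (l m : Fin d) : ContDiffOn ℝ ∞ (fun x => (A x)⁻¹ l m) O := by
  simp only [Matrix.inv_def, Matrix.smul_apply, Ring.inverse_eq_inv', smul_eq_mul]
  refine ((contDiffOn_det hA).inv hdet).mul ?_
  simp only [Matrix.adjugate_apply]
  refine contDiffOn_det fun a b => ?_
  simp only [Matrix.updateRow_apply]
  split_ifs
  · exact contDiffOn_const
  · exact hA _ _

end InverseMatrix

end ConicScattering

/-! ### The boundary value problem for geodesic rays and its smoothness. -/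

namespace ConicScattering

open BoundedContinuousFunction

variable {d : ℕ}

/-- Bounded continuous functions of a base point and a rescaled time. -/
abbrev Alg (M : ConicChart d) (K : Set (Ang d)) : Type := PathIdx M K →ᵇ ℝ

/-- Parameters `(μ, s, h, k)` of the boundary value problem: size of the perturbation of the
limiting metric, relative displacement of the radius, displacements of the two end angles. -/
abbrev Par (d : ℕ) : Type := ℝ × Triple d

/-- Families of velocities. -/
abbrev Vel (M : ConicChart d) (K : Set (Ang d)) : Type := Fin d → Alg M K

variable {M : ConicChart d} {K : Set (Ang d)}

/-- Relative radius and angular displacement along the path with velocity `z.2`. -/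
def coord (z : Par d × Vel M K) : Option (Fin d) → Alg M K :=
  fun a => a.elim (z.1.2.1 • 1) fun a => z.1.2.2.2 a • 1 + volterra (z.2 a)

/-- The coefficients of the metric along the path. -/
def metr (l m : Fin d) (z : Par d × Vel M K) : Alg M K :=
  superpose (barFam M K l m) (coord z) + z.1.1 • superpose (devFam M K l m) (coord z)

/-- The angular derivatives of the coefficients of the metric along the path. -/
def dmetr (a l m : Fin d) (z : Par d × Vel M K) : Alg M K :=
  superpose (partialFam (barFam M K l m) (some a)) (coord z)
    + z.1.1 • superpose (partialFam (devFam M K l m) (some a)) (coord z)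

/-- The squared angular speed. -/
def quad (z : Par d × Vel M K) : Alg M K := ∑ l, ∑ m, metr l m z * z.2 m * z.2 l

/-- The inverse of the speed. -/
def invSpeed (z : Par d × Vel M K) : Alg M K :=
  superpose invSqrtFam fun _ : Unit => timeSq * quad z

/-- The momentum of the path. -/
def mom (l : Fin d) (z : Par d × Vel M K) : Alg M K := (∑ m, metr l m z * z.2 m) * invSpeed z

/-- The force along the path. -/
def force (a : Fin d) (z : Par d × Vel M K) : Alg M K :=
  (∑ l, ∑ m, dmetr a l m z * z.2 m * z.2 l) * ((1 / 2 : ℝ) • invSpeed z)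

/-- The Lagrangian along the path. -/
def lagr (z : Par d × Vel M K) : Alg M K :=
  quad z * superpose lagrFam fun _ : Unit => timeSq * quad z

/-- The momentum minus the integrated force; constant in time along geodesics. -/
def resid (l : Fin d) (z : Par d × Vel M K) : Alg M K := mom l z - volterra (force l z)

/-- The boundary value problem for geodesics. -/
def bvp (z : Par d × Vel M K) : Vel M K := fun l =>
  -- Two equations are packed in one: the first difference has mean zero and the rest is constant in
  -- τ, so the sum vanishes only if both do. The first is the integrated Euler–Lagrange equation,
  -- the second says that the path goes from ϑ to θ, whose displacements are k and h.
  resid l z - meanOp (resid l z) + (meanOp (z.2 l) - (z.1.2.2.1 l - z.1.2.2.2 l) • 1)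

@[fun_prop]
theorem contDiff_ang_apply {E : Type*} [NormedAddCommGroup E] [NormedSpace ℝ E] {f : E → Ang d}
    (hf : ContDiff ℝ ∞ f) (a : Fin d) : ContDiff ℝ ∞ fun x => f x a :=
  (EuclideanSpace.proj (𝕜 := ℝ) a : Ang d →L[ℝ] ℝ).contDiff.comp hf

theorem contDiff_coord : ContDiff ℝ ∞ (coord : Par d × Vel M K → _) := by
  refine contDiff_pi.2 fun a => ?_
  cases a with
  | none =>
    have h : ContDiff ℝ ∞ fun z : Par d × Vel M K => z.1.2.1 := by fun_prop
    exact h.smul contDiff_const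
  | some a =>
    have h : ContDiff ℝ ∞ fun z : Par d × Vel M K => z.1.2.2.2 a := by fun_prop
    have h' : ContDiff ℝ ∞ fun z : Par d × Vel M K => z.2 a := by fun_prop
    exact (h.smul contDiff_const).add (volterra.contDiff.comp h')

/-- Radii on which the boundary value problem is smooth. -/
structure GoodRadii (M : ConicChart d) (K : Set (Ang d)) (b ρ : ℝ) : Prop where
  b_pos : 0 < b
  b_le : b ≤ 1 / 2
  pos : 0 < ρ
  mem_U : ∀ θ ∈ K, ∀ y ∈ Metric.ball (0 : Option (Fin d) → ℝ) b, angPart y + θ ∈ M.U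
  bar : ∀ l m, UnifSmooth b (barFam M K l m)
  dev : ∀ l m, UnifSmooth b (devFam M K l m)
  coord_mem : ∀ z ∈ Metric.ball (0 : Par d × Vel M K) ρ, coord z ∈ Metric.ball 0 b
  quad_mem : ∀ z ∈ Metric.ball (0 : Par d × Vel M K) ρ,
    (fun _ : Unit => timeSq * quad z) ∈ Metric.ball 0 (1 / 2)

section Smoothness

variable {b : ℝ} {O : Set (Par d × Vel M K)}

theorem contDiffOn_metr (hbar : ∀ l m, UnifSmooth b (barFam M K l m))
    (hdev : ∀ l m, UnifSmooth b (devFam M K l m)) (hO : ∀ z ∈ O, coord z ∈ Metric.ball 0 b)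
    (l m : Fin d) : ContDiffOn ℝ ∞ (metr l m) O := by
  have h : ContDiffOn ℝ ∞ (fun z : Par d × Vel M K => z.1.1) O := by fun_prop
  exact ((hbar l m).contDiffOn_superpose.comp contDiff_coord.contDiffOn hO).add
    (h.smul ((hdev l m).contDiffOn_superpose.comp contDiff_coord.contDiffOn hO))

theorem contDiffOn_dmetr (hbar : ∀ l m, UnifSmooth b (barFam M K l m))
    (hdev : ∀ l m, UnifSmooth b (devFam M K l m)) (hO : ∀ z ∈ O, coord z ∈ Metric.ball 0 b)
    (a l m : Fin d) : ContDiffOn ℝ ∞ (dmetr a l m) O := by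
  have h : ContDiffOn ℝ ∞ (fun z : Par d × Vel M K => z.1.1) O := by fun_prop
  exact (((hbar l m).partialFam _).contDiffOn_superpose.comp contDiff_coord.contDiffOn hO).add
    (h.smul (((hdev l m).partialFam _).contDiffOn_superpose.comp contDiff_coord.contDiffOn hO))

theorem contDiffOn_quad (hbar : ∀ l m, UnifSmooth b (barFam M K l m))
    (hdev : ∀ l m, UnifSmooth b (devFam M K l m)) (hO : ∀ z ∈ O, coord z ∈ Metric.ball 0 b) :
    ContDiffOn ℝ ∞ quad O := by
  refine ContDiffOn.sum fun l _ => ContDiffOn.sum fun m _ => ?_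
  refine ((contDiffOn_metr hbar hdev hO l m).mul ?_).mul ?_ <;> fun_prop

theorem coord_zero : coord (0 : Par d × Vel M K) = 0 := by
  ext a j
  cases a <;> simp [coord]

theorem quad_of_vel_eq_zero {z : Par d × Vel M K} (hz : z.2 = 0) : quad z = 0 := by
  simp [quad, hz]

theorem exists_goodRadii (hK : IsCompact K) (hKU : K ⊆ M.U) : ∃ b ρ, GoodRadii M K b ρ := by
  obtain ⟨b, hb, hb2, K', hK', hK'U, hmem⟩ := exists_compact_nhd hK hKU
  have hbar := fun l m => unifSmooth_barFam (M := M) (K := K) hK' hK'U hmem l m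
  have hdev := fun l m => unifSmooth_devFam (M := M) (K := K) hb2 hK' hK'U hmem l m
  have hO : IsOpen ((coord : Par d × Vel M K → _) ⁻¹' Metric.ball 0 b) :=
    Metric.isOpen_ball.preimage contDiff_coord.continuous
  have h0 : (0 : Par d × Vel M K) ∈ coord ⁻¹' Metric.ball 0 b := by
    simp [coord_zero, hb]
  have hq : ContinuousAt (fun z : Par d × Vel M K => (fun _ : Unit => timeSq * quad z)) 0 := by
    have h1 := (contDiffOn_quad hbar hdev (O := coord ⁻¹' Metric.ball 0 b)
      fun z hz => hz).continuousOn.continuousAt (hO.mem_nhds h0)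
    exact continuousAt_pi.2 fun _ => continuousAt_const.mul h1
  have hq' : (fun z : Par d × Vel M K => (fun _ : Unit => timeSq * quad z)) ⁻¹'
      Metric.ball 0 (1 / 2) ∈ 𝓝 0 := by
    refine hq (Metric.isOpen_ball.mem_nhds ?_)
    simp only [quad_of_vel_eq_zero (z := (0 : Par d × Vel M K)) rfl, mul_zero]
    exact Metric.mem_ball_self (by norm_num)
  obtain ⟨ρ, hρ, hsub⟩ := Metric.mem_nhds_iff.1 (Filter.inter_mem (hO.mem_nhds h0) hq')
  exact ⟨b, ρ, hb, hb2, hρ, fun θ hθ y hy => hK'U (hmem θ hθ y hy), hbar, hdev,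
    fun z hz => (hsub hz).1, fun z hz => (hsub hz).2⟩

end Smoothness

namespace GoodRadii

variable {b ρ : ℝ}

theorem metr (G : GoodRadii M K b ρ) (l m : Fin d) :
    ContDiffOn ℝ ∞ (metr l m : Par d × Vel M K → _) (Metric.ball 0 ρ) :=
  contDiffOn_metr G.bar G.dev G.coord_mem l m

theorem dmetr (G : GoodRadii M K b ρ) (a l m : Fin d) :
    ContDiffOn ℝ ∞ (dmetr a l m : Par d × Vel M K → _) (Metric.ball 0 ρ) :=
  contDiffOn_dmetr G.bar G.dev G.coord_mem a l m

theorem quad (G : GoodRadii M K b ρ) :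
    ContDiffOn ℝ ∞ (quad : Par d × Vel M K → _) (Metric.ball 0 ρ) :=
  contDiffOn_quad G.bar G.dev G.coord_mem

theorem timeSq_mul_quad (G : GoodRadii M K b ρ) :
    ContDiffOn ℝ ∞ (fun z : Par d × Vel M K => fun _ : Unit => timeSq * ConicScattering.quad z)
      (Metric.ball 0 ρ) :=
  contDiffOn_pi.2 fun _ => contDiffOn_const.mul G.quad

theorem invSpeed (G : GoodRadii M K b ρ) :
    ContDiffOn ℝ ∞ (invSpeed : Par d × Vel M K → _) (Metric.ball 0 ρ) :=
  unifSmooth_invSqrtFam.contDiffOn_superpose.comp G.timeSq_mul_quad G.quad_mem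

theorem lagr (G : GoodRadii M K b ρ) :
    ContDiffOn ℝ ∞ (lagr : Par d × Vel M K → _) (Metric.ball 0 ρ) :=
  G.quad.mul (unifSmooth_lagrFam.contDiffOn_superpose.comp G.timeSq_mul_quad G.quad_mem)

theorem mom (G : GoodRadii M K b ρ) (l : Fin d) :
    ContDiffOn ℝ ∞ (mom l : Par d × Vel M K → _) (Metric.ball 0 ρ) := by
  refine (ContDiffOn.sum fun m _ => (G.metr l m).mul ?_).mul G.invSpeed
  fun_prop

theorem force (G : GoodRadii M K b ρ) (a : Fin d) :
    ContDiffOn ℝ ∞ (force a : Par d × Vel M K → _) (Metric.ball 0 ρ) := by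
  have h : ContDiffOn ℝ ∞ (fun z : Par d × Vel M K => (1 / 2 : ℝ) • ConicScattering.invSpeed z)
      (Metric.ball 0 ρ) := G.invSpeed.const_smul _
  refine (ContDiffOn.sum fun l _ => ContDiffOn.sum fun m _ =>
    ((G.dmetr a l m).mul ?_).mul ?_).mul h <;> fun_prop

theorem resid (G : GoodRadii M K b ρ) (l : Fin d) :
    ContDiffOn ℝ ∞ (resid l : Par d × Vel M K → _) (Metric.ball 0 ρ) :=
  (G.mom l).sub (volterra.contDiff.comp_contDiffOn (G.force l))

theorem bvp (G : GoodRadii M K b ρ) :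
    ContDiffOn ℝ ∞ (bvp : Par d × Vel M K → _) (Metric.ball 0 ρ) := by
  refine contDiffOn_pi.2 fun l => ?_
  have h : ContDiff ℝ ∞ fun z : Par d × Vel M K => z.1.2.2.1 l - z.1.2.2.2 l := by
    fun_prop
  have h' : ContDiff ℝ ∞ fun z : Par d × Vel M K => z.2 l := by fun_prop
  exact ((G.resid l).sub (meanOp.contDiff.comp_contDiffOn (G.resid l))).add
    ((meanOp.contDiff.comp h').sub (h.smul contDiff_const)).contDiffOn

end GoodRadii

section DerivativeAtConstantPaths

variable {E 𝔸 : Type*} [NormedAddCommGroup E] [NormedSpace ℝ E]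

theorem hasFDerivAt_mul_of_eq_zero [NormedCommRing 𝔸] [NormedAlgebra ℝ 𝔸] {f g : E → 𝔸}
    {g' : E →L[ℝ] 𝔸} {x : E} (hf : DifferentiableAt ℝ f x) (hg : HasFDerivAt g g' x)
    (h0 : g x = 0) :
    HasFDerivAt (fun y => f y * g y) ((ContinuousLinearMap.mul ℝ 𝔸 (f x)).comp g') x := by
  refine (hf.hasFDerivAt.mul hg).congr_fderiv (ContinuousLinearMap.ext fun v => ?_)
  simp [h0]

theorem hasFDerivAt_mul_of_eq_zero_of_eq_zero [NormedCommRing 𝔸] [NormedAlgebra ℝ 𝔸]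
    {f g : E → 𝔸} {x : E} (hf : DifferentiableAt ℝ f x) (hg : DifferentiableAt ℝ g x)
    (hf0 : f x = 0) (hg0 : g x = 0) :
    HasFDerivAt (fun y => f y * g y) (0 : E →L[ℝ] 𝔸) x := by
  refine (hasFDerivAt_mul_of_eq_zero hf hg.hasFDerivAt hg0).congr_fderiv
    (ContinuousLinearMap.ext fun v => ?_)
  simp [hf0]

variable {b ρ : ℝ} {z : Par d × Vel M K}

/-- The component of index `l` of the velocity. -/
def velProj (l : Fin d) : (Par d × Vel M K) →L[ℝ] Alg M K :=
  (ContinuousLinearMap.proj (R := ℝ) (φ := fun _ : Fin d => Alg M K) l).comp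
    (ContinuousLinearMap.snd ℝ _ _)

theorem hasFDerivAt_vel (l : Fin d) (z : Par d × Vel M K) :
    HasFDerivAt (fun z : Par d × Vel M K => z.2 l) (velProj l) z :=
  (velProj l).hasFDerivAt

theorem GoodRadii.differentiableAt {f : Par d × Vel M K → Alg M K}
    (hf : ContDiffOn ℝ ∞ f (Metric.ball 0 ρ)) (hz : z ∈ Metric.ball 0 ρ) :
    DifferentiableAt ℝ f z :=
  (hf.contDiffAt (Metric.isOpen_ball.mem_nhds hz)).differentiableAt (by simp)

theorem invSpeed_of_vel_eq_zero (hz0 : z.2 = 0) : invSpeed z = 1 := by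
  have h : (fun _ : Unit => timeSq * quad z) = 0 := by
    simp [quad_of_vel_eq_zero hz0]; rfl
  ext j
  rw [invSpeed, h, superpose_apply unifSmooth_invSqrtFam (Metric.mem_ball_self (by norm_num))]
  simp [invSqrtFam]

/-- The squared speed is quadratic in the velocity, hence vanishes to second order at constant
paths; the same applies to the force below. -/
theorem hasFDerivAt_quad_of_vel_eq_zero (G : GoodRadii M K b ρ) (hz : z ∈ Metric.ball 0 ρ)
    (hz0 : z.2 = 0) : HasFDerivAt (quad : Par d × Vel M K → _)
      (0 : (Par d × Vel M K) →L[ℝ] Alg M K) z := by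
  have h : HasFDerivAt (quad : Par d × Vel M K → _)
      (∑ l : Fin d, ∑ m : Fin d, (0 : (Par d × Vel M K) →L[ℝ] Alg M K)) z := by
    refine HasFDerivAt.fun_sum fun l _ => HasFDerivAt.fun_sum fun m _ => ?_
    refine hasFDerivAt_mul_of_eq_zero_of_eq_zero ((GoodRadii.differentiableAt (G.metr l m) hz).mul
      (hasFDerivAt_vel m z).differentiableAt) (hasFDerivAt_vel l z).differentiableAt ?_ ?_ <;>
    simp [hz0]
  simpa using h

theorem hasFDerivAt_force_of_vel_eq_zero (G : GoodRadii M K b ρ) (hz : z ∈ Metric.ball 0 ρ)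
    (hz0 : z.2 = 0) (a : Fin d) : HasFDerivAt (force a : Par d × Vel M K → _)
      (0 : (Par d × Vel M K) →L[ℝ] Alg M K) z := by
  have h : HasFDerivAt (fun z : Par d × Vel M K => ∑ l, ∑ m, dmetr a l m z * z.2 m * z.2 l)
      (∑ l : Fin d, ∑ m : Fin d, (0 : (Par d × Vel M K) →L[ℝ] Alg M K)) z := by
    refine HasFDerivAt.fun_sum fun l _ => HasFDerivAt.fun_sum fun m _ => ?_
    refine hasFDerivAt_mul_of_eq_zero_of_eq_zero
      ((GoodRadii.differentiableAt (G.dmetr a l m) hz).mul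
      (hasFDerivAt_vel m z).differentiableAt) (hasFDerivAt_vel l z).differentiableAt ?_ ?_ <;>
    simp [hz0]
  have h2 := hasFDerivAt_mul_of_eq_zero (f := fun z => (1 / 2 : ℝ) • invSpeed z)
    ((GoodRadii.differentiableAt G.invSpeed hz).const_smul (1 / 2 : ℝ)) h (by simp [hz0])
  simp only [Finset.sum_const_zero, ContinuousLinearMap.comp_zero] at h2
  refine h2.congr_of_eventuallyEq (Filter.Eventually.of_forall fun y => ?_)
  simp only [force]
  exact mul_comm _ _

theorem hasFDerivAt_mom_of_vel_eq_zero (G : GoodRadii M K b ρ) (hz : z ∈ Metric.ball 0 ρ)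
    (hz0 : z.2 = 0) (l : Fin d) : HasFDerivAt (mom l : Par d × Vel M K → _)
      (∑ m, (ContinuousLinearMap.mul ℝ (Alg M K) (metr l m z)).comp (velProj m)) z := by
  have h : HasFDerivAt (fun z : Par d × Vel M K => ∑ m, metr l m z * z.2 m)
      (∑ m, (ContinuousLinearMap.mul ℝ (Alg M K) (metr l m z)).comp (velProj m)) z := by
    refine HasFDerivAt.fun_sum fun m _ => ?_
    exact hasFDerivAt_mul_of_eq_zero (GoodRadii.differentiableAt (G.metr l m) hz)
      (hasFDerivAt_vel m z) (by simp [hz0])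
  have h2 := hasFDerivAt_mul_of_eq_zero (GoodRadii.differentiableAt G.invSpeed hz) h
    (by simp [hz0])
  rw [invSpeed_of_vel_eq_zero hz0] at h2
  refine (h2.congr_fderiv (ContinuousLinearMap.ext fun v => ?_)).congr_of_eventuallyEq
    (Filter.Eventually.of_forall fun y => mul_comm _ _)
  simp

/-- The force and the variation of the speed are of second order, so only multiplication of the
velocity by the metric survives. -/
theorem hasFDerivAt_resid_of_vel_eq_zero (G : GoodRadii M K b ρ) (hz : z ∈ Metric.ball 0 ρ)
    (hz0 : z.2 = 0) (l : Fin d) : HasFDerivAt (resid l : Par d × Vel M K → _)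
      (∑ m, (ContinuousLinearMap.mul ℝ (Alg M K) (metr l m z)).comp (velProj m)) z := by
  refine ((hasFDerivAt_mom_of_vel_eq_zero G hz hz0 l).sub
    ((volterra (I := Idx M K)).hasFDerivAt.comp z
      (hasFDerivAt_force_of_vel_eq_zero G hz hz0 l))).congr_fderiv
        (ContinuousLinearMap.ext fun v => ?_)
  simp

end DerivativeAtConstantPaths

end ConicScattering

/-! ### Linearisation at constant paths and the family of solutions. -/

namespace ConicScattering

open BoundedContinuousFunction

variable {d : ℕ} {M : ConicChart d} {K : Set (Ang d)} {b ρ : ℝ}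

theorem coord_none_apply (z : Par d × Vel M K) (j : PathIdx M K) :
    coord z none j = z.1.2.1 := by
  simp [coord]

theorem coord_some_apply (z : Par d × Vel M K) (a : Fin d) (j : PathIdx M K) :
    coord z (some a) j = z.1.2.2.2 a + ∫ t in (0 : ℝ)..j.2, line (z.2 a) j.1 t := by
  simp [coord, volterra_apply]

theorem angPart_coord_of_vel_eq_zero {z : Par d × Vel M K} (hz0 : z.2 = 0) (j : PathIdx M K) :
    angPart (fun a => coord z a j) = z.1.2.2.2 := by
  ext a
  rw [angPart_apply, coord_some_apply]
  simp [hz0, line]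

theorem metr_apply (G : GoodRadii M K b ρ) {z : Par d × Vel M K} (hz : z ∈ Metric.ball 0 ρ)
    (l m : Fin d) (j : PathIdx M K) :
    metr l m z j = barFam M K l m j (fun a => coord z a j)
      + z.1.1 * devFam M K l m j (fun a => coord z a j) := by
  simp [metr, superpose_apply (G.bar l m) (G.coord_mem z hz),
    superpose_apply (G.dev l m) (G.coord_mem z hz)]

theorem metr_apply_of_unperturbed (G : GoodRadii M K b ρ) {z : Par d × Vel M K}
    (hz : z ∈ Metric.ball 0 ρ) (hz0 : z.2 = 0) (hμ : z.1.1 = 0) (l m : Fin d)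
    (j : PathIdx M K) : metr l m z j = M.gbar (z.1.2.2.2 + j.1.1.2) l m := by
  rw [metr_apply G hz, hμ, barFam, angPart_coord_of_vel_eq_zero hz0]
  simp

/-- The derivative of the residual at unperturbed constant paths. -/
def gbarMul (z : Par d × Vel M K) (l : Fin d) : (Par d × Vel M K) →L[ℝ] Alg M K :=
  ∑ m, (ContinuousLinearMap.mul ℝ (Alg M K) (metr l m z)).comp (velProj m)

theorem gbarMul_apply (z w : Par d × Vel M K) (l : Fin d) :
    gbarMul z l w = ∑ m, metr l m z * w.2 m := by
  simp [gbarMul, velProj]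

/-- The coefficients of the inverse of the limiting metric at the base points. -/
theorem exists_gbar_inv (hK : IsCompact K) (hKU : K ⊆ M.U) (l m : Fin d) :
    ∃ c : Alg M K, ∀ j : PathIdx M K, c j = (M.gbar j.1.1.2)⁻¹ l m := by
  have hc : ContinuousOn (fun θ => (M.gbar θ)⁻¹ l m) K :=
    (contDiffOn_inv_matrix M.gbar_smooth (fun θ hθ => (M.gbar_posDef θ hθ).det_pos.ne')
      l m).continuousOn.mono hKU
  obtain ⟨C, hC⟩ := hK.bddAbove_image hc.norm
  refine ⟨BoundedContinuousFunction.ofNormedAddCommGroup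
    (fun j : PathIdx M K => (M.gbar j.1.1.2)⁻¹ l m) ?_ C fun j => hC ⟨_, j.1.2.2, rfl⟩, fun j => rfl⟩
  exact (continuous_of_discreteTopology (f := fun i : Idx M K => (M.gbar i.1.2)⁻¹ l m)).comp
    continuous_fst

/-- The linear functional `(h, k) ↦ h - k`, as a map to constant functions. -/
def endGap (l : Fin d) : (Par d × Vel M K) →L[ℝ] Alg M K :=
  (ContinuousLinearMap.toSpanSingleton ℝ (1 : Alg M K)).comp
    ((EuclideanSpace.proj (𝕜 := ℝ) l : Ang d →L[ℝ] ℝ).comp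
      (((ContinuousLinearMap.fst ℝ (Ang d) (Ang d) - ContinuousLinearMap.snd ℝ (Ang d) (Ang d)).comp
        (ContinuousLinearMap.snd ℝ ℝ (Ang d × Ang d))).comp
          ((ContinuousLinearMap.snd ℝ ℝ (Triple d)).comp
            (ContinuousLinearMap.fst ℝ (Par d) (Vel M K)))))

theorem endGap_apply (w : Par d × Vel M K) (l : Fin d) :
    endGap l w = (w.1.2.2.1 l - w.1.2.2.2 l) • (1 : Alg M K) := by
  simp only [endGap, ContinuousLinearMap.comp_apply, ContinuousLinearMap.toSpanSingleton_apply]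
  rfl

theorem endGap_apply_apply (w : Par d × Vel M K) (l : Fin d) (j : PathIdx M K) :
    endGap l w j = w.1.2.2.1 l - w.1.2.2.2 l := by
  simp [endGap_apply]

/-- The derivative of `bvp` at constant paths. -/
def bvpDeriv (z : Par d × Vel M K) : (Par d × Vel M K) →L[ℝ] Vel M K :=
  ContinuousLinearMap.pi fun l =>
    gbarMul z l - meanOp.comp (gbarMul z l) + (meanOp.comp (velProj l) - endGap l)

theorem hasFDerivAt_bvp_of_vel_eq_zero (G : GoodRadii M K b ρ) {z : Par d × Vel M K}
    (hz : z ∈ Metric.ball 0 ρ) (hz0 : z.2 = 0) :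
    HasFDerivAt (bvp : Par d × Vel M K → _) (bvpDeriv z) z := by
  refine hasFDerivAt_pi.2 fun l => ?_
  have h := hasFDerivAt_resid_of_vel_eq_zero G hz hz0 l
  have h1 := (meanOp (I := Idx M K)).hasFDerivAt.comp z h
  have h2 := (meanOp (I := Idx M K)).hasFDerivAt.comp z (hasFDerivAt_vel l z)
  have h3 := (h.sub h1).add (h2.sub (endGap (M := M) (K := K) l).hasFDerivAt)
  refine h3.congr_of_eventuallyEq (Filter.Eventually.of_forall fun y => ?_)
  simp only [bvp, Pi.add_apply, Pi.sub_apply, Function.comp_apply, endGap_apply]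

theorem bvp_of_vel_eq_zero {z : Par d × Vel M K} (hz0 : z.2 = 0) (h : z.1.2.2.1 = z.1.2.2.2) :
    bvp z = 0 := by
  funext l
  simp [bvp, resid, mom, force, hz0, h]

/-- At the origin the metric A = ḡ is independent of τ, so the linearisation sends v to A(v - mean
v) + mean v - (h - k). It is block diagonal in the oscillating and constant parts of v, and x ↦
A⁻¹(x - mean x) + mean x + (h - k) inverts it. The entries of A⁻¹ are bounded because the angles lie
in a compact set. -/
theorem exists_bvp_equiv (G : GoodRadii M K b ρ) (hK : IsCompact K) (hKU : K ⊆ M.U) :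
    ∃ e : (Par d × Vel M K) ≃L[ℝ] (Par d × Vel M K),
      (e : (Par d × Vel M K) →L[ℝ] (Par d × Vel M K))
        = (ContinuousLinearMap.fst ℝ (Par d) (Vel M K)).prod (bvpDeriv 0) := by
  choose c hc using exists_gbar_inv (M := M) (K := K) hK hKU
  have hA : ∀ l m j, metr l m (0 : Par d × Vel M K) j = M.gbar j.1.1.2 l m := by
    intro l m j
    rw [metr_apply_of_unperturbed G (Metric.mem_ball_self G.pos) rfl rfl]
    simp
  have hAc : ∀ l m i s t, metr l m (0 : Par d × Vel M K) (i, s) = metr l m 0 (i, t) :=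
    fun l m i s t => by rw [hA, hA]
  have hcc : ∀ l m i s t, c l m (i, s) = c l m (i, t) := fun l m i s t => by rw [hc, hc]
  have hdet : ∀ j : PathIdx M K, IsUnit (M.gbar j.1.1.2).det := fun j =>
    (M.gbar_posDef _ (hKU j.1.2.2)).det_pos.ne'.isUnit
  -- The inverse matrix is inverted entrywise in the algebra of functions: its coefficients `c`
  -- satisfy both matrix identities at every base point.
  have hcA : ∀ l n, ∑ m, c l m * metr m n (0 : Par d × Vel M K)
      = if l = n then 1 else 0 := by
    intro l n
    ext j
    have h := congrFun (congrFun (Matrix.nonsing_inv_mul _ (hdet j)) l) n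
    rw [Matrix.mul_apply, Matrix.one_apply] at h
    simp only [BoundedContinuousFunction.sum_apply, BoundedContinuousFunction.mul_apply, hc, hA]
    rw [h]; split_ifs <;> rfl
  have hAcinv : ∀ l n, ∑ m, metr l m (0 : Par d × Vel M K) * c m n
      = if l = n then 1 else 0 := by
    intro l n
    ext j
    have h := congrFun (congrFun (Matrix.mul_nonsing_inv _ (hdet j)) l) n
    rw [Matrix.mul_apply, Matrix.one_apply] at h
    simp only [BoundedContinuousFunction.sum_apply, BoundedContinuousFunction.mul_apply, hc, hA]
    rw [h]; split_ifs <;> rfl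
  set A : Fin d → Fin d → Alg M K := fun l m => metr l m (0 : Par d × Vel M K) with hAdef
  have hmeanA : ∀ l (v : Vel M K), meanOp (∑ m, A l m * v m) = ∑ m, A l m * meanOp (v m) := by
    intro l v
    rw [map_sum]
    exact Finset.sum_congr rfl fun m _ => meanOp_mul_of_const (hAc l m) _
  have hmeanc : ∀ l (v : Vel M K), meanOp (∑ m, c l m * v m) = ∑ m, c l m * meanOp (v m) := by
    intro l v
    rw [map_sum]
    exact Finset.sum_congr rfl fun m _ => meanOp_mul_of_const (hcc l m) _
  have hcomp : ∀ (B C : Fin d → Fin d → Alg M K) (_ : ∀ l n, ∑ m, B l m * C m n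
      = if l = n then 1 else 0) (v : Vel M K) (l : Fin d),
      ∑ m, B l m * ∑ n, C m n * v n = v l := by
    intro B C hBC v l
    simp only [Finset.mul_sum]
    rw [Finset.sum_comm]
    simp only [← mul_assoc, ← Finset.sum_mul, hBC, ite_mul, one_mul, zero_mul, Finset.sum_ite_eq,
      Finset.mem_univ, if_true]
  have hendMean : ∀ (w : Par d × Vel M K) l, meanOp (endGap l w) = endGap l w := fun w l =>
    meanOp_const fun i s t => by rw [endGap_apply_apply, endGap_apply_apply]
  have happ : ∀ (w : Par d × Vel M K) l, bvpDeriv (0 : Par d × Vel M K) w l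
      = (∑ m, A l m * w.2 m) - (∑ m, A l m * meanOp (w.2 m)) + (meanOp (w.2 l) - endGap l w) := by
    intro w l
    simp only [bvpDeriv, ContinuousLinearMap.pi_apply, _root_.add_apply,
      _root_.sub_apply, ContinuousLinearMap.comp_apply, gbarMul_apply]
    rw [hmeanA]; rfl
  let inv2 : (Par d × Vel M K) →L[ℝ] Vel M K := ContinuousLinearMap.pi fun l =>
    (∑ m, (ContinuousLinearMap.mul ℝ (Alg M K) (c l m)).comp (velProj m - meanOp.comp (velProj m)))
      + (meanOp.comp (velProj l) + endGap l)
  have hinv : ∀ (w : Par d × Vel M K) l, inv2 w l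
      = (∑ m, c l m * (w.2 m - meanOp (w.2 m))) + (meanOp (w.2 l) + endGap l w) := by
    intro w l
    simp [inv2, velProj, mul_sub]
  have hend : ∀ (w w' : Par d × Vel M K) l, w.1 = w'.1 → endGap l w = endGap l w' := by
    intro w w' l h
    rw [endGap_apply, endGap_apply, h]
  refine ⟨ContinuousLinearEquiv.equivOfInverse
    ((ContinuousLinearMap.fst ℝ (Par d) (Vel M K)).prod (bvpDeriv 0))
    ((ContinuousLinearMap.fst ℝ (Par d) (Vel M K)).prod inv2) ?_ ?_, rfl⟩
  · intro w
    refine Prod.ext rfl (funext fun l => ?_)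
    simp only [ContinuousLinearMap.prod_apply]
    rw [hinv]
    have h1 : ∀ m, meanOp (bvpDeriv (0 : Par d × Vel M K) w m)
        = meanOp (w.2 m) - endGap m w := by
      intro m
      rw [happ, map_add, map_sub, map_sub, hmeanA, hmeanA, hendMean]
      simp only [meanOp_meanOp]
      abel
    have h2 : ∀ m, bvpDeriv (0 : Par d × Vel M K) w m - meanOp (bvpDeriv (0 : Par d × Vel M K) w m)
        = ∑ n, A m n * (w.2 n - meanOp (w.2 n)) := by
      intro m
      rw [h1, happ]
      simp only [mul_sub, Finset.sum_sub_distrib]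
      abel
    simp only [h2]
    rw [h1, hcomp c A hcA (fun n => w.2 n - meanOp (w.2 n)) l]
    rw [hend ((ContinuousLinearMap.fst ℝ (Par d) (Vel M K)) w, (bvpDeriv 0) w) w l rfl]
    abel
  · intro w
    refine Prod.ext rfl (funext fun l => ?_)
    simp only [ContinuousLinearMap.prod_apply]
    rw [happ]
    have h1 : ∀ m, meanOp (inv2 w m) = meanOp (w.2 m) + endGap m w := by
      intro m
      rw [hinv, map_add, map_add, hmeanc, hendMean]
      simp only [map_sub, meanOp_meanOp, sub_self, mul_zero, Finset.sum_const_zero, zero_add]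
    have h2 : ∀ m, inv2 w m - meanOp (inv2 w m) = ∑ n, c m n * (w.2 n - meanOp (w.2 n)) := by
      intro m
      rw [h1, hinv]; abel
    rw [← Finset.sum_sub_distrib]
    simp only [← mul_sub, h2]
    rw [hcomp A c hAcinv (fun n => w.2 n - meanOp (w.2 n)) l, h1,
      hend ((ContinuousLinearMap.fst ℝ (Par d) (Vel M K)) w, inv2 w) w l rfl]
    abel

/-- A smooth family of solutions of the boundary value problem, unique among small velocities. -/
structure SolutionFamily (M : ConicChart d) (K : Set (Ang d)) (b ρ η : ℝ)
    (w : Par d → Vel M K) : Prop where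
  good : GoodRadii M K b ρ
  pos : 0 < η
  le : η ≤ ρ
  smooth : ContDiffOn ℝ ∞ w (Metric.ball 0 η)
  small : ∀ p ∈ Metric.ball (0 : Par d) η, ‖w p‖ < ρ
  solves : ∀ p ∈ Metric.ball (0 : Par d) η, bvp (p, w p) = 0
  unique : ∀ p ∈ Metric.ball (0 : Par d) η, ∀ v : Vel M K, ‖v‖ < ρ → bvp (p, v) = 0 → v = w p

theorem GoodRadii.mono (G : GoodRadii M K b ρ) {ρ' : ℝ} (h : 0 < ρ') (hle : ρ' ≤ ρ) :
    GoodRadii M K b ρ' :=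
  ⟨G.b_pos, G.b_le, h, G.mem_U, G.bar, G.dev,
    fun z hz => G.coord_mem z (Metric.ball_subset_ball hle hz),
    fun z hz => G.quad_mem z (Metric.ball_subset_ball hle hz)⟩

theorem exists_solutionFamily (hK : IsCompact K) (hKU : K ⊆ M.U) :
    ∃ b ρ η w, SolutionFamily M K b ρ η w := by
  obtain ⟨b, ρ₀, G⟩ := exists_goodRadii hK hKU
  obtain ⟨e, he⟩ := exists_bvp_equiv G hK hKU
  have h0 : (0 : Par d × Vel M K) ∈ Metric.ball 0 ρ₀ := Metric.mem_ball_self G.pos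
  have hd := hasFDerivAt_bvp_of_vel_eq_zero G h0 rfl
  obtain ⟨ρ, η, hη, hle, hsub, w, hw, hsol, huniq⟩ := exists_smooth_implicit Metric.isOpen_ball h0
    G.bvp (bvp_of_vel_eq_zero rfl rfl) e (he ▸ hasFDerivAt_fst.prodMk hd)
  -- The radius of uniqueness must also be a radius on which `bvp` is smooth, so both are shrunk to
  -- the minimum, and η is shrunk until the solutions stay below it, by continuity at the origin.
  have hρ : 0 < min ρ ρ₀ := lt_min (hη.trans_le hle) G.pos
  have hcont : ContinuousAt w 0 := hw.continuousOn.continuousAt (Metric.ball_mem_nhds _ hη)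
  have hw0 : w 0 = 0 := by
    refine (huniq 0 (Metric.mem_ball_self hη) 0 (by simpa using hη.trans_le hle) ?_).symm
    exact bvp_of_vel_eq_zero rfl rfl
  have hev : ∀ᶠ p in 𝓝 (0 : Par d), ‖w p‖ < min ρ ρ₀ := by
    refine hcont.norm.eventually_lt_const ?_
    simpa [hw0] using hρ
  obtain ⟨η', hη', hball⟩ := Metric.eventually_nhds_iff_ball.1 hev
  have hs : Metric.ball (0 : Par d) (min (min η η') (min ρ ρ₀)) ⊆ Metric.ball 0 η :=
    Metric.ball_subset_ball ((min_le_left _ _).trans (min_le_left _ _))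
  have hs' : Metric.ball (0 : Par d) (min (min η η') (min ρ ρ₀)) ⊆ Metric.ball 0 η' :=
    Metric.ball_subset_ball ((min_le_left _ _).trans (min_le_right _ _))
  exact ⟨b, min ρ ρ₀, min (min η η') (min ρ ρ₀), w, G.mono hρ (min_le_right _ _),
    lt_min (lt_min hη hη') hρ, min_le_right _ _, hw.mono hs, fun p hp => hball p (hs' hp),
    fun p hp => (hsol p (hs hp)).2,
    fun p hp v hv => huniq p (hs hp) v (hv.trans_le (min_le_left _ _))⟩

end ConicScattering

/-! ### First variation of the generating function. -/

namespace ConicScattering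

open BoundedContinuousFunction

variable {d : ℕ} {M : ConicChart d} {K : Set (Ang d)} {b ρ η : ℝ} {w : Par d → Vel M K}

/-- The integrand is the derivative of the product of the two primitives; this is the integration by
parts of the first variation formula. -/
theorem integral_mul_primitive_add {α β : ℝ → ℝ} (hα : Continuous α) (hβ : Continuous β)
    (A B : ℝ) :
    ∫ t in (0 : ℝ)..1, (α t * (B + ∫ u in (0 : ℝ)..t, β u) + (A + ∫ u in (0 : ℝ)..t, α u) * β t)
      = (A + ∫ u in (0 : ℝ)..1, α u) * (B + ∫ u in (0 : ℝ)..1, β u) - A * B := by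
  have hpα : ∀ t, HasDerivAt (fun t => A + ∫ u in (0 : ℝ)..t, α u) (α t) t := fun t =>
    (hα.integral_hasStrictDerivAt 0 t).hasDerivAt.const_add A
  have hpβ : ∀ t, HasDerivAt (fun t => B + ∫ u in (0 : ℝ)..t, β u) (β t) t := fun t =>
    (hβ.integral_hasStrictDerivAt 0 t).hasDerivAt.const_add B
  have hcα : Continuous fun t => A + ∫ u in (0 : ℝ)..t, α u :=
    continuous_iff_continuousAt.2 fun t => (hpα t).continuousAt
  have hcβ : Continuous fun t => B + ∫ u in (0 : ℝ)..t, β u :=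
    continuous_iff_continuousAt.2 fun t => (hpβ t).continuousAt
  rw [intervalIntegral.integral_eq_sub_of_hasDerivAt (fun t _ => (hpα t).mul (hpβ t))
    ((hα.mul hcβ).add (hcα.mul hβ)).continuousOn.intervalIntegrable]
  simp

theorem alg_one_apply (j : PathIdx M K) : (1 : Alg M K) j = 1 := rfl

theorem metr_symm (G : GoodRadii M K b ρ) {z : Par d × Vel M K} (hz : z ∈ Metric.ball 0 ρ)
    (l m : Fin d) : metr l m z = metr m l z := by
  ext j
  have hy := eval_mem_ball (G.coord_mem z hz) j
  have hU := G.mem_U _ j.1.2.2 _ hy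
  have hbar : ∀ θ ∈ M.U, M.gbar θ l m = M.gbar θ m l := fun θ hθ => by
    simpa using (M.gbar_posDef θ hθ).isHermitian.apply m l
  rw [metr_apply G hz, metr_apply G hz]
  congr 1
  · exact hbar _ hU
  · congr 1
    simp only [devFam]
    split_ifs with h
    · rfl
    · have hg := M.g_posDef _ (dev_radius_gt G.b_le j h hy) _ hU
      rw [hbar _ hU, ← hg.isHermitian.apply]
      simp

/-- The variation of a superposition operator along a curve of coordinates. -/
theorem hasDerivAt_superpose_coord {f : PathIdx M K → (Option (Fin d) → ℝ) → ℝ}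
    (hf : UnifSmooth b f) {y : ℝ → Option (Fin d) → Alg M K} {y' : Option (Fin d) → Alg M K}
    (hy0 : y 0 ∈ Metric.ball 0 b) (hy : HasDerivAt y y' 0) (hnone : y' none = 0) :
    HasDerivAt (fun t => superpose f (y t))
      (∑ a, superpose (partialFam f (some a)) (y 0) * y' (some a)) 0 := by
  have h := (hf.hasFDerivAt_superpose hy0).comp_hasDerivAt (0 : ℝ) hy
  simpa [Fintype.sum_option, hnone, Function.comp_def] using h

theorem hasDerivAt_metr (G : GoodRadii M K b ρ) {z : ℝ → Par d × Vel M K}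
    (hz : z 0 ∈ Metric.ball 0 ρ) {μ : ℝ} (hμ : ∀ t, (z t).1.1 = μ)
    {y' : Option (Fin d) → Alg M K} (hy : HasDerivAt (fun t => coord (z t)) y' 0)
    (hnone : y' none = 0) (l m : Fin d) :
    HasDerivAt (fun t => metr l m (z t)) (∑ a, dmetr a l m (z 0) * y' (some a)) 0 := by
  have h1 := hasDerivAt_superpose_coord (G.bar l m) (y := fun t => coord (z t))
    (G.coord_mem _ hz) hy hnone
  have h2 := (hasDerivAt_superpose_coord (G.dev l m) (y := fun t => coord (z t))
    (G.coord_mem _ hz) hy hnone).const_smul μ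
  refine (h1.add h2).congr_deriv ?_ |>.congr_of_eventuallyEq
    (Filter.Eventually.of_forall fun t => ?_)
  · rw [Finset.smul_sum, ← Finset.sum_add_distrib]
    refine Finset.sum_congr rfl fun a _ => ?_
    rw [dmetr, add_mul, hμ, smul_mul_assoc]
  · simp [metr, hμ]

/-- In terms of y = τ²q this is the identity d/dq [q / (1 + √(1 + τ²q))] = 1 / (2√(1 + τ²q)): the
regularised Lagrangian has the same derivative in q as (√(1 + τ²q) - 1)/τ². -/
theorem partialFam_lagrFam {J : Type} (j : J) {y : Unit → ℝ}
    (hy : y ∈ Metric.ball (0 : Unit → ℝ) (1 / 2)) :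
    lagrFam j y + y () * partialFam lagrFam () j y = 1 / 2 * invSqrtFam j y := by
  have hpos : 0 < 1 + y () := one_add_pos_of_mem_ball (by norm_num) hy
  have hs : 0 < √(1 + y ()) := Real.sqrt_pos.2 hpos
  have hproj : HasFDerivAt (fun y : Unit → ℝ => 1 + y ())
      (ContinuousLinearMap.proj (R := ℝ) (φ := fun _ : Unit => ℝ) ()) y :=
    (ContinuousLinearMap.proj (R := ℝ) (φ := fun _ : Unit => ℝ) ()).hasFDerivAt.const_add 1
  have h1 : HasDerivAt (fun x : ℝ => (1 + √x)⁻¹)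
      (-(1 / (2 * √(1 + y ()))) / (1 + √(1 + y ())) ^ 2) (1 + y ()) :=
    ((Real.hasDerivAt_sqrt hpos.ne').const_add 1).inv (by positivity)
  have h2 := h1.comp_hasFDerivAt y hproj
  have h3 : partialFam lagrFam () j y = -(1 / (2 * √(1 + y ()))) / (1 + √(1 + y ())) ^ 2 := by
    have h4 : lagrFam j = (fun x : ℝ => (1 + √x)⁻¹) ∘ fun y : Unit → ℝ => 1 + y () := rfl
    rw [partialFam, h4, h2.fderiv]
    simp
  rw [h3, lagrFam, invSqrtFam]
  have hsq : √(1 + y ()) ^ 2 = 1 + y () := Real.sq_sqrt hpos.le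
  -- Expressing y through the square root makes the identity rational.
  have hy' : y () = √(1 + y ()) ^ 2 - 1 := by rw [hsq]; ring
  generalize √(1 + y ()) = S at *
  rw [hy']
  field_simp
  ring

theorem hasDerivAt_lagr (G : GoodRadii M K b ρ) {z : ℝ → Par d × Vel M K}
    (hz : z 0 ∈ Metric.ball 0 ρ) {q' : Alg M K} (hq : HasDerivAt (fun t => quad (z t)) q' 0) :
    HasDerivAt (fun t => lagr (z t)) (((1 / 2 : ℝ) • invSpeed (z 0)) * q') 0 := by
  have hball := G.quad_mem _ hz
  have h1 : HasDerivAt (fun t => fun _ : Unit => timeSq * quad (z t)) (fun _ => timeSq * q') 0 :=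
    hasDerivAt_pi.2 fun _ => hq.const_mul timeSq
  have h2 := (unifSmooth_lagrFam.hasFDerivAt_superpose hball).comp_hasDerivAt (0 : ℝ) h1
  refine (hq.mul h2).congr_deriv ?_
  ext j
  have hy := eval_mem_ball hball j
  have key := partialFam_lagrFam (J := PathIdx M K) j hy
  simp only [invSpeed, Function.comp_apply, BoundedContinuousFunction.add_apply,
    BoundedContinuousFunction.mul_apply, BoundedContinuousFunction.smul_apply,
    superpose_apply unifSmooth_invSqrtFam hball, superpose_apply unifSmooth_lagrFam hball,
    smul_eq_mul]
  simp only [Finset.univ_unique, Finset.sum_singleton, ContinuousLinearMap.comp_apply,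
    ContinuousLinearMap.mul_apply', ContinuousLinearMap.proj_apply,
    BoundedContinuousFunction.mul_apply, PUnit.default_eq_unit,
    superpose_apply (unifSmooth_lagrFam.partialFam ()) hball]
  simp only [BoundedContinuousFunction.mul_apply] at key
  rw [← key]
  ring

theorem hasDerivAt_quad (G : GoodRadii M K b ρ) {z : ℝ → Par d × Vel M K}
    (hz : z 0 ∈ Metric.ball 0 ρ) {μ : ℝ} (hμ : ∀ t, (z t).1.1 = μ)
    {y' : Option (Fin d) → Alg M K} (hy : HasDerivAt (fun t => coord (z t)) y' 0)
    (hnone : y' none = 0) {v' : Vel M K} (hv : HasDerivAt (fun t => (z t).2) v' 0) :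
    HasDerivAt (fun t => quad (z t))
      ((∑ a, (∑ l, ∑ m, dmetr a l m (z 0) * (z 0).2 m * (z 0).2 l) * y' (some a))
        + (2 : ℝ) • ∑ l, (∑ m, metr l m (z 0) * (z 0).2 m) * v' l) 0 := by
  have hvl := fun l => hasDerivAt_pi.1 hv l
  have h : HasDerivAt (fun t => quad (z t)) (∑ l, ∑ m,
      (((∑ a, dmetr a l m (z 0) * y' (some a)) * (z 0).2 m + metr l m (z 0) * v' m) * (z 0).2 l
        + metr l m (z 0) * (z 0).2 m * v' l)) 0 :=
    HasDerivAt.fun_sum fun l _ => HasDerivAt.fun_sum fun m _ =>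
      (((hasDerivAt_metr G hz hμ hy hnone l m).mul (hvl m)).mul (hvl l))
  refine h.congr_deriv ?_
  simp only [add_mul, Finset.sum_add_distrib, two_smul]
  rw [add_assoc]
  congr 1
  · simp only [Finset.sum_mul]
    rw [Finset.sum_comm_cycle] 
    refine Finset.sum_congr rfl fun l _ => Finset.sum_congr rfl fun m _ =>
      Finset.sum_congr rfl fun a _ => ?_
    ring
  · congr 1
    · rw [Finset.sum_comm]
      refine Finset.sum_congr rfl fun l _ => ?_
      rw [Finset.sum_mul]
      refine Finset.sum_congr rfl fun m _ => ?_
      rw [metr_symm G hz m l]; ring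
    · simp only [Finset.sum_mul]

namespace SolutionFamily

/-- The rescaled generating function. -/
def psiFam (w : Par d → Vel M K) (p : Par d) : Alg M K :=
  (1 + p.2.1) • (1 - meanOp (lagr (p, w p)))

/-- The rescaled momentum at the end of the path. -/
def endMom (w : Par d → Vel M K) (l : Fin d) (p : Par d) : Alg M K := atOne (mom l (p, w p))

/-- The rescaled momentum at infinity. -/
def infMom (w : Par d → Vel M K) (l : Fin d) (p : Par d) : Alg M K := meanOp (resid l (p, w p))

/-- The inverse of the speed at the end of the path. -/
def endInvSpeed (w : Par d → Vel M K) (p : Par d) : Alg M K := atOne (invSpeed (p, w p))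

theorem mem_ball (S : SolutionFamily M K b ρ η w) {p : Par d} (hp : p ∈ Metric.ball 0 η) :
    (p, w p) ∈ Metric.ball (0 : Par d × Vel M K) ρ := by
  have h := S.small p hp
  rw [mem_ball_zero_iff] at hp ⊢
  exact max_lt (hp.trans_le S.le) h

theorem contDiffOn_graph (S : SolutionFamily M K b ρ η w) :
    ContDiffOn ℝ ∞ (fun p => (p, w p)) (Metric.ball 0 η) := contDiffOn_id.prodMk S.smooth

theorem contDiffOn_psiFam (S : SolutionFamily M K b ρ η w) :
    ContDiffOn ℝ ∞ (psiFam w) (Metric.ball 0 η) := by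
  have h : ContDiffOn ℝ ∞ (fun p : Par d => 1 + p.2.1) (Metric.ball 0 η) := by fun_prop
  exact h.smul (contDiffOn_const.sub (meanOp.contDiff.comp_contDiffOn
    (S.good.lagr.comp S.contDiffOn_graph fun _ hp => S.mem_ball hp)))

theorem contDiffOn_endMom (S : SolutionFamily M K b ρ η w) (l : Fin d) :
    ContDiffOn ℝ ∞ (endMom w l) (Metric.ball 0 η) :=
  atOne.contDiff.comp_contDiffOn
    ((S.good.mom l).comp S.contDiffOn_graph fun _ hp => S.mem_ball hp)

theorem contDiffOn_infMom (S : SolutionFamily M K b ρ η w) (l : Fin d) :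
    ContDiffOn ℝ ∞ (infMom w l) (Metric.ball 0 η) :=
  meanOp.contDiff.comp_contDiffOn
    ((S.good.resid l).comp S.contDiffOn_graph fun _ hp => S.mem_ball hp)

theorem contDiffOn_endInvSpeed (S : SolutionFamily M K b ρ η w) :
    ContDiffOn ℝ ∞ (endInvSpeed w) (Metric.ball 0 η) :=
  atOne.contDiff.comp_contDiffOn
    (S.good.invSpeed.comp S.contDiffOn_graph fun _ hp => S.mem_ball hp)

/-- Averaging the equation removes its Euler–Lagrange part and leaves the end condition. -/
theorem meanOp_vel (S : SolutionFamily M K b ρ η w) {p : Par d} (hp : p ∈ Metric.ball 0 η)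
    (l : Fin d) : meanOp (w p l) = (p.2.2.1 l - p.2.2.2 l) • 1 := by
  have h := congrArg meanOp (congrFun (S.solves p hp) l)
  simp only [bvp, map_add, map_sub, meanOp_meanOp, sub_self, zero_add, Pi.zero_apply,
    map_zero] at h
  have h1 : meanOp ((p.2.2.1 l - p.2.2.2 l) • (1 : Alg M K)) = (p.2.2.1 l - p.2.2.2 l) • 1 :=
    meanOp_const fun i s t => rfl
  rw [h1] at h
  exact sub_eq_zero.1 h

theorem resid_eq (S : SolutionFamily M K b ρ η w) {p : Par d} (hp : p ∈ Metric.ball 0 η)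
    (l : Fin d) : resid l (p, w p) = infMom w l p := by
  have h := congrFun (S.solves p hp) l
  simp only [bvp, S.meanOp_vel hp l, sub_self, add_zero, Pi.zero_apply] at h
  exact sub_eq_zero.1 h

theorem mom_eq (S : SolutionFamily M K b ρ η w) {p : Par d} (hp : p ∈ Metric.ball 0 η)
    (l : Fin d) : mom l (p, w p) = infMom w l p + volterra (force l (p, w p)) := by
  rw [← S.resid_eq hp, resid]; abel

/-- First variation formula: the derivative of the generating function in the end angles is given
by the momenta. -/
theorem fderiv_psiFam (S : SolutionFamily M K b ρ η w) {p : Par d} (hp : p ∈ Metric.ball 0 η)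
    (eh ek : Ang d) (j : PathIdx M K) :
    fderiv ℝ (psiFam w) p (0, 0, eh, ek) j
      = -(1 + p.2.1) * ∑ l, (endMom w l p j * eh l - infMom w l p j * ek l) := by
  have G := S.good
  set e : Par d := (0, 0, eh, ek) with he
  have hO := Metric.isOpen_ball.mem_nhds hp
  have hline : HasDerivAt (fun t : ℝ => p + t • e) e 0 := by
    simpa using ((hasDerivAt_id (0 : ℝ)).smul_const e).const_add p
  have hw : HasDerivAt (fun t : ℝ => w (p + t • e)) (fderiv ℝ w p e) 0 := by
    have h1 : HasFDerivAt w (fderiv ℝ w p) (p + (0 : ℝ) • e) := by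
      rw [zero_smul, add_zero]
      exact ((S.smooth.contDiffAt hO).differentiableAt (by simp)).hasFDerivAt
    exact h1.comp_hasDerivAt (0 : ℝ) hline
  set v' := fderiv ℝ w p e with hv'
  set z : ℝ → Par d × Vel M K := fun t => (p + t • e, w (p + t • e)) with hzdef
  have hz0 : z 0 = (p, w p) := by simp [hzdef]
  have hz : z 0 ∈ Metric.ball 0 ρ := hz0 ▸ S.mem_ball hp
  have hμ : ∀ t, (z t).1.1 = p.1 := fun t => by simp [hzdef, he]
  set y' : Option (Fin d) → Alg M K := fun a => a.elim 0 fun a => ek a • 1 + volterra (v' a)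
    with hy'
  have hy : HasDerivAt (fun t => coord (z t)) y' 0 := by
    refine hasDerivAt_pi.2 fun a => ?_
    cases a with
    | none =>
      simp only [coord, Option.elim_none, hzdef, he, hy']
      simpa using hasDerivAt_const (0 : ℝ) (p.2.1 • (1 : Alg M K))
    | some a =>
      simp only [coord, Option.elim_some, hzdef, hy']
      have h1 : HasDerivAt (fun t : ℝ => (p + t • e).2.2.2 a • (1 : Alg M K)) (ek a • 1) 0 := by
        have h2 : HasDerivAt (fun t : ℝ => p.2.2.2 a + t * ek a) (ek a) 0 := by
          simpa using ((hasDerivAt_id (0 : ℝ)).mul_const (ek a)).const_add (p.2.2.2 a)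
        simpa [he] using h2.smul_const (1 : Alg M K)
      exact h1.add ((volterra (I := Idx M K)).hasFDerivAt.comp_hasDerivAt (0 : ℝ)
        (hasDerivAt_pi.1 hw a))
  have hq := hasDerivAt_quad G hz hμ hy rfl hw
  have hl := hasDerivAt_lagr G hz hq
  -- The variation of the Lagrangian is force · δx + momentum · δv, with the momentum replaced by
  -- its value at infinity plus the integrated force.
  have hlagr : (((1 / 2 : ℝ) • invSpeed (z 0)) *
      ((∑ a, (∑ l, ∑ m, dmetr a l m (z 0) * (z 0).2 m * (z 0).2 l) * y' (some a))
        + (2 : ℝ) • ∑ l, (∑ m, metr l m (z 0) * (z 0).2 m) * v' l))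
      = ∑ l, (force l (p, w p) * (ek l • 1 + volterra (v' l))
          + (infMom w l p + volterra (force l (p, w p))) * v' l) := by
    simp only [← S.mom_eq hp]
    rw [hz0, mul_add, Finset.mul_sum, Finset.sum_add_distrib, Finset.smul_sum, Finset.mul_sum]
    congr 1
    · refine Finset.sum_congr rfl fun a _ => ?_
      simp only [force, hy', Option.elim_some]
      ring
    · refine Finset.sum_congr rfl fun l _ => ?_
      simp only [mom]
      rw [smul_mul_smul_comm]
      norm_num
      ring
  rw [hlagr] at hl
  have hpsi : HasDerivAt (fun t : ℝ => psiFam w (p + t • e)) (fderiv ℝ (psiFam w) p e) 0 := by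
    have h1 : HasFDerivAt (psiFam w) (fderiv ℝ (psiFam w) p) (p + (0 : ℝ) • e) := by
      rw [zero_smul, add_zero]
      exact ((S.contDiffOn_psiFam.contDiffAt hO).differentiableAt (by simp)).hasFDerivAt
    exact h1.comp_hasDerivAt (0 : ℝ) hline
  have hpsi2 : HasDerivAt (fun t : ℝ => psiFam w (p + t • e)) ((1 + p.2.1) • -(meanOp (∑ l,
      (force l (p, w p) * (ek l • 1 + volterra (v' l))
          + (infMom w l p + volterra (force l (p, w p))) * v' l)))) 0 := by
    have h1 := ((meanOp (I := Idx M K)).hasFDerivAt.comp_hasDerivAt (0 : ℝ) hl).const_sub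
      (1 : Alg M K) |>.const_smul (1 + p.2.1)
    refine h1.congr_of_eventuallyEq (Filter.Eventually.of_forall fun t => ?_)
    simp [psiFam, hzdef, he]
  rw [hpsi.unique hpsi2]
  -- The end condition is differentiated: the variation of the path starts at `ek` and ends at `eh`.
  have hmv : ∀ l, meanOp (v' l) = (eh l - ek l) • 1 := by
    intro l
    have h1 : HasDerivAt (fun t : ℝ => meanOp (w (p + t • e) l)) (meanOp (v' l)) 0 :=
      (meanOp (I := Idx M K)).hasFDerivAt.comp_hasDerivAt (0 : ℝ) (hasDerivAt_pi.1 hw l)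
    have h2 : HasDerivAt (fun t : ℝ => meanOp (w (p + t • e) l)) ((eh l - ek l) • 1) 0 := by
      have h3 : HasDerivAt (fun t : ℝ => (p.2.2.1 l - p.2.2.2 l) + t * (eh l - ek l))
          (eh l - ek l) 0 := by
        simpa using ((hasDerivAt_id (0 : ℝ)).mul_const (eh l - ek l)).const_add
          (p.2.2.1 l - p.2.2.2 l)
      refine (h3.smul_const (1 : Alg M K)).congr_of_eventuallyEq ?_
      have hc : ContinuousAt (fun t : ℝ => p + t • e) 0 := hline.continuousAt
      have hev : ∀ᶠ t in 𝓝 (0 : ℝ), p + t • e ∈ Metric.ball (0 : Par d) η := by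
        refine hc (Metric.isOpen_ball.mem_nhds ?_)
        simpa using hp
      filter_upwards [hev] with t ht
      rw [S.meanOp_vel ht]
      congr 1
      simp [he]
      ring
    exact h1.unique h2
  obtain ⟨i, τ⟩ := j
  -- The integrand is the derivative of momentum · δx, so only the boundary terms at τ = 1 and τ = 0
  -- remain.
  have hint : ∀ l, meanOp (force l (p, w p) * (ek l • 1 + volterra (v' l))
          + (infMom w l p + volterra (force l (p, w p))) * v' l) (i, τ)
        = endMom w l p (i, τ) * eh l - infMom w l p (i, τ) * ek l := by
    intro l
    have hm := congrArg (fun x : Alg M K => x (i, τ)) (hmv l)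
    simp only [meanOp_apply, BoundedContinuousFunction.smul_apply,
      alg_one_apply, smul_eq_mul, mul_one] at hm
    rw [meanOp_apply]
    have hcongr : ∀ t ∈ Set.uIcc (0 : ℝ) 1,
        line (force l (p, w p) * (ek l • 1 + volterra (v' l))
          + (infMom w l p + volterra (force l (p, w p))) * v' l) i t
        = line (force l (p, w p)) i t * (ek l + ∫ u in (0 : ℝ)..t, line (v' l) i u)
          + (infMom w l p (i, τ) + ∫ u in (0 : ℝ)..t, line (force l (p, w p)) i u)
            * line (v' l) i t := by
      intro t ht
      rw [Set.uIcc_of_le zero_le_one] at ht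
      simp only [line_of_mem _ i ht, BoundedContinuousFunction.add_apply,
        BoundedContinuousFunction.mul_apply, BoundedContinuousFunction.smul_apply,
        alg_one_apply, smul_eq_mul, mul_one, volterra_apply]
      rfl
    rw [intervalIntegral.integral_congr hcongr,
      integral_mul_primitive_add (continuous_line _ i) (continuous_line _ i), hm]
    have hend : endMom w l p (i, τ) = infMom w l p (i, τ)
        + ∫ u in (0 : ℝ)..1, line (force l (p, w p)) i u := by
      rw [endMom, S.mom_eq hp]
      rfl
    rw [hend]
    ring
  simp only [map_sum, BoundedContinuousFunction.smul_apply, BoundedContinuousFunction.neg_apply,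
    BoundedContinuousFunction.sum_apply, hint, smul_eq_mul]
  ring

end SolutionFamily

end ConicScattering

/-! ### Values and derivatives on the diagonal. -/

namespace ConicScattering

open BoundedContinuousFunction

variable {d : ℕ} {M : ConicChart d} {K : Set (Ang d)} {b ρ η : ℝ} {w : Par d → Vel M K}

theorem atOne_volterra (x : Alg M K) : atOne (volterra x) = meanOp x := rfl

theorem atOne_meanOp (x : Alg M K) : atOne (meanOp x) = meanOp x := by
  ext j
  rw [atOne_apply, meanOp_apply, meanOp_apply]

namespace SolutionFamily

/-- When θ = ϑ the constant path is a solution, and small solutions are unique. -/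
theorem vel_eq_zero (S : SolutionFamily M K b ρ η w) {p : Par d} (hp : p ∈ Metric.ball 0 η)
    (h : p.2.2.1 = p.2.2.2) : w p = 0 := by
  refine (S.unique p hp 0 ?_ (bvp_of_vel_eq_zero rfl h)).symm
  simpa using S.pos.trans_le S.le

theorem psiFam_diag (S : SolutionFamily M K b ρ η w) {p : Par d} (hp : p ∈ Metric.ball 0 η)
    (h : p.2.2.1 = p.2.2.2) : psiFam w p = (1 + p.2.1) • 1 := by
  simp [psiFam, lagr, S.vel_eq_zero hp h, quad_of_vel_eq_zero]

theorem endInvSpeed_diag (S : SolutionFamily M K b ρ η w) {p : Par d} (hp : p ∈ Metric.ball 0 η)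
    (h : p.2.2.1 = p.2.2.2) : endInvSpeed w p = 1 := by
  rw [endInvSpeed, invSpeed_of_vel_eq_zero (S.vel_eq_zero hp h)]
  rfl

theorem infMom_diag (S : SolutionFamily M K b ρ η w) {p : Par d} (hp : p ∈ Metric.ball 0 η)
    (h : p.2.2.1 = p.2.2.2) (l : Fin d) : infMom w l p = 0 := by
  simp [infMom, resid, mom, force, S.vel_eq_zero hp h]

theorem endMom_eq (S : SolutionFamily M K b ρ η w) {p : Par d} (hp : p ∈ Metric.ball 0 η)
    (l : Fin d) : endMom w l p = infMom w l p + meanOp (force l (p, w p)) := by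
  rw [endMom, S.mom_eq hp, map_add, atOne_volterra, infMom, atOne_meanOp]

theorem endMom_diag (S : SolutionFamily M K b ρ η w) {p : Par d} (hp : p ∈ Metric.ball 0 η)
    (h : p.2.2.1 = p.2.2.2) (l : Fin d) : endMom w l p = 0 := by
  simp [endMom, mom, S.vel_eq_zero hp h]

theorem hasFDerivAt_graph (S : SolutionFamily M K b ρ η w) {p : Par d}
    (hp : p ∈ Metric.ball 0 η) :
    HasFDerivAt (fun p => (p, w p)) ((ContinuousLinearMap.id ℝ (Par d)).prod (fderiv ℝ w p)) p :=
  (hasFDerivAt_id p).prodMk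
    ((S.smooth.contDiffAt (Metric.isOpen_ball.mem_nhds hp)).differentiableAt (by simp)).hasFDerivAt

theorem meanOp_fderiv_vel (S : SolutionFamily M K b ρ η w) {p : Par d}
    (hp : p ∈ Metric.ball 0 η) (e : Par d) (l : Fin d) :
    meanOp (fderiv ℝ w p e l) = (e.2.2.1 l - e.2.2.2 l) • 1 := by
  have hO := Metric.isOpen_ball.mem_nhds hp
  have hw : HasFDerivAt w (fderiv ℝ w p) p :=
    ((S.smooth.contDiffAt hO).differentiableAt (by simp)).hasFDerivAt
  have h1 := (meanOp (I := Idx M K)).hasFDerivAt.comp p (hasFDerivAt_pi'.1 hw l)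
  have h2 : HasFDerivAt (fun p : Par d => endGap (M := M) (K := K) l (p, 0))
      ((endGap (M := M) (K := K) l).comp (ContinuousLinearMap.inl ℝ (Par d) (Vel M K))) p :=
    ((endGap (M := M) (K := K) l).comp
      (ContinuousLinearMap.inl ℝ (Par d) (Vel M K))).hasFDerivAt
  have h3 : (fun p : Par d => endGap (M := M) (K := K) l (p, 0)) =ᶠ[𝓝 p]
      (meanOp (I := Idx M K)) ∘ fun p => w p l := by
    filter_upwards [hO] with q hq
    rw [Function.comp_apply, S.meanOp_vel hq, endGap_apply]
  have h4 := congrArg (fun T : Par d →L[ℝ] Alg M K => T e)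
    ((h2.congr_of_eventuallyEq h3.symm).unique h1)
  simpa [endGap_apply] using h4.symm

theorem hasFDerivAt_infMom (S : SolutionFamily M K b ρ η w) {p : Par d}
    (hp : p ∈ Metric.ball 0 η) (h : p.2.2.1 = p.2.2.2) (l : Fin d) :
    HasFDerivAt (infMom w l) (meanOp.comp ((gbarMul (p, w p) l).comp
      ((ContinuousLinearMap.id ℝ (Par d)).prod (fderiv ℝ w p)))) p := by
  have h1 : HasFDerivAt (resid l) (gbarMul (p, w p) l) (p, w p) :=
    hasFDerivAt_resid_of_vel_eq_zero S.good (S.mem_ball hp) (S.vel_eq_zero hp h) l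
  have h2 := HasFDerivAt.comp (g := resid l) (f := fun p => (p, w p)) p h1 (S.hasFDerivAt_graph hp)
  exact (meanOp (I := Idx M K)).hasFDerivAt.comp p h2

/-- For μ = 0 the metric along a constant path does not depend on τ, so it passes through the mean,
and the mean of the varied velocity is the varied end gap. This fails for μ ≠ 0, which is why the
linear term of the expansions carries an error of size r^{-ν}. -/
theorem fderiv_infMom (S : SolutionFamily M K b ρ η w) {p : Par d}
    (hp : p ∈ Metric.ball 0 η) (h : p.2.2.1 = p.2.2.2) (hμ : p.1 = 0) (l : Fin d) (e : Par d)
    (j : PathIdx M K) :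
    fderiv ℝ (infMom w l) p e j
      = ∑ m, M.gbar (p.2.2.2 + j.1.1.2) l m * (e.2.2.1 m - e.2.2.2 m) := by
  rw [(S.hasFDerivAt_infMom hp h l).fderiv]
  simp only [ContinuousLinearMap.comp_apply, ContinuousLinearMap.prod_apply, gbarMul_apply,
    map_sum]
  have hv := S.vel_eq_zero hp h
  have hm : ∀ m j, metr l m (p, w p) j = M.gbar (p.2.2.2 + j.1.1.2) l m := fun m j =>
    metr_apply_of_unperturbed S.good (S.mem_ball hp) hv hμ l m j
  have hc : ∀ m, meanOp (metr l m (p, w p) * fderiv ℝ w p e m)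
      = metr l m (p, w p) * meanOp (fderiv ℝ w p e m) := fun m =>
    meanOp_mul_of_const (fun i s t => by rw [hm, hm]) _
  simp only [hc, S.meanOp_fderiv_vel hp, BoundedContinuousFunction.sum_apply,
    BoundedContinuousFunction.mul_apply, BoundedContinuousFunction.smul_apply, hm,
    alg_one_apply, smul_eq_mul, mul_one]

/-- The momenta at the two ends differ by the mean force, which is of second order at constant
paths. -/
theorem fderiv_endMom (S : SolutionFamily M K b ρ η w) {p : Par d}
    (hp : p ∈ Metric.ball 0 η) (h : p.2.2.1 = p.2.2.2) (l : Fin d) :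
    fderiv ℝ (endMom w l) p = fderiv ℝ (infMom w l) p := by
  have h1 := (S.hasFDerivAt_infMom hp h l)
  have h2 := (meanOp (I := Idx M K)).hasFDerivAt.comp p
    ((hasFDerivAt_force_of_vel_eq_zero S.good (S.mem_ball hp) (S.vel_eq_zero hp h) l).comp p
      (S.hasFDerivAt_graph hp))
  have h3 : endMom w l =ᶠ[𝓝 p] fun p => infMom w l p + meanOp (force l (p, w p)) := by
    filter_upwards [Metric.isOpen_ball.mem_nhds hp] with q hq
    exact S.endMom_eq hq l
  rw [((h1.add h2).congr_of_eventuallyEq h3).fderiv, h1.fderiv]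
  refine ContinuousLinearMap.ext fun e => ?_
  simp

theorem fderiv_endInvSpeed (S : SolutionFamily M K b ρ η w) {p : Par d}
    (hp : p ∈ Metric.ball 0 η) (h : p.2.2.1 = p.2.2.2) :
    fderiv ℝ (endInvSpeed w) p = 0 := by
  have hz := S.mem_ball hp
  have h1 := hasFDerivAt_quad_of_vel_eq_zero S.good hz (S.vel_eq_zero hp h)
  have h2 : HasFDerivAt (fun z : Par d × Vel M K => fun _ : Unit => timeSq * quad z)
      (0 : (Par d × Vel M K) →L[ℝ] (Unit → Alg M K)) (p, w p) := by
    refine hasFDerivAt_pi'.2 fun _ => ?_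
    simpa using h1.const_mul timeSq
  have h3 := (unifSmooth_invSqrtFam.hasFDerivAt_superpose (S.good.quad_mem _ hz)).comp _ h2
  have h4 := (atOne (I := Idx M K)).hasFDerivAt.comp p (h3.comp p (S.hasFDerivAt_graph hp))
  have h5 : HasFDerivAt (endInvSpeed w) _ p := h4
  rw [h5.fderiv]
  refine ContinuousLinearMap.ext fun e => ?_
  simp

theorem fderiv_psiFam_diag (S : SolutionFamily M K b ρ η w) {p : Par d}
    (hp : p ∈ Metric.ball 0 η) (h : p.2.2.1 = p.2.2.2) (eh ek : Ang d) :
    fderiv ℝ (psiFam w) p (0, 0, eh, ek) = 0 := by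
  ext j
  rw [S.fderiv_psiFam hp]
  simp [S.endMom_diag hp h, S.infMom_diag hp h]

end SolutionFamily

/-! ### Geodesic rays as real paths, without reference to base points. -/

section RealPaths

variable (M)

/-- The rescaled coefficients of the metric at time `τ` of a path starting at radius `r`. -/
def coefAt (r τ : ℝ) (x : Ang d) (l m : Fin d) : ℝ :=
  if τ = 0 then M.gbar x l m else M.g (r / τ) x l m

/-- The angular derivatives of `coefAt`. -/
def dcoefAt (r τ : ℝ) (x : Ang d) (a l m : Fin d) : ℝ :=
  if τ = 0 then fderiv ℝ (fun x => M.gbar x l m) x (unitVec a)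
  else fderiv ℝ (fun y : Base d => M.g y.1 y.2 l m) (r / τ, x) (0, unitVec a)

/-- The path with velocity `v` starting at `ϑ`. -/
def pathAt (ϑ : Ang d) (v : ℝ → Fin d → ℝ) (τ : ℝ) : Ang d :=
  ϑ + WithLp.toLp 2 fun l => ∫ t in (0 : ℝ)..τ, v t l

/-- Squared angular speed. -/
def quadAt (r : ℝ) (ϑ : Ang d) (v : ℝ → Fin d → ℝ) (τ : ℝ) : ℝ :=
  ∑ l, ∑ m, coefAt M r τ (pathAt ϑ v τ) l m * v τ m * v τ l

/-- Speed. -/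
def speedAt (r : ℝ) (ϑ : Ang d) (v : ℝ → Fin d → ℝ) (τ : ℝ) : ℝ :=
  √(1 + τ ^ 2 * quadAt M r ϑ v τ)

/-- Momentum. -/
def momAt (r : ℝ) (ϑ : Ang d) (v : ℝ → Fin d → ℝ) (l : Fin d) (τ : ℝ) : ℝ :=
  (∑ m, coefAt M r τ (pathAt ϑ v τ) l m * v τ m) * (speedAt M r ϑ v τ)⁻¹

/-- Force. -/
def forceAt (r : ℝ) (ϑ : Ang d) (v : ℝ → Fin d → ℝ) (a : Fin d) (τ : ℝ) : ℝ :=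
  (∑ l, ∑ m, dcoefAt M r τ (pathAt ϑ v τ) a l m * v τ m * v τ l)
    * (1 / 2 * (speedAt M r ϑ v τ)⁻¹)

/-- Lagrangian. -/
def lagrAt (r : ℝ) (ϑ : Ang d) (v : ℝ → Fin d → ℝ) (τ : ℝ) : ℝ :=
  quadAt M r ϑ v τ * (1 + speedAt M r ϑ v τ)⁻¹

/-- `v` is the velocity, with respect to the time `τ = r / r'`, of a geodesic ray which starts at
`(r, θ)` and is asymptotic to the angle `ϑ`, and `c` is its rescaled momentum at infinity. -/
structure IsAsymptoticPath (r : ℝ) (θ ϑ : Ang d) (v : ℝ → Fin d → ℝ) (c : Fin d → ℝ) : Prop where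
  cont : ∀ l, Continuous fun t => v t l
  mem : ∀ τ ∈ Set.Icc (0 : ℝ) 1, pathAt ϑ v τ ∈ M.U
  endpoint : pathAt ϑ v 1 = θ
  quad_cont : ContinuousOn (quadAt M r ϑ v) (Set.Icc 0 1)
  force_cont : ∀ l, ContinuousOn (forceAt M r ϑ v l) (Set.Icc 0 1)
  eqn : ∀ l, ∀ τ ∈ Set.Icc (0 : ℝ) 1,
    momAt M r ϑ v l τ = c l + ∫ t in (0 : ℝ)..τ, forceAt M r ϑ v l t

end RealPaths

section Evaluation

/-- The velocity of the member of index `i` of a family. -/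
def lineVel (v : Vel M K) (i : Idx M K) (t : ℝ) (l : Fin d) : ℝ := line (v l) i t

variable {z : Par d × Vel M K} {i : Idx M K} {r : ℝ} {ϑ : Ang d}

theorem angPart_coord (hϑ : ϑ = i.1.2 + z.1.2.2.2) (τ : unitInterval) :
    angPart (fun a => coord z a (i, τ)) + i.1.2 = pathAt ϑ (lineVel z.2 i) τ := by
  ext a
  simp only [PiLp.add_apply, angPart_apply, coord_some_apply, pathAt, hϑ, lineVel]
  ring

theorem rpow_neg_mul_rpow_radius (i : Idx M K) : i.1.1 ^ (-M.ν) * i.1.1 ^ M.ν = 1 := by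
  rw [← Real.rpow_add (radius_pos i)]
  simp

/-- The choice μ = r^{-ν}, with r the base radius, undoes the normalisation by r^ν, so ḡ + μ · dev
is the true metric at radius r(1 + s)/τ. -/
theorem metr_eq_coefAt (G : GoodRadii M K b ρ) (hz : z ∈ Metric.ball 0 ρ)
    (hμ : z.1.1 = i.1.1 ^ (-M.ν)) (hr : r = i.1.1 * (1 + z.1.2.1))
    (hϑ : ϑ = i.1.2 + z.1.2.2.2) (l m : Fin d) (τ : unitInterval) :
    metr l m z (i, τ) = coefAt M r τ (pathAt ϑ (lineVel z.2 i) τ) l m := by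
  rw [metr_apply G hz, barFam, devFam, coefAt]
  rw [angPart_coord hϑ]
  by_cases h : (τ : ℝ) = 0
  · simp [h]
  · simp only [h, if_false, hμ]
    rw [← mul_assoc, rpow_neg_mul_rpow_radius, coord_none_apply, hr]
    have : i.1.1 / (τ : ℝ) * (1 + z.1.2.1) = i.1.1 * (1 + z.1.2.1) / τ := by ring
    rw [this]
    ring

theorem partialFam_barFam {y : Option (Fin d) → ℝ} {j : PathIdx M K}
    (hU : angPart y + j.1.1.2 ∈ M.U) (a l m : Fin d) :
    partialFam (barFam M K l m) (some a) j y
      = fderiv ℝ (fun x => M.gbar x l m) (angPart y + j.1.1.2) (unitVec a) := by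
  have h := iterPartial_comp_affine M.isOpen_U (M.gbar_smooth l m) angPart j.1.1.2
    [(Pi.single (some a) 1 : Option (Fin d) → ℝ)] hU
  simp only [iterPartial_cons, iterPartial_nil, List.map_cons, List.map_nil,
    angPart_single_some] at h
  exact h

theorem partialFam_devFam {y : Option (Fin d) → ℝ} {j : PathIdx M K}
    (hU : angPart y + j.1.1.2 ∈ M.U) (hj : (j.2 : ℝ) ≠ 0)
    (hr : M.RM < j.1.1.1 / j.2 * (1 + y none)) (a l m : Fin d) :
    partialFam (devFam M K l m) (some a) j y = j.1.1.1 ^ M.ν *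
      (fderiv ℝ (fun x : Base d => M.g x.1 x.2 l m)
        (j.1.1.1 / j.2 * (1 + y none), angPart y + j.1.1.2) (0, unitVec a)
        - fderiv ℝ (fun x => M.gbar x l m) (angPart y + j.1.1.2) (unitVec a)) := by
  have hO : IsOpen (Set.Ioi M.RM ×ˢ M.U) := isOpen_Ioi.prod M.isOpen_U
  have hbar : ContDiffOn ℝ ∞ (fun x : Base d => M.gbar x.2 l m) (Set.Ioi M.RM ×ˢ M.U) :=
    (M.gbar_smooth l m).comp contDiff_snd.contDiffOn fun x hx => hx.2
  have hHs := (M.g_smooth l m).sub hbar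
  set c := j.1.1.1 / (j.2 : ℝ) with hc
  have hpt : scaleBase c y + (c, j.1.1.2) = (c * (1 + y none), angPart y + j.1.1.2) := by
    simp [scaleBase, mul_add, add_comm]
  have hmem : scaleBase c y + (c, j.1.1.2) ∈ Set.Ioi M.RM ×ˢ M.U := hpt ▸ ⟨hr, hU⟩
  have hO' : IsOpen ((fun y => scaleBase c y + (c, j.1.1.2)) ⁻¹' (Set.Ioi M.RM ×ˢ M.U)) :=
    hO.preimage (by fun_prop)
  have h1 := iterPartial_comp_affine hO hHs (scaleBase c) (c, j.1.1.2)
    [(Pi.single (some a) 1 : Option (Fin d) → ℝ)] hmem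
  have h2 := iterPartial_const_mul hO' (hHs.comp
    ((scaleBase c).contDiff.add contDiff_const).contDiffOn fun y hy => hy) (j.1.1.1 ^ M.ν)
    [(Pi.single (some a) 1 : Option (Fin d) → ℝ)] hmem
  have hvec : scaleBase c (Pi.single (some a) 1) = ((0, unitVec a) : Base d) := by
    simp [scaleBase, angPart_single_some]
  simp only [iterPartial_cons, iterPartial_nil, List.map_cons, List.map_nil, hvec,
    Function.comp_def] at h1 h2
  rw [partialFam, show devFam M K l m j = _ from funext fun y => devFam_eq hj y]
  rw [h2, h1, hpt]
  have hm' : (c * (1 + y none), angPart y + j.1.1.2) ∈ Set.Ioi M.RM ×ˢ M.U := ⟨hr, hU⟩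
  have hd1 : DifferentiableAt ℝ (fun x : Base d => M.g x.1 x.2 l m)
      (c * (1 + y none), angPart y + j.1.1.2) :=
    ((M.g_smooth l m).contDiffAt (hO.mem_nhds hm')).differentiableAt (by simp)
  have hd2 : HasFDerivAt (fun x => M.gbar x l m)
      (fderiv ℝ (fun x => M.gbar x l m) (angPart y + j.1.1.2)) (angPart y + j.1.1.2) :=
    (((M.gbar_smooth l m).contDiffAt (M.isOpen_U.mem_nhds hU)).differentiableAt
      (by simp)).hasFDerivAt
  have hd3 : HasFDerivAt (fun x : Base d => M.gbar x.2 l m) _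
      (c * (1 + y none), angPart y + j.1.1.2) := HasFDerivAt.comp (g := fun x => M.gbar x l m)
      (c * (1 + y none), angPart y + j.1.1.2) hd2 hasFDerivAt_snd
  have h5 := (hd1.hasFDerivAt.sub hd3).fderiv
  have h6 : (fun x : Base d => M.g x.1 x.2 l m - M.gbar x.2 l m)
    = (fun x : Base d => M.g x.1 x.2 l m) - fun x : Base d => M.gbar x.2 l m := rfl
  rw [h6, h5]
  simp

theorem dmetr_apply (G : GoodRadii M K b ρ) (hz : z ∈ Metric.ball 0 ρ) (a l m : Fin d)
    (j : PathIdx M K) :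
    dmetr a l m z j = partialFam (barFam M K l m) (some a) j (fun a => coord z a j)
      + z.1.1 * partialFam (devFam M K l m) (some a) j (fun a => coord z a j) := by
  simp [dmetr, superpose_apply ((G.bar l m).partialFam _) (G.coord_mem z hz),
    superpose_apply ((G.dev l m).partialFam _) (G.coord_mem z hz)]

theorem dmetr_eq_dcoefAt (G : GoodRadii M K b ρ) (hz : z ∈ Metric.ball 0 ρ)
    (hμ : z.1.1 = i.1.1 ^ (-M.ν)) (hr : r = i.1.1 * (1 + z.1.2.1))
    (hϑ : ϑ = i.1.2 + z.1.2.2.2) (a l m : Fin d) (τ : unitInterval) :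
    dmetr a l m z (i, τ) = dcoefAt M r τ (pathAt ϑ (lineVel z.2 i) τ) a l m := by
  have hy := eval_mem_ball (G.coord_mem z hz) (i, τ)
  have hU := G.mem_U _ i.2.2 _ hy
  rw [dmetr_apply G hz, partialFam_barFam hU, dcoefAt]
  by_cases h : (τ : ℝ) = 0
  · have h0 : partialFam (devFam M K l m) (some a) (i, τ) (fun a => coord z a (i, τ)) = 0 := by
      have : devFam M K l m (i, τ) = fun _ => 0 := funext fun y => by simp [devFam, h]
      simp [partialFam, this]
    rw [h0, if_pos h, angPart_coord hϑ]
    simp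
  · rw [partialFam_devFam hU h (dev_radius_gt G.b_le (i, τ) h hy), if_neg h]
    simp only [angPart_coord hϑ, hμ, coord_none_apply]
    rw [← mul_assoc, rpow_neg_mul_rpow_radius, hr]
    have : i.1.1 / (τ : ℝ) * (1 + z.1.2.1) = i.1.1 * (1 + z.1.2.1) / τ := by ring
    rw [this]
    ring

theorem quad_eq_quadAt (G : GoodRadii M K b ρ) (hz : z ∈ Metric.ball 0 ρ)
    (hμ : z.1.1 = i.1.1 ^ (-M.ν)) (hr : r = i.1.1 * (1 + z.1.2.1))
    (hϑ : ϑ = i.1.2 + z.1.2.2.2) (τ : unitInterval) :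
    quad z (i, τ) = quadAt M r ϑ (lineVel z.2 i) τ := by
  simp only [quad, quadAt, BoundedContinuousFunction.sum_apply,
    BoundedContinuousFunction.mul_apply, metr_eq_coefAt G hz hμ hr hϑ, lineVel, line_coe]

theorem invSpeed_eq_speedAt (G : GoodRadii M K b ρ) (hz : z ∈ Metric.ball 0 ρ)
    (hμ : z.1.1 = i.1.1 ^ (-M.ν)) (hr : r = i.1.1 * (1 + z.1.2.1))
    (hϑ : ϑ = i.1.2 + z.1.2.2.2) (τ : unitInterval) :
    invSpeed z (i, τ) = (speedAt M r ϑ (lineVel z.2 i) τ)⁻¹ := by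
  rw [invSpeed, superpose_apply unifSmooth_invSqrtFam (G.quad_mem z hz)]
  simp only [invSqrtFam, speedAt, BoundedContinuousFunction.mul_apply, timeSq_apply,
    quad_eq_quadAt G hz hμ hr hϑ]

theorem mom_eq_momAt (G : GoodRadii M K b ρ) (hz : z ∈ Metric.ball 0 ρ)
    (hμ : z.1.1 = i.1.1 ^ (-M.ν)) (hr : r = i.1.1 * (1 + z.1.2.1))
    (hϑ : ϑ = i.1.2 + z.1.2.2.2) (l : Fin d) (τ : unitInterval) :
    mom l z (i, τ) = momAt M r ϑ (lineVel z.2 i) l τ := by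
  simp only [mom, momAt, BoundedContinuousFunction.sum_apply,
    BoundedContinuousFunction.mul_apply, metr_eq_coefAt G hz hμ hr hϑ,
    invSpeed_eq_speedAt G hz hμ hr hϑ, lineVel, line_coe]

theorem force_eq_forceAt (G : GoodRadii M K b ρ) (hz : z ∈ Metric.ball 0 ρ)
    (hμ : z.1.1 = i.1.1 ^ (-M.ν)) (hr : r = i.1.1 * (1 + z.1.2.1))
    (hϑ : ϑ = i.1.2 + z.1.2.2.2) (a : Fin d) (τ : unitInterval) :
    force a z (i, τ) = forceAt M r ϑ (lineVel z.2 i) a τ := by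
  simp only [force, forceAt, BoundedContinuousFunction.sum_apply,
    BoundedContinuousFunction.mul_apply, BoundedContinuousFunction.smul_apply, smul_eq_mul,
    dmetr_eq_dcoefAt G hz hμ hr hϑ, invSpeed_eq_speedAt G hz hμ hr hϑ, lineVel, line_coe]

theorem lagr_eq_lagrAt (G : GoodRadii M K b ρ) (hz : z ∈ Metric.ball 0 ρ)
    (hμ : z.1.1 = i.1.1 ^ (-M.ν)) (hr : r = i.1.1 * (1 + z.1.2.1))
    (hϑ : ϑ = i.1.2 + z.1.2.2.2) (τ : unitInterval) :
    lagr z (i, τ) = lagrAt M r ϑ (lineVel z.2 i) τ := by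
  rw [lagr, BoundedContinuousFunction.mul_apply,
    superpose_apply unifSmooth_lagrFam (G.quad_mem z hz)]
  simp only [lagrFam, lagrAt, speedAt, BoundedContinuousFunction.mul_apply, timeSq_apply,
    quad_eq_quadAt G hz hμ hr hϑ]

end Evaluation

end ConicScattering

/-! ### Locality in the base point and uniqueness of rays. -/

namespace ConicScattering

open BoundedContinuousFunction

variable {d : ℕ} {M : ConicChart d} {K : Set (Ang d)} {b ρ η : ℝ} {w : Par d → Vel M K}

section PathCongr

variable {r : ℝ} {ϑ : Ang d} {v v' : ℝ → Fin d → ℝ}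

theorem pathAt_congr (h : ∀ τ ∈ Set.Icc (0 : ℝ) 1, v τ = v' τ) {τ : ℝ}
    (hτ : τ ∈ Set.Icc (0 : ℝ) 1) : pathAt ϑ v τ = pathAt ϑ v' τ := by
  simp only [pathAt]
  congr 2
  funext l
  refine intervalIntegral.integral_congr fun t ht => ?_
  rw [Set.uIcc_of_le hτ.1] at ht
  exact congrFun (h t ⟨ht.1, ht.2.trans hτ.2⟩) l

theorem quadAt_congr (h : ∀ τ ∈ Set.Icc (0 : ℝ) 1, v τ = v' τ) {τ : ℝ}
    (hτ : τ ∈ Set.Icc (0 : ℝ) 1) : quadAt M r ϑ v τ = quadAt M r ϑ v' τ := by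
  simp only [quadAt, pathAt_congr h hτ, h τ hτ]

theorem speedAt_congr (h : ∀ τ ∈ Set.Icc (0 : ℝ) 1, v τ = v' τ) {τ : ℝ}
    (hτ : τ ∈ Set.Icc (0 : ℝ) 1) : speedAt M r ϑ v τ = speedAt M r ϑ v' τ := by
  simp only [speedAt, quadAt_congr h hτ]

theorem momAt_congr (h : ∀ τ ∈ Set.Icc (0 : ℝ) 1, v τ = v' τ) {τ : ℝ}
    (hτ : τ ∈ Set.Icc (0 : ℝ) 1) (l : Fin d) : momAt M r ϑ v l τ = momAt M r ϑ v' l τ := by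
  simp only [momAt, pathAt_congr h hτ, speedAt_congr h hτ, h τ hτ]

theorem forceAt_congr (h : ∀ τ ∈ Set.Icc (0 : ℝ) 1, v τ = v' τ) {τ : ℝ}
    (hτ : τ ∈ Set.Icc (0 : ℝ) 1) (l : Fin d) : forceAt M r ϑ v l τ = forceAt M r ϑ v' l τ := by
  simp only [forceAt, pathAt_congr h hτ, speedAt_congr h hτ, h τ hτ]

theorem lagrAt_congr (h : ∀ τ ∈ Set.Icc (0 : ℝ) 1, v τ = v' τ) {τ : ℝ}
    (hτ : τ ∈ Set.Icc (0 : ℝ) 1) : lagrAt M r ϑ v τ = lagrAt M r ϑ v' τ := by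
  simp only [lagrAt, quadAt_congr h hτ, speedAt_congr h hτ]

end PathCongr

section Locality

variable {p : Par d} {u u' : Vel M K} {i : Idx M K}

theorem line_congr {x y : Alg M K} (h : ∀ τ, x (i, τ) = y (i, τ)) : line x i = line y i :=
  funext fun _ => h _

/-- All the operators act within a single line {i} × [0, 1]; this and the following lemmas record
that values at `i` depend on the member `i` only. -/
theorem coord_congr (h : ∀ l τ, u l (i, τ) = u' l (i, τ)) (a : Option (Fin d))
    (τ : unitInterval) : coord (p, u) a (i, τ) = coord (p, u') a (i, τ) := by
  cases a with
  | none => simp only [coord_none_apply]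
  | some a => simp only [coord_some_apply, line_congr (h a)]

theorem metr_congr (G : GoodRadii M K b ρ) (hu : (p, u) ∈ Metric.ball (0 : Par d × Vel M K) ρ)
    (hu' : (p, u') ∈ Metric.ball (0 : Par d × Vel M K) ρ)
    (h : ∀ l τ, u l (i, τ) = u' l (i, τ)) (l m : Fin d) (τ : unitInterval) :
    metr l m (p, u) (i, τ) = metr l m (p, u') (i, τ) := by
  simp only [metr_apply G hu, metr_apply G hu', coord_congr h]

theorem dmetr_congr (G : GoodRadii M K b ρ) (hu : (p, u) ∈ Metric.ball (0 : Par d × Vel M K) ρ)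
    (hu' : (p, u') ∈ Metric.ball (0 : Par d × Vel M K) ρ)
    (h : ∀ l τ, u l (i, τ) = u' l (i, τ)) (a l m : Fin d) (τ : unitInterval) :
    dmetr a l m (p, u) (i, τ) = dmetr a l m (p, u') (i, τ) := by
  simp only [dmetr_apply G hu, dmetr_apply G hu', coord_congr h]

theorem quad_congr (G : GoodRadii M K b ρ) (hu : (p, u) ∈ Metric.ball (0 : Par d × Vel M K) ρ)
    (hu' : (p, u') ∈ Metric.ball (0 : Par d × Vel M K) ρ)
    (h : ∀ l τ, u l (i, τ) = u' l (i, τ)) (τ : unitInterval) :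
    quad (p, u) (i, τ) = quad (p, u') (i, τ) := by
  simp only [quad, BoundedContinuousFunction.sum_apply, BoundedContinuousFunction.mul_apply,
    metr_congr G hu hu' h, h]

theorem invSpeed_congr (G : GoodRadii M K b ρ) (hu : (p, u) ∈ Metric.ball (0 : Par d × Vel M K) ρ)
    (hu' : (p, u') ∈ Metric.ball (0 : Par d × Vel M K) ρ)
    (h : ∀ l τ, u l (i, τ) = u' l (i, τ)) (τ : unitInterval) :
    invSpeed (p, u) (i, τ) = invSpeed (p, u') (i, τ) := by
  simp only [invSpeed, superpose_apply unifSmooth_invSqrtFam (G.quad_mem _ hu),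
    superpose_apply unifSmooth_invSqrtFam (G.quad_mem _ hu'), invSqrtFam,
    BoundedContinuousFunction.mul_apply, quad_congr G hu hu' h]

theorem resid_congr (G : GoodRadii M K b ρ) (hu : (p, u) ∈ Metric.ball (0 : Par d × Vel M K) ρ)
    (hu' : (p, u') ∈ Metric.ball (0 : Par d × Vel M K) ρ)
    (h : ∀ l τ, u l (i, τ) = u' l (i, τ)) (l : Fin d) (τ : unitInterval) :
    resid l (p, u) (i, τ) = resid l (p, u') (i, τ) := by
  have hf : ∀ τ, force l (p, u) (i, τ) = force l (p, u') (i, τ) := fun τ => by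
    simp only [force, BoundedContinuousFunction.sum_apply, BoundedContinuousFunction.mul_apply,
      BoundedContinuousFunction.smul_apply, dmetr_congr G hu hu' h, invSpeed_congr G hu hu' h, h]
  simp only [resid, mom, BoundedContinuousFunction.sub_apply,
    BoundedContinuousFunction.sum_apply, BoundedContinuousFunction.mul_apply, volterra_apply,
    metr_congr G hu hu' h, invSpeed_congr G hu hu' h, h, line_congr hf]

theorem bvp_congr (G : GoodRadii M K b ρ) (hu : (p, u) ∈ Metric.ball (0 : Par d × Vel M K) ρ)
    (hu' : (p, u') ∈ Metric.ball (0 : Par d × Vel M K) ρ)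
    (h : ∀ l τ, u l (i, τ) = u' l (i, τ)) (l : Fin d) (τ : unitInterval) :
    bvp (p, u) l (i, τ) = bvp (p, u') l (i, τ) := by
  simp only [bvp, BoundedContinuousFunction.sub_apply, BoundedContinuousFunction.add_apply,
    meanOp_apply, line_congr (h l), line_congr (resid_congr G hu hu' h l),
    resid_congr G hu hu' h]

end Locality

/-- Replacement of the member of index `i` of a family of functions. -/
def replaceAt (i : Idx M K) (x : C(unitInterval, ℝ)) (y : Alg M K) : Alg M K :=
  open Classical in
  BoundedContinuousFunction.ofNormedAddCommGroup
    (fun j => if j.1 = i then x j.2 else y j)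
    (continuous_prod_of_discrete_left.2 fun i' => by
      by_cases h : i' = i
      · simp only [h, if_true]; fun_prop
      · simp only [h, if_false]; fun_prop)
    (max ‖x‖ ‖y‖) (fun j => by
      split_ifs
      · exact (x.norm_coe_le_norm _).trans (le_max_left _ _)
      · exact (y.norm_coe_le_norm _).trans (le_max_right _ _))

theorem replaceAt_self (i : Idx M K) (x : C(unitInterval, ℝ)) (y : Alg M K) (τ : unitInterval) :
    replaceAt i x y (i, τ) = x τ := if_pos rfl

theorem replaceAt_of_ne {i i' : Idx M K} (h : i' ≠ i) (x : C(unitInterval, ℝ)) (y : Alg M K)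
    (τ : unitInterval) : replaceAt i x y (i', τ) = y (i', τ) := if_neg h

theorem norm_replaceAt_le (i : Idx M K) (x : C(unitInterval, ℝ)) (y : Alg M K) :
    ‖replaceAt i x y‖ ≤ max ‖x‖ ‖y‖ :=
  BoundedContinuousFunction.norm_ofNormedAddCommGroup_le _
    ((norm_nonneg x).trans (le_max_left _ _)) _

namespace SolutionFamily

theorem infMom_apply (p : Par d) (l : Fin d) (i : Idx M K) (τ τ' : unitInterval) :
    infMom w l p (i, τ) = infMom w l p (i, τ') := by
  rw [infMom, meanOp_apply, meanOp_apply]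

theorem isAsymptoticPath (S : SolutionFamily M K b ρ η w) {i : Idx M K} {p : Par d}
    (hp : p ∈ Metric.ball 0 η) (hμ : p.1 = i.1.1 ^ (-M.ν)) {r : ℝ} {θ ϑ : Ang d}
    (hr : r = i.1.1 * (1 + p.2.1)) (hθ : θ = i.1.2 + p.2.2.1) (hϑ : ϑ = i.1.2 + p.2.2.2) :
    IsAsymptoticPath M r θ ϑ (lineVel (w p) i) (fun l => infMom w l p (i, 1)) := by
  have hz := S.mem_ball hp
  have hforce : ∀ l, Set.EqOn (forceAt M r ϑ (lineVel (w p) i) l) (line (force l (p, w p)) i)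
      (Set.Icc 0 1) := fun l τ hτ => by
    rw [line_of_mem _ i hτ]
    exact (force_eq_forceAt S.good hz hμ hr hϑ l ⟨τ, hτ⟩).symm
  have hquad : Set.EqOn (quadAt M r ϑ (lineVel (w p) i)) (line (quad (p, w p)) i)
      (Set.Icc 0 1) := fun τ hτ => by
    rw [line_of_mem _ i hτ]
    exact (quad_eq_quadAt S.good hz hμ hr hϑ ⟨τ, hτ⟩).symm
  refine ⟨fun l => continuous_line _ i, fun τ hτ => ?_, ?_, ?_, fun l => ?_, fun l τ hτ => ?_⟩
  · have h := angPart_coord (z := (p, w p)) hϑ ⟨τ, hτ⟩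
    rw [← h]
    exact S.good.mem_U _ i.2.2 _ (eval_mem_ball (S.good.coord_mem _ hz) (i, ⟨τ, hτ⟩))
  · ext l
    have h := congrArg (fun x : Alg M K => x (i, 1)) (S.meanOp_vel hp l)
    simp only [meanOp_apply, BoundedContinuousFunction.smul_apply, alg_one_apply, smul_eq_mul,
      mul_one] at h
    simp only [pathAt, PiLp.add_apply, lineVel, h, hϑ, hθ]
    ring
  · exact (continuous_line _ i).continuousOn.congr hquad
  · exact (continuous_line _ i).continuousOn.congr (hforce l)
  · rw [← mom_eq_momAt S.good hz hμ hr hϑ l ⟨τ, hτ⟩, S.mom_eq hp,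
      BoundedContinuousFunction.add_apply, volterra_apply, infMom_apply p l i _ 1]
    congr 1
    refine intervalIntegral.integral_congr fun t ht => ?_
    rw [Set.uIcc_of_le hτ.1] at ht
    exact (hforce l ⟨ht.1, ht.2.trans hτ.2⟩).symm

/-- Uniqueness is available only for whole families. The given path is therefore inserted as the
member `i` of the known solution `w p`; by locality the new family still solves the problem, and it
is still small, so it equals `w p`. -/
theorem eq_of_isAsymptoticPath (S : SolutionFamily M K b ρ η w) {i : Idx M K} {p : Par d}
    (hp : p ∈ Metric.ball 0 η) (hμ : p.1 = i.1.1 ^ (-M.ν)) {r : ℝ} {θ ϑ : Ang d}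
    (hr : r = i.1.1 * (1 + p.2.1)) (hθ : θ = i.1.2 + p.2.2.1) (hϑ : ϑ = i.1.2 + p.2.2.2)
    {v : ℝ → Fin d → ℝ} {c : Fin d → ℝ} (hv : IsAsymptoticPath M r θ ϑ v c) {ρ' : ℝ}
    (hρ' : ρ' < ρ) (hbd : ∀ τ ∈ Set.Icc (0 : ℝ) 1, ∀ l, |v τ l| ≤ ρ') :
    ∀ τ ∈ Set.Icc (0 : ℝ) 1, v τ = lineVel (w p) i τ := by
  have hρ : 0 < ρ := S.good.pos
  set x : Fin d → C(unitInterval, ℝ) := fun l =>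
    ⟨fun τ => v τ l, (hv.cont l).comp continuous_subtype_val⟩ with hx
  set u : Vel M K := fun l => replaceAt i (x l) (w p l) with hu
  -- The maximum with zero provides a nonnegative bound, as `ρ'` carries no sign condition.
  have hxn : ∀ l, ‖x l‖ ≤ max ρ' 0 := fun l =>
    (ContinuousMap.norm_le _ (le_max_right _ _)).2 fun τ =>
      (hbd τ τ.2 l).trans (le_max_left _ _)
  have hun : ‖u‖ < ρ := (pi_norm_lt_iff hρ).2 fun l =>
    (norm_replaceAt_le i (x l) (w p l)).trans_lt
      (max_lt ((hxn l).trans_lt (max_lt hρ' hρ)) ((norm_le_pi_norm _ l).trans_lt (S.small p hp)))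
  have hz : (p, u) ∈ Metric.ball (0 : Par d × Vel M K) ρ := by
    rw [mem_ball_zero_iff] at hp ⊢
    exact max_lt (hp.trans_le S.le) hun
  have hvu : ∀ τ ∈ Set.Icc (0 : ℝ) 1, lineVel u i τ = v τ := fun τ hτ => by
    funext l
    rw [lineVel, line_of_mem _ i hτ]
    exact replaceAt_self i (x l) (w p l) ⟨τ, hτ⟩
  have hres : ∀ l τ, resid l (p, u) (i, τ) = c l := fun l τ => by
    rw [resid, BoundedContinuousFunction.sub_apply, mom_eq_momAt S.good hz hμ hr hϑ,
      volterra_apply]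
    rw [momAt_congr hvu τ.2, hv.eqn l τ τ.2]
    have : ∫ t in (0 : ℝ)..τ, line (force l (p, u)) i t
        = ∫ t in (0 : ℝ)..τ, forceAt M r ϑ v l t := by
      refine intervalIntegral.integral_congr fun t ht => ?_
      rw [Set.uIcc_of_le τ.2.1] at ht
      have ht' : t ∈ Set.Icc (0 : ℝ) 1 := ⟨ht.1, ht.2.trans τ.2.2⟩
      rw [line_of_mem _ i ht', force_eq_forceAt S.good hz hμ hr hϑ l ⟨t, ht'⟩,
        forceAt_congr hvu ht']
    simp only at this ⊢
    rw [this]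
    ring
  have hb : bvp (p, u) = 0 := by
    funext l
    ext ⟨i', τ⟩
    by_cases h : i' = i
    · subst h
      have h1 : line (resid l (p, u)) i' = fun _ => c l := funext fun t => hres l _
      have h2 : ∫ t in (0 : ℝ)..1, line (u l) i' t = p.2.2.1 l - p.2.2.2 l := by
        have h3 := congrArg (fun y : Ang d => y l) hv.endpoint
        simp only [pathAt, PiLp.add_apply, hϑ, hθ] at h3
        have h4 : ∫ t in (0 : ℝ)..1, line (u l) i' t = ∫ t in (0 : ℝ)..1, v t l := by
          refine intervalIntegral.integral_congr fun t ht => ?_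
          rw [Set.uIcc_of_le zero_le_one] at ht
          exact congrFun (hvu t ht) l
        rw [h4]
        linarith
      simp only [bvp, BoundedContinuousFunction.sub_apply, BoundedContinuousFunction.add_apply,
        meanOp_apply, h1, h2, hres, BoundedContinuousFunction.smul_apply, alg_one_apply]
      simp
    · rw [bvp_congr S.good hz (S.mem_ball hp) (fun l τ => replaceAt_of_ne h (x l) (w p l) τ),
        S.solves p hp]
  intro τ hτ
  rw [← S.unique p hp u hun hb, hvu τ hτ]

end SolutionFamily

end ConicScattering

/-! ### From families over base points to functions of (r, θ, ϑ). -/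

namespace ConicScattering

open BoundedContinuousFunction

variable {d : ℕ} {M : ConicChart d} {K V : Set (Ang d)} {b ρ η : ℝ} {w : Par d → Vel M K}

/-- The parameter of the boundary value problem with data `(r, θ, ϑ)` based at `(r, θ)`. -/
def basePar (M : ConicChart d) (x : Triple d) : Par d := (x.1 ^ (-M.ν), 0, 0, x.2.2 - x.2.1)

/-- The value at `(r, θ, ϑ)` of a homogeneous family of degree `q`. -/
def famVal (q : ℕ) (A : Par d → Alg M K) (x : Triple d) : ℝ :=
  open Classical in
  -- The factor r^q restores the homogeneity removed by rescaling; the value `0` off the admissible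
  -- base points is a default not met on `paramDomain` when `V ⊆ K`.
  x.1 ^ q * if h : 2 * M.RM < x.1 ∧ x.2.1 ∈ K then A (basePar M x) (⟨(x.1, x.2.1), h⟩, 1) else 0

/-- The values of the members of the family with the same data are related by homogeneity of
degree `q`. -/
def Consistent (η : ℝ) (q : ℕ) (A : Par d → Alg M K) : Prop :=
  ∀ (i i' : Idx M K) (p p' : Par d), p ∈ Metric.ball 0 η → p' ∈ Metric.ball 0 η →
    p.1 = i.1.1 ^ (-M.ν) → p'.1 = i'.1.1 ^ (-M.ν) →
    i.1.1 * (1 + p.2.1) = i'.1.1 * (1 + p'.2.1) → i.1.2 + p.2.2.1 = i'.1.2 + p'.2.2.1 →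
    i.1.2 + p.2.2.2 = i'.1.2 + p'.2.2.2 → i.1.1 ^ q * A p (i, 1) = i'.1.1 ^ q * A p' (i', 1)

/-- The data with a parameter in the ball of radius `η`. -/
def paramDomain (M : ConicChart d) (V : Set (Ang d)) (η : ℝ) : Set (Triple d) :=
  {x | 2 * M.RM < x.1 ∧ x.1 ^ (-M.ν) < η ∧ x.2.1 ∈ V ∧ ‖x.2.2 - x.2.1‖ < η}

/-- The index of the member based at `(r, θ)`. -/
def baseIdx (hVK : V ⊆ K) {x : Triple d} (hx : x ∈ paramDomain M V η) : Idx M K :=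
  ⟨(x.1, x.2.1), hx.1, hVK hx.2.2.1⟩

/-- The linear change of data induced by dilation of the radius. -/
def dilation (c : ℝ) : Triple d →L[ℝ] Par d :=
  (0 : Triple d →L[ℝ] ℝ).prod ((c⁻¹ • ContinuousLinearMap.fst ℝ ℝ (Ang d × Ang d)).prod
    (ContinuousLinearMap.snd ℝ ℝ (Ang d × Ang d)))

theorem dilation_apply (c : ℝ) (e : Triple d) : dilation c e = (0, c⁻¹ * e.1, e.2) := rfl

theorem paramDomain_pos {x : Triple d} (hx : x ∈ paramDomain M V η) : 0 < x.1 := by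
  have := hx.1
  have := M.RM_pos
  linarith

theorem basePar_mem {x : Triple d} (hx : x ∈ paramDomain M V η) :
    basePar M x ∈ Metric.ball (0 : Par d) η := by
  have h0 : 0 < x.1 ^ (-M.ν) := Real.rpow_pos_of_pos (paramDomain_pos hx) _
  have hη : 0 < η := h0.trans hx.2.1
  rw [mem_ball_zero_iff]
  refine max_lt ?_ (max_lt ?_ (max_lt ?_ hx.2.2.2))
  · rw [basePar, Real.norm_of_nonneg h0.le]
    exact hx.2.1
  · simpa [basePar] using hη
  · simpa [basePar] using hη

theorem isOpen_paramDomain (hV : IsOpen V) : IsOpen (paramDomain M V η) := by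
  have hpos : IsOpen {x : Triple d | 2 * M.RM < x.1} :=
    isOpen_lt continuous_const continuous_fst
  have h1 : IsOpen ({x : Triple d | 2 * M.RM < x.1} ∩ (fun x => x.1 ^ (-M.ν)) ⁻¹' Set.Iio η) := by
    refine ContinuousOn.isOpen_inter_preimage ?_ hpos isOpen_Iio
    intro x hx
    have h0 : x.1 ≠ 0 := by
      have := M.RM_pos
      have : 2 * M.RM < x.1 := hx
      linarith
    exact (continuous_fst.continuousAt.rpow_const (Or.inl h0)).continuousWithinAt
  have h2 : IsOpen {x : Triple d | x.2.1 ∈ V} := hV.preimage (by fun_prop)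
  have h3 : IsOpen {x : Triple d | ‖x.2.2 - x.2.1‖ < η} :=
    isOpen_lt (by fun_prop) continuous_const
  convert h1.inter (h2.inter h3) using 1
  ext x
  simp only [paramDomain, Set.mem_ofPred_eq, Set.mem_inter_iff, Set.mem_preimage, Set.mem_Iio]
  tauto

theorem famVal_of_mem (hVK : V ⊆ K) (q : ℕ) (A : Par d → Alg M K) {x : Triple d}
    (hx : x ∈ paramDomain M V η) :
    famVal q A x = x.1 ^ q * A (basePar M x) (baseIdx hVK hx, 1) := by
  rw [famVal, dif_pos ⟨hx.1, hVK hx.2.2.1⟩]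
  rfl

/-- Consistency lets a neighbouring point y be computed from the base point of x: the index and μ
stay frozen and only (s, h, k) move, linearly in y - x. Derivatives in (r, θ, ϑ) thereby become
derivatives in the parameters, although nothing is assumed about the dependence on the index. -/
theorem Consistent.famVal_eq {q : ℕ} {A : Par d → Alg M K} (hA : Consistent η q A) (hVK : V ⊆ K)
    {x y : Triple d} (hx : x ∈ paramDomain M V η) (hy : y ∈ paramDomain M V η)
    (hp : basePar M x + dilation x.1 (y - x) ∈ Metric.ball (0 : Par d) η) :
    famVal q A y
      = x.1 ^ q * A (basePar M x + dilation x.1 (y - x)) (baseIdx hVK hx, 1) := by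
  rw [famVal_of_mem hVK q A hy]
  have hx0 := (paramDomain_pos hx).ne'
  refine (hA (baseIdx hVK hx) (baseIdx hVK hy) _ _ hp (basePar_mem hy) ?_ rfl ?_ ?_ ?_).symm
  · simp [basePar, dilation_apply, baseIdx]
  · simp [basePar, dilation_apply, baseIdx]
    field_simp
    ring
  · simp [basePar, dilation_apply, baseIdx]
  · simp [basePar, dilation_apply, baseIdx]

theorem Consistent.famVal_eventuallyEq {q : ℕ} {A : Par d → Alg M K} (hA : Consistent η q A)
    (hV : IsOpen V) (hVK : V ⊆ K) {x : Triple d} (hx : x ∈ paramDomain M V η) :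
    famVal q A =ᶠ[𝓝 x] fun y => x.1 ^ q *
      A (basePar M x + dilation x.1 (y - x)) (baseIdx hVK hx, 1) := by
  have hc : Continuous fun y : Triple d => basePar M x + dilation x.1 (y - x) := by fun_prop
  have h1 : ∀ᶠ y in 𝓝 x, basePar M x + dilation x.1 (y - x) ∈ Metric.ball (0 : Par d) η := by
    refine hc.continuousAt.eventually_mem (Metric.isOpen_ball.mem_nhds ?_)
    simpa using mem_ball_zero_iff.1 (basePar_mem hx)
  filter_upwards [(isOpen_paramDomain hV).mem_nhds hx, h1] with y hy hp
  exact hA.famVal_eq hVK hx hy hp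

theorem Consistent.hasFDerivAt_famVal {q : ℕ} {A : Par d → Alg M K} (hA : Consistent η q A)
    (hAs : ContDiffOn ℝ ∞ A (Metric.ball 0 η)) (hV : IsOpen V) (hVK : V ⊆ K) {x : Triple d}
    (hx : x ∈ paramDomain M V η) :
    HasFDerivAt (famVal q A) (x.1 ^ q • (evalCLM ℝ (baseIdx hVK hx, (1 : unitInterval))).comp
      ((fderiv ℝ A (basePar M x)).comp (dilation x.1))) x := by
  refine HasFDerivAt.congr_of_eventuallyEq ?_ (hA.famVal_eventuallyEq hV hVK hx)
  have h1 : HasFDerivAt A (fderiv ℝ A (basePar M x)) (basePar M x + dilation x.1 (x - x)) := by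
    rw [sub_self, map_zero, add_zero]
    exact ((hAs.contDiffAt (Metric.isOpen_ball.mem_nhds (basePar_mem hx))).differentiableAt
      (by simp)).hasFDerivAt
  have h2 : HasFDerivAt (fun y : Triple d => basePar M x + dilation x.1 (y - x))
      (dilation x.1) x :=
    ((dilation x.1).hasFDerivAt.comp x ((hasFDerivAt_id x).sub_const x)).const_add _
  exact ((evalCLM ℝ (baseIdx hVK hx, (1 : unitInterval))).hasFDerivAt.comp x
    (h1.comp x h2)).const_mul (x.1 ^ q)

theorem Consistent.contDiffOn_famVal {q : ℕ} {A : Par d → Alg M K} (hA : Consistent η q A)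
    (hAs : ContDiffOn ℝ ∞ A (Metric.ball 0 η)) (hV : IsOpen V) (hVK : V ⊆ K) :
    ContDiffOn ℝ ∞ (famVal q A) (paramDomain M V η) := by
  intro x hx
  refine ContDiffAt.contDiffWithinAt
    (ContDiffAt.congr_of_eventuallyEq ?_ (hA.famVal_eventuallyEq hV hVK hx))
  have h1 : ContDiffAt ℝ ∞ A (basePar M x + dilation x.1 (x - x)) := by
    rw [sub_self, map_zero, add_zero]
    exact hAs.contDiffAt (Metric.isOpen_ball.mem_nhds (basePar_mem hx))
  have h2 : ContDiffAt ℝ ∞ (fun y : Triple d => basePar M x + dilation x.1 (y - x)) x := by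
    fun_prop
  have h3 := ContDiffAt.comp (g := A) x h1 h2
  have h4 : ContDiffAt ℝ ∞ (fun y : Triple d => evalCLM ℝ (baseIdx hVK hx, (1 : unitInterval))
      (A (basePar M x + dilation x.1 (y - x)))) x :=
    ContDiffAt.comp (g := evalCLM ℝ (baseIdx hVK hx, (1 : unitInterval))) x
      (ContinuousLinearMap.contDiff _).contDiffAt h3
  exact contDiffAt_const.mul h4

namespace SolutionFamily

/-- The first path is an asymptotic path for the data of the second and is bounded by `‖w p‖ < ρ`,
so uniqueness identifies them. -/
theorem lineVel_eq (S : SolutionFamily M K b ρ η w) {i i' : Idx M K} {p p' : Par d}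
    (hp : p ∈ Metric.ball 0 η) (hp' : p' ∈ Metric.ball 0 η)
    (hμ : p.1 = i.1.1 ^ (-M.ν)) (hμ' : p'.1 = i'.1.1 ^ (-M.ν))
    (hr : i.1.1 * (1 + p.2.1) = i'.1.1 * (1 + p'.2.1))
    (hθ : i.1.2 + p.2.2.1 = i'.1.2 + p'.2.2.1) (hϑ : i.1.2 + p.2.2.2 = i'.1.2 + p'.2.2.2) :
    ∀ τ ∈ Set.Icc (0 : ℝ) 1, lineVel (w p) i τ = lineVel (w p') i' τ :=
  S.eq_of_isAsymptoticPath hp' hμ' hr hθ hϑ (S.isAsymptoticPath hp hμ rfl rfl rfl) (S.small p hp)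
    fun τ _ l => (abs_line_le _ i τ).trans (norm_le_pi_norm _ l)

theorem consistent_endMom (S : SolutionFamily M K b ρ η w) (l : Fin d) :
    Consistent η 0 (endMom w l) := by
  intro i i' p p' hp hp' hμ hμ' hr hθ hϑ
  rw [pow_zero, pow_zero, one_mul, one_mul, endMom, endMom, atOne_apply, atOne_apply,
    mom_eq_momAt S.good (S.mem_ball hp) hμ rfl rfl, mom_eq_momAt S.good (S.mem_ball hp') hμ' hr hϑ]
  exact momAt_congr (S.lineVel_eq hp hp' hμ hμ' hr hθ hϑ) ⟨zero_le_one, le_rfl⟩ l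

/-- At τ = 0 the integrated force vanishes, so this constant is the momentum of the path there and
depends on the path alone. -/
theorem consistent_infMom (S : SolutionFamily M K b ρ η w) (l : Fin d) :
    Consistent η 0 (infMom w l) := by
  intro i i' p p' hp hp' hμ hμ' hr hθ hϑ
  have h := S.isAsymptoticPath hp hμ rfl rfl rfl
  have h' := S.isAsymptoticPath hp' hμ' hr hθ hϑ
  have h0 : (0 : ℝ) ∈ Set.Icc (0 : ℝ) 1 := ⟨le_rfl, zero_le_one⟩
  have e := h.eqn l 0 h0
  have e' := h'.eqn l 0 h0
  rw [intervalIntegral.integral_same, add_zero] at e e'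
  rw [pow_zero, pow_zero, one_mul, one_mul, ← e, ← e']
  exact momAt_congr (S.lineVel_eq hp hp' hμ hμ' hr hθ hϑ) h0 l

theorem consistent_endInvSpeed (S : SolutionFamily M K b ρ η w) :
    Consistent η 0 (endInvSpeed w) := by
  intro i i' p p' hp hp' hμ hμ' hr hθ hϑ
  rw [pow_zero, pow_zero, one_mul, one_mul, endInvSpeed, endInvSpeed, atOne_apply, atOne_apply,
    invSpeed_eq_speedAt S.good (S.mem_ball hp) hμ rfl rfl,
    invSpeed_eq_speedAt S.good (S.mem_ball hp') hμ' hr hϑ]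
  congr 1
  exact speedAt_congr (S.lineVel_eq hp hp' hμ hμ' hr hθ hϑ) ⟨zero_le_one, le_rfl⟩

theorem psiFam_apply (S : SolutionFamily M K b ρ η w) {i : Idx M K} {p : Par d}
    (hp : p ∈ Metric.ball 0 η) (hμ : p.1 = i.1.1 ^ (-M.ν)) {r : ℝ} {ϑ : Ang d}
    (hr : r = i.1.1 * (1 + p.2.1)) (hϑ : ϑ = i.1.2 + p.2.2.2) (τ : unitInterval) :
    psiFam w p (i, τ)
      = (1 + p.2.1) * (1 - ∫ t in (0 : ℝ)..1, lagrAt M r ϑ (lineVel (w p) i) t) := by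
  rw [psiFam, BoundedContinuousFunction.smul_apply, BoundedContinuousFunction.sub_apply,
    meanOp_apply, alg_one_apply, smul_eq_mul]
  congr 2
  refine intervalIntegral.integral_congr fun t ht => ?_
  rw [Set.uIcc_of_le zero_le_one] at ht
  simp only
  rw [line_of_mem _ i ht]
  exact lagr_eq_lagrAt S.good (S.mem_ball hp) hμ hr hϑ ⟨t, ht⟩

theorem consistent_psiFam (S : SolutionFamily M K b ρ η w) : Consistent η 1 (psiFam w) := by
  intro i i' p p' hp hp' hμ hμ' hr hθ hϑ
  rw [pow_one, pow_one, S.psiFam_apply hp hμ rfl rfl, S.psiFam_apply hp' hμ' hr hϑ, ← mul_assoc,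
    ← mul_assoc, hr]
  congr 2
  refine intervalIntegral.integral_congr fun t ht => ?_
  rw [Set.uIcc_of_le zero_le_one] at ht
  exact lagrAt_congr (S.lineVel_eq hp hp' hμ hμ' hr hθ hϑ) ht

/-- The generating function. -/
def psi (w : Par d → Vel M K) : Triple d → ℝ := famVal 1 (psiFam w)

theorem contDiffOn_psi (S : SolutionFamily M K b ρ η w) (hV : IsOpen V) (hVK : V ⊆ K) :
    ContDiffOn ℝ ∞ (psi w) (paramDomain M V η) :=
  S.consistent_psiFam.contDiffOn_famVal S.contDiffOn_psiFam hV hVK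

theorem fderiv_psi_angular (S : SolutionFamily M K b ρ η w) (hV : IsOpen V) (hVK : V ⊆ K)
    {x : Triple d} (hx : x ∈ paramDomain M V η) (eh ek : Ang d) :
    fderiv ℝ (psi w) x (0, eh, ek)
      = -x.1 * ∑ l, (famVal 0 (endMom w l) x * eh l - famVal 0 (infMom w l) x * ek l) := by
  rw [psi, (S.consistent_psiFam.hasFDerivAt_famVal S.contDiffOn_psiFam hV hVK hx).fderiv]
  have h : dilation x.1 ((0, eh, ek) : Triple d) = (0, 0, eh, ek) := by simp [dilation_apply]
  simp only [_root_.smul_apply, ContinuousLinearMap.comp_apply, h, evalCLM_apply,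
    S.fderiv_psiFam (basePar_mem hx), famVal_of_mem hVK _ _ hx, pow_zero, one_mul, pow_one,
    smul_eq_mul]
  simp [basePar]
  ring

end SolutionFamily

end ConicScattering

/-! ### Tails of rays and the radial derivative of the generating function. -/

namespace ConicScattering

open BoundedContinuousFunction

variable {d : ℕ} {M : ConicChart d} {K V : Set (Ang d)} {b ρ η : ℝ} {w : Par d → Vel M K}

section Restriction

variable {r σ : ℝ} {θ ϑ : Ang d} {v : ℝ → Fin d → ℝ} {c : Fin d → ℝ}

/-- The velocity of the restriction of a path to `[0, σ]`, in rescaled time. -/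
def restrictVel (σ : ℝ) (v : ℝ → Fin d → ℝ) : ℝ → Fin d → ℝ := fun t l => σ * v (σ * t) l

theorem coefAt_div (hσ : σ ≠ 0) (t : ℝ) (x : Ang d) (l m : Fin d) :
    coefAt M (r / σ) t x l m = coefAt M r (σ * t) x l m := by
  simp [coefAt, hσ, div_div]

theorem dcoefAt_div (hσ : σ ≠ 0) (t : ℝ) (x : Ang d) (a l m : Fin d) :
    dcoefAt M (r / σ) t x a l m = dcoefAt M r (σ * t) x a l m := by
  simp [dcoefAt, hσ, div_div]

theorem pathAt_restrictVel (σ t : ℝ) :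
    pathAt ϑ (restrictVel σ v) t = pathAt ϑ v (σ * t) := by
  simp only [pathAt, restrictVel]
  congr 2
  funext l
  rw [intervalIntegral.integral_const_mul,
    intervalIntegral.mul_integral_comp_mul_left (f := fun t => v t l), mul_zero]

theorem quadAt_restrictVel (hσ : σ ≠ 0) (t : ℝ) :
    quadAt M (r / σ) ϑ (restrictVel σ v) t = σ ^ 2 * quadAt M r ϑ v (σ * t) := by
  simp only [quadAt, pathAt_restrictVel, coefAt_div hσ, restrictVel, Finset.mul_sum]
  refine Finset.sum_congr rfl fun l _ => Finset.sum_congr rfl fun m _ => ?_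
  ring

theorem speedAt_restrictVel (hσ : σ ≠ 0) (t : ℝ) :
    speedAt M (r / σ) ϑ (restrictVel σ v) t = speedAt M r ϑ v (σ * t) := by
  simp only [speedAt, quadAt_restrictVel hσ]
  congr 2
  ring

theorem momAt_restrictVel (hσ : σ ≠ 0) (l : Fin d) (t : ℝ) :
    momAt M (r / σ) ϑ (restrictVel σ v) l t = σ * momAt M r ϑ v l (σ * t) := by
  simp only [momAt, speedAt_restrictVel hσ, pathAt_restrictVel, coefAt_div hσ, restrictVel,
    ← mul_assoc, Finset.mul_sum]
  congr 1
  refine Finset.sum_congr rfl fun m _ => ?_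
  ring

theorem forceAt_restrictVel (hσ : σ ≠ 0) (l : Fin d) (t : ℝ) :
    forceAt M (r / σ) ϑ (restrictVel σ v) l t = σ ^ 2 * forceAt M r ϑ v l (σ * t) := by
  simp only [forceAt, speedAt_restrictVel hσ, pathAt_restrictVel, dcoefAt_div hσ, restrictVel]
  rw [← mul_assoc (σ ^ 2)]
  simp only [Finset.mul_sum]
  congr 1
  refine Finset.sum_congr rfl fun l _ => Finset.sum_congr rfl fun m _ => ?_
  ring

theorem lagrAt_restrictVel (hσ : σ ≠ 0) (t : ℝ) :
    lagrAt M (r / σ) ϑ (restrictVel σ v) t = σ ^ 2 * lagrAt M r ϑ v (σ * t) := by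
  simp only [lagrAt, speedAt_restrictVel hσ, quadAt_restrictVel hσ, mul_assoc]

theorem mul_mem_Icc {t : ℝ} (h0 : 0 < σ) (h1 : σ ≤ 1) (ht : t ∈ Set.Icc (0 : ℝ) 1) :
    σ * t ∈ Set.Icc (0 : ℝ) 1 :=
  ⟨mul_nonneg h0.le ht.1, mul_le_one₀ h1 ht.1 ht.2⟩

/-- The part [0, σ] is the tail beyond radius r/σ. Rescaling its time to [0, 1] multiplies
velocities and momenta by σ and forces by σ², so the equation is preserved. -/
theorem IsAsymptoticPath.restrict (h : IsAsymptoticPath M r θ ϑ v c) (h0 : 0 < σ) (h1 : σ ≤ 1) :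
    IsAsymptoticPath M (r / σ) (pathAt ϑ v σ) ϑ (restrictVel σ v) (fun l => σ * c l) := by
  have hmaps : Set.MapsTo (fun t => σ * t) (Set.Icc (0 : ℝ) 1) (Set.Icc 0 1) :=
    fun t ht => mul_mem_Icc h0 h1 ht
  have hc : ContinuousOn (fun t => σ * t) (Set.Icc (0 : ℝ) 1) := by fun_prop
  refine ⟨fun l => ?_, fun τ hτ => ?_, ?_, ?_, fun l => ?_, fun l τ hτ => ?_⟩
  · exact continuous_const.mul ((h.cont l).comp (continuous_const.mul continuous_id))
  · rw [pathAt_restrictVel]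
    exact h.mem _ (hmaps hτ)
  · rw [pathAt_restrictVel, mul_one]
  · refine ContinuousOn.congr ?_ fun t _ => quadAt_restrictVel h0.ne' t
    exact continuousOn_const.mul (h.quad_cont.comp hc hmaps)
  · refine ContinuousOn.congr ?_ fun t _ => forceAt_restrictVel h0.ne' l t
    exact continuousOn_const.mul ((h.force_cont l).comp hc hmaps)
  · simp only [momAt_restrictVel h0.ne', forceAt_restrictVel h0.ne']
    rw [h.eqn l _ (hmaps hτ), intervalIntegral.integral_const_mul, sq, mul_assoc,
      intervalIntegral.mul_integral_comp_mul_left (f := fun t => forceAt M r ϑ v l t), mul_zero]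
    ring

theorem hasDerivAt_pathAt (hv : ∀ l, Continuous fun t => v t l) (ϑ : Ang d) (τ : ℝ) :
    HasDerivAt (pathAt ϑ v) (WithLp.toLp 2 (v τ)) τ := by
  have h : HasDerivAt (fun τ => fun l => ∫ t in (0 : ℝ)..τ, v t l) (v τ) τ :=
    hasDerivAt_pi.2 fun l => ((hv l).integral_hasStrictDerivAt 0 τ).hasDerivAt
  have h2 := ((PiLp.continuousLinearEquiv 2 ℝ (fun _ : Fin d => ℝ)).symm :
    (Fin d → ℝ) →L[ℝ] Ang d).hasFDerivAt.comp_hasDerivAt τ h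
  exact h2.const_add ϑ

theorem pathAt_zero : pathAt ϑ v 0 = ϑ := by
  ext l
  simp [pathAt]

theorem coefAt_posDef {x : Ang d} (hx : x ∈ M.U) {τ : ℝ} (hτ : τ ∈ Set.Icc (0 : ℝ) 1)
    (hr : M.RM < r) : (Matrix.of (coefAt M r τ x)).PosDef := by
  by_cases h : τ = 0
  · have : Matrix.of (coefAt M r τ x) = M.gbar x := by
      ext l m; simp [coefAt, h]
    rw [this]
    exact M.gbar_posDef x hx
  · have : Matrix.of (coefAt M r τ x) = M.g (r / τ) x := by
      ext l m; simp [coefAt, h]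
    rw [this]
    have hpos : 0 < τ := lt_of_le_of_ne hτ.1 (Ne.symm h)
    refine M.g_posDef _ (hr.trans_le ?_) x hx
    rw [le_div_iff₀ hpos]
    exact mul_le_of_le_one_right (M.RM_pos.trans hr).le hτ.2

theorem quadAt_nonneg {τ : ℝ} (hx : pathAt ϑ v τ ∈ M.U) (hτ : τ ∈ Set.Icc (0 : ℝ) 1)
    (hr : M.RM < r) : 0 ≤ quadAt M r ϑ v τ := by
  have h := (coefAt_posDef hx hτ hr).posSemidef.dotProduct_mulVec_nonneg (v τ)
  refine h.trans_eq ?_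
  simp only [dotProduct, Matrix.mulVec, quadAt, Finset.mul_sum, Matrix.of_apply, Pi.star_apply,
    star_trivial]
  refine Finset.sum_congr rfl fun l _ => Finset.sum_congr rfl fun m _ => ?_
  ring

theorem one_le_speedAt {τ : ℝ} (hx : pathAt ϑ v τ ∈ M.U) (hτ : τ ∈ Set.Icc (0 : ℝ) 1)
    (hr : M.RM < r) : 1 ≤ speedAt M r ϑ v τ := by
  rw [speedAt, Real.one_le_sqrt]
  have := quadAt_nonneg (v := v) hx hτ hr
  nlinarith [sq_nonneg τ]

theorem speedAt_sq {τ : ℝ} (hx : pathAt ϑ v τ ∈ M.U) (hτ : τ ∈ Set.Icc (0 : ℝ) 1)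
    (hr : M.RM < r) : speedAt M r ϑ v τ ^ 2 = 1 + τ ^ 2 * quadAt M r ϑ v τ := by
  refine Real.sq_sqrt ?_
  have := quadAt_nonneg (v := v) hx hτ hr
  positivity

theorem sum_momAt_mul (τ : ℝ) :
    ∑ l, momAt M r ϑ v l τ * v τ l = quadAt M r ϑ v τ * (speedAt M r ϑ v τ)⁻¹ := by
  simp only [momAt, quadAt, Finset.sum_mul]
  refine Finset.sum_congr rfl fun l _ => Finset.sum_congr rfl fun m _ => ?_
  ring

end Restriction

namespace SolutionFamily

/-- The velocity of the solution with data `x`. -/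
def pathVel (w : Par d → Vel M K) (hVK : V ⊆ K) {x : Triple d} (hx : x ∈ paramDomain M V η) :
    ℝ → Fin d → ℝ := lineVel (w (basePar M x)) (baseIdx hVK hx)

theorem isAsymptoticPath_pathVel (S : SolutionFamily M K b ρ η w) (hVK : V ⊆ K) {x : Triple d}
    (hx : x ∈ paramDomain M V η) :
    IsAsymptoticPath M x.1 x.2.1 x.2.2 (pathVel w hVK hx) (fun l => famVal 0 (infMom w l) x) := by
  simp only [famVal_of_mem hVK _ _ hx, pow_zero, one_mul]
  refine S.isAsymptoticPath (basePar_mem hx) rfl ?_ ?_ ?_ <;> simp [basePar, baseIdx]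

theorem endMom_eq_momAt (S : SolutionFamily M K b ρ η w) (hVK : V ⊆ K) {x : Triple d}
    (hx : x ∈ paramDomain M V η) (l : Fin d) :
    famVal 0 (endMom w l) x = momAt M x.1 x.2.2 (pathVel w hVK hx) l 1 := by
  rw [famVal_of_mem hVK _ _ hx, pow_zero, one_mul, endMom, atOne_apply]
  refine mom_eq_momAt S.good (S.mem_ball (basePar_mem hx)) rfl ?_ ?_ l 1 <;> simp [basePar, baseIdx]

theorem endInvSpeed_eq_speedAt (S : SolutionFamily M K b ρ η w) (hVK : V ⊆ K) {x : Triple d}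
    (hx : x ∈ paramDomain M V η) :
    famVal 0 (endInvSpeed w) x = (speedAt M x.1 x.2.2 (pathVel w hVK hx) 1)⁻¹ := by
  rw [famVal_of_mem hVK _ _ hx, pow_zero, one_mul, endInvSpeed, atOne_apply]
  refine invSpeed_eq_speedAt S.good (S.mem_ball (basePar_mem hx)) rfl ?_ ?_ 1 <;>
    simp [basePar, baseIdx]

theorem psi_eq_integral (S : SolutionFamily M K b ρ η w) (hVK : V ⊆ K) {x : Triple d}
    (hx : x ∈ paramDomain M V η) :
    psi w x = x.1 * (1 - ∫ t in (0 : ℝ)..1, lagrAt M x.1 x.2.2 (pathVel w hVK hx) t) := by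
  rw [psi, famVal_of_mem hVK _ _ hx, pow_one, S.psiFam_apply (r := x.1) (ϑ := x.2.2)
    (basePar_mem hx) rfl (by simp [basePar, baseIdx]) (by simp [basePar, baseIdx])]
  simp [basePar, pathVel]

/-- The tail has velocity no larger than the original one because σ ≤ 1, hence is the solution for
its own data; its Lagrangian integral is a part of the original one. -/
theorem psi_along_path (S : SolutionFamily M K b ρ η w) (hVK : V ⊆ K) {x : Triple d}
    (hx : x ∈ paramDomain M V η) {σ : ℝ} (h0 : 0 < σ) (h1 : σ ≤ 1)
    (hy : (x.1 / σ, pathAt x.2.2 (pathVel w hVK hx) σ, x.2.2) ∈ paramDomain M V η) :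
    psi w (x.1 / σ, pathAt x.2.2 (pathVel w hVK hx) σ, x.2.2)
      = x.1 / σ - x.1 * ∫ t in (0 : ℝ)..σ, lagrAt M x.1 x.2.2 (pathVel w hVK hx) t := by
  set v := pathVel w hVK hx with hv
  have hpath := (S.isAsymptoticPath_pathVel hVK hx).restrict h0 h1
  have hbd : ∀ τ ∈ Set.Icc (0 : ℝ) 1, ∀ l, |restrictVel σ v τ l| ≤ ‖w (basePar M x)‖ := by
    intro τ _ l
    rw [restrictVel, abs_mul, abs_of_pos h0]
    have h2 : |v (σ * τ) l| ≤ ‖w (basePar M x)‖ :=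
      (abs_line_le _ _ _).trans (norm_le_pi_norm _ l)
    exact (mul_le_of_le_one_left (abs_nonneg _) h1).trans h2
  have heq := S.eq_of_isAsymptoticPath (basePar_mem hy) (i := baseIdx hVK hy) rfl
    (r := x.1 / σ) (θ := pathAt x.2.2 v σ) (ϑ := x.2.2) (by simp [basePar, baseIdx])
    (by simp [basePar, baseIdx]) (by simp [basePar, baseIdx]) hpath
    (S.small _ (basePar_mem hx)) hbd
  rw [S.psi_eq_integral hVK hy]
  have hint : ∫ t in (0 : ℝ)..1, lagrAt M (x.1 / σ) x.2.2 (pathVel w hVK hy) t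
      = σ * ∫ t in (0 : ℝ)..σ, lagrAt M x.1 x.2.2 v t := by
    have h2 : ∫ t in (0 : ℝ)..1, lagrAt M (x.1 / σ) x.2.2 (pathVel w hVK hy) t
        = ∫ t in (0 : ℝ)..1, σ ^ 2 * lagrAt M x.1 x.2.2 v (σ * t) := by
      refine intervalIntegral.integral_congr fun t ht => ?_
      rw [Set.uIcc_of_le zero_le_one] at ht
      rw [← lagrAt_restrictVel h0.ne']
      exact (lagrAt_congr heq ht).symm
    rw [h2, intervalIntegral.integral_const_mul, sq, mul_assoc,
      intervalIntegral.mul_integral_comp_mul_left (f := fun t => lagrAt M x.1 x.2.2 v t),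
      mul_zero, mul_one]
  simp only
  rw [hint]
  field_simp

/-- Along the ray, ψ is explicit by `psi_along_path`. Its derivative at σ = 1 combines the unknown
radial derivative with the known angular one, paired with the velocity, and solving for the former
gives the inverse speed. -/
theorem fderiv_psi_radial (S : SolutionFamily M K b ρ η w) (hV : IsOpen V) (hVK : V ⊆ K)
    {x : Triple d} (hx : x ∈ paramDomain M V η) :
    fderiv ℝ (psi w) x (1, 0, 0) = famVal 0 (endInvSpeed w) x := by
  set v := pathVel w hVK hx with hv
  have hpath := S.isAsymptoticPath_pathVel hVK hx
  have hx0 := paramDomain_pos hx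
  have hRM : M.RM < x.1 := by
    have := hx.1
    have := M.RM_pos
    linarith
  have hone : (1 : ℝ) ∈ Set.Icc (0 : ℝ) 1 := ⟨zero_le_one, le_rfl⟩
  have hcurve : HasDerivAt (fun σ : ℝ => ((x.1 / σ, pathAt x.2.2 v σ, x.2.2) : Triple d))
      (-x.1, WithLp.toLp 2 (v 1), 0) 1 := by
    have h1 : HasDerivAt (fun σ : ℝ => x.1 / σ) (-x.1) 1 := by
      simpa [div_eq_mul_inv] using (hasDerivAt_inv (one_ne_zero (α := ℝ))).const_mul x.1
    exact h1.prodMk ((hasDerivAt_pathAt hpath.cont x.2.2 1).prodMk (hasDerivAt_const _ _))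
  have hval : ((x.1 / 1, pathAt x.2.2 v 1, x.2.2) : Triple d) = x := by
    rw [hpath.endpoint, div_one]
  have hd : HasFDerivAt (psi w) (fderiv ℝ (psi w) x) (x.1 / 1, pathAt x.2.2 v 1, x.2.2) := by
    rw [hval]
    exact (((S.contDiffOn_psi hV hVK).contDiffAt
      ((isOpen_paramDomain hV).mem_nhds hx)).differentiableAt (by simp)).hasFDerivAt
  -- Only σ ≤ 1 is available, so the two derivatives are compared from the left.
  have hleft := (HasFDerivAt.comp_hasDerivAt (1 : ℝ) hd hcurve).hasDerivWithinAt (s := Set.Iic 1)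
  have hlagr : Set.EqOn (lagrAt M x.1 x.2.2 v) (line (lagr (basePar M x, w (basePar M x)))
      (baseIdx hVK hx)) (Set.Icc 0 1) := fun t ht => by
    rw [line_of_mem _ _ ht]
    refine (lagr_eq_lagrAt S.good (S.mem_ball (basePar_mem hx)) rfl ?_ ?_ ⟨t, ht⟩).symm <;>
      simp [basePar, baseIdx]
  have hright : HasDerivWithinAt (fun σ : ℝ => x.1 / σ - x.1 * ∫ t in (0 : ℝ)..σ,
      line (lagr (basePar M x, w (basePar M x))) (baseIdx hVK hx) t)
      (-x.1 - x.1 * lagrAt M x.1 x.2.2 v 1) (Set.Iic 1) 1 := by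
    have h1 : HasDerivAt (fun σ : ℝ => x.1 / σ) (-x.1) 1 := by
      simpa [div_eq_mul_inv] using (hasDerivAt_inv (one_ne_zero (α := ℝ))).const_mul x.1
    rw [hlagr hone]
    exact (h1.sub ((((continuous_line _ _).integral_hasStrictDerivAt 0 1).hasDerivAt).const_mul
      x.1)).hasDerivWithinAt
  have hev : (psi w ∘ fun σ : ℝ => ((x.1 / σ, pathAt x.2.2 v σ, x.2.2) : Triple d))
      =ᶠ[𝓝[Set.Iic 1] 1] fun σ : ℝ => x.1 / σ - x.1 * ∫ t in (0 : ℝ)..σ,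
      line (lagr (basePar M x, w (basePar M x))) (baseIdx hVK hx) t := by
    have h1 : ∀ᶠ σ in 𝓝 (1 : ℝ),
        ((x.1 / σ, pathAt x.2.2 v σ, x.2.2) : Triple d) ∈ paramDomain M V η := by
      refine hcurve.continuousAt.eventually_mem ((isOpen_paramDomain hV).mem_nhds ?_)
      rw [hval]
      exact hx
    filter_upwards [nhdsWithin_le_nhds h1, nhdsWithin_le_nhds (lt_mem_nhds one_pos),
      self_mem_nhdsWithin] with σ hσ hσ0 hσ1
    rw [Function.comp_apply, S.psi_along_path hVK hx hσ0 hσ1 hσ]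
    congr 2
    refine intervalIntegral.integral_congr fun t ht => ?_
    rw [Set.uIcc_of_le (le_of_lt hσ0)] at ht
    exact hlagr ⟨ht.1, ht.2.trans hσ1⟩
  have huniq := (uniqueDiffWithinAt_Iic (1 : ℝ)).eq_deriv _
    hleft (hright.congr_of_eventuallyEq hev (hev.self_of_nhdsWithin Set.self_mem_Iic))
  have hsplit : ((-x.1, WithLp.toLp 2 (v 1), 0) : Triple d)
      = (-x.1) • ((1, 0, 0) : Triple d) + (0, WithLp.toLp 2 (v 1), 0) := by simp
  rw [hsplit, map_add, map_smul, S.fderiv_psi_angular hV hVK hx] at huniq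
  have hsum : ∑ l, (famVal 0 (endMom w l) x * (WithLp.toLp 2 (v 1) : Ang d) l
      - famVal 0 (infMom w l) x * (0 : Ang d) l)
      = quadAt M x.1 x.2.2 v 1 * (speedAt M x.1 x.2.2 v 1)⁻¹ := by
    rw [← sum_momAt_mul]
    refine Finset.sum_congr rfl fun l _ => ?_
    rw [S.endMom_eq_momAt hVK hx, ← hv]
    simp
  rw [hsum] at huniq
  rw [S.endInvSpeed_eq_speedAt hVK hx]
  have hmem := hpath.mem 1 hone
  have hS1 : 1 ≤ speedAt M x.1 x.2.2 v 1 := one_le_speedAt hmem hone hRM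
  have hSq := speedAt_sq (v := v) hmem hone hRM
  rw [lagrAt] at huniq
  rw [← hv]
  generalize speedAt M x.1 x.2.2 v 1 = Sp at *
  generalize fderiv ℝ (psi w) x (1, 0, 0) = D at *
  have hQ : quadAt M x.1 x.2.2 v 1 = Sp ^ 2 - 1 := by linarith
  rw [hQ] at huniq
  have hpos : 0 < Sp := by linarith
  have hpos' : 0 < 1 + Sp := by linarith
  simp only [smul_eq_mul] at huniq
  -- With Q = S² - 1 the Lagrangian at τ = 1 is S - 1 and momentum · velocity is S - S⁻¹.
  have h3 : (Sp ^ 2 - 1) * (1 + Sp)⁻¹ = Sp - 1 := by field_simp; ring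
  have h4 : (Sp ^ 2 - 1) * Sp⁻¹ = Sp - Sp⁻¹ := by field_simp
  rw [h3, h4] at huniq
  have h5 : x.1 * (D - Sp⁻¹) = 0 := by linarith
  rcases mul_eq_zero.1 h5 with h | h <;> linarith

end SolutionFamily

end ConicScattering

/-! ### The Hamiltonian vector field in terms of velocities. -/

namespace ConicScattering

variable {d : ℕ} {M : ConicChart d}

section Gradients

theorem inner_gradient (f : Ang d → ℝ) (x e : Ang d) : inner ℝ (gradient f x) e = fderiv ℝ f x e := by
  rw [gradient, InnerProductSpace.toDual_symm_apply]

theorem gradient_apply (f : Ang d → ℝ) (x : Ang d) (a : Fin d) :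
    gradient f x a = fderiv ℝ f x (unitVec a) := by
  rw [← inner_gradient, unitVec, EuclideanSpace.inner_single_right]
  simp

theorem hasDerivAt_add_smul {E : Type*} [NormedAddCommGroup E] [NormedSpace ℝ E] (x e : E) :
    HasDerivAt (fun t : ℝ => x + t • e) e 0 := by
  simpa using ((hasDerivAt_id (0 : ℝ)).smul_const e).const_add x

theorem hasDerivAt_toLp {f : Fin d → ℝ → ℝ} {f' : Fin d → ℝ} {t : ℝ}
    (h : ∀ l, HasDerivAt (f l) (f' l) t) :
    HasDerivAt (fun t => (WithLp.toLp 2 fun l => f l t : Ang d)) (WithLp.toLp 2 f') t :=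
  ((PiLp.continuousLinearEquiv 2 ℝ (fun _ : Fin d => ℝ)).symm :
    (Fin d → ℝ) →L[ℝ] Ang d).hasFDerivAt.comp_hasDerivAt t
      (hasDerivAt_pi.2 h : HasDerivAt (fun t => fun l => f l t) f' t)

end Gradients

section Kinetic

/-- The angular part of the symbol, as a function of `(r, θ, η)`. -/
def kinetic (M : ConicChart d) (x : Triple d) : ℝ :=
  (x.1 ^ 2)⁻¹ * ∑ j, ∑ k, (M.g x.1 x.2.1)⁻¹ j k * x.2.2 j * x.2.2 k

theorem symbolP_one (z : Phase d) :
    symbolP M 1 z = z.2.2.1 ^ 2 + kinetic M (z.1, z.2.1, z.2.2.2) := by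
  simp [symbolP, kinetic]

theorem differentiableAt_kinetic {x : Triple d} (hr : M.RM < x.1) (hθ : x.2.1 ∈ M.U) :
    DifferentiableAt ℝ (kinetic M) x := by
  have hO : IsOpen {x : Triple d | M.RM < x.1 ∧ x.2.1 ∈ M.U} :=
    (isOpen_lt continuous_const continuous_fst).inter (M.isOpen_U.preimage (by fun_prop))
  have h1 : ∀ j k, ContDiffOn ℝ ∞ (fun x : Triple d => (M.g x.1 x.2.1)⁻¹ j k)
      {x : Triple d | M.RM < x.1 ∧ x.2.1 ∈ M.U} := fun j k => by
    refine contDiffOn_inv_matrix (A := fun x : Triple d => M.g x.1 x.2.1) (fun l m => ?_)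
      (fun x hx => (M.g_posDef _ hx.1 _ hx.2).det_pos.ne') j k
    exact (M.g_smooth l m).comp (t := Set.Ioi M.RM ×ˢ M.U)
      (f := fun x : Triple d => ((x.1, x.2.1) : Base d)) (by fun_prop) fun x hx => hx
  have h2 : ∀ j k, DifferentiableAt ℝ (fun x : Triple d => (M.g x.1 x.2.1)⁻¹ j k) x := fun j k =>
    ((h1 j k).contDiffAt (hO.mem_nhds ⟨hr, hθ⟩)).differentiableAt (by simp)
  have h3 : ∀ j, DifferentiableAt ℝ (fun x : Triple d => x.2.2 j) x := fun j => by
    have : ContDiff ℝ ∞ fun x : Triple d => x.2.2 j := by fun_prop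
    exact this.contDiffAt.differentiableAt (by simp)
  have h4 : DifferentiableAt ℝ (fun x : Triple d => (x.1 ^ 2)⁻¹) x := by
    refine DifferentiableAt.inv (by fun_prop) ?_
    have := M.RM_pos.trans hr
    positivity
  exact h4.mul (DifferentiableAt.fun_sum fun j _ => DifferentiableAt.fun_sum fun k _ =>
    ((h2 j k).mul (h3 j)).mul (h3 k))

variable {r : ℝ} {θ η : Ang d} {u : Fin d → ℝ}

theorem inv_mulVec_eq (hr : M.RM < r) (hθ : θ ∈ M.U) (hu : ∀ l, η l = ∑ m, M.g r θ l m * u m)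
    (j : Fin d) : ∑ k, (M.g r θ)⁻¹ j k * η k = u j := by
  have hdet : IsUnit (M.g r θ).det := (M.g_posDef r hr θ hθ).det_pos.ne'.isUnit
  have h1 : (M.g r θ)⁻¹.mulVec ((M.g r θ).mulVec u) = u := by
    rw [Matrix.mulVec_mulVec, Matrix.nonsing_inv_mul _ hdet, Matrix.one_mulVec]
  have h2 : (M.g r θ).mulVec u = fun l => η l := funext fun l => (hu l).symm
  rw [h2] at h1
  exact congrFun h1 j

theorem g_symm (hr : M.RM < r) (hθ : θ ∈ M.U) (l m : Fin d) : M.g r θ l m = M.g r θ m l := by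
  simpa using (M.g_posDef r hr θ hθ).isHermitian.apply m l

theorem g_inv_symm (hr : M.RM < r) (hθ : θ ∈ M.U) (l m : Fin d) :
    (M.g r θ)⁻¹ l m = (M.g r θ)⁻¹ m l := by
  simpa using (M.g_posDef r hr θ hθ).isHermitian.inv.apply m l

theorem kinetic_eq (hr : M.RM < r) (hθ : θ ∈ M.U) (hu : ∀ l, η l = ∑ m, M.g r θ l m * u m) :
    kinetic M (r, θ, η) = (r ^ 2)⁻¹ * ∑ j, η j * u j := by
  rw [kinetic]
  congr 1
  refine Finset.sum_congr rfl fun j _ => ?_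
  rw [← inv_mulVec_eq hr hθ hu j, Finset.mul_sum]
  refine Finset.sum_congr rfl fun k _ => ?_
  ring

theorem fderiv_kinetic_momentum (hr : M.RM < r) (hθ : θ ∈ M.U)
    (hu : ∀ l, η l = ∑ m, M.g r θ l m * u m) (e : Ang d) :
    fderiv ℝ (kinetic M) (r, θ, η) (0, 0, e) = 2 * (r ^ 2)⁻¹ * ∑ j, u j * e j := by
  have hline : HasDerivAt (fun t : ℝ => ((r, θ, η) : Triple d) + t • ((0, 0, e) : Triple d))
      (0, 0, e) 0 :=
    hasDerivAt_add_smul _ _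
  have hd : HasFDerivAt (kinetic M) (fderiv ℝ (kinetic M) (r, θ, η))
      (((r, θ, η) : Triple d) + (0 : ℝ) • ((0, 0, e) : Triple d)) := by
    rw [zero_smul, add_zero]
    exact (differentiableAt_kinetic hr hθ).hasFDerivAt
  have h1 := hd.comp_hasDerivAt (0 : ℝ) hline
  have hc : ∀ j, HasDerivAt (fun t : ℝ => η j + t * e j) (e j) 0 := fun j => by
    simpa using ((hasDerivAt_id (0 : ℝ)).mul_const (e j)).const_add (η j)
  have h2 : HasDerivAt (fun t : ℝ => (r ^ 2)⁻¹ * ∑ j, ∑ k, (M.g r θ)⁻¹ j k * (η j + t * e j)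
      * (η k + t * e k)) ((r ^ 2)⁻¹ * ∑ j, ∑ k, ((M.g r θ)⁻¹ j k * e j * (η k + 0 * e k)
        + (M.g r θ)⁻¹ j k * (η j + 0 * e j) * e k)) 0 :=
    (HasDerivAt.fun_sum fun j _ => HasDerivAt.fun_sum fun k _ =>
      ((hc j).const_mul _).mul (hc k)).const_mul _
  have h3 := h1.unique (h2.congr_of_eventuallyEq (Filter.Eventually.of_forall fun t => by
    simp [kinetic]))
  rw [h3]
  simp only [zero_mul, add_zero, Finset.sum_add_distrib]
  have h4 : ∑ j, ∑ k, (M.g r θ)⁻¹ j k * e j * η k = ∑ j, u j * e j := by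
    refine Finset.sum_congr rfl fun j _ => ?_
    rw [← inv_mulVec_eq hr hθ hu j, Finset.sum_mul]
    refine Finset.sum_congr rfl fun k _ => ?_
    ring
  have h5 : ∑ j, ∑ k, (M.g r θ)⁻¹ j k * η j * e k = ∑ j, u j * e j := by
    rw [Finset.sum_comm, ← h4]
    refine Finset.sum_congr rfl fun j _ => Finset.sum_congr rfl fun k _ => ?_
    rw [g_inv_symm hr hθ]
    ring
  rw [h4, h5]
  ring

/-- The derivative of the inverse matrix is avoided: y = g⁻¹η is differentiated through the identity
g y = η, so g y' = -g' y, and pairing with u = g⁻¹η gives -g'(u, u). -/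
theorem fderiv_kinetic_angle (hr : M.RM < r) (hθ : θ ∈ M.U)
    (hu : ∀ l, η l = ∑ m, M.g r θ l m * u m) (e : Ang d) :
    fderiv ℝ (kinetic M) (r, θ, η) (0, e, 0) = -(r ^ 2)⁻¹ * ∑ l, ∑ m,
      fderiv ℝ (fun y : Base d => M.g y.1 y.2 l m) (r, θ) (0, e) * u m * u l := by
  have hline : HasDerivAt (fun t : ℝ => ((r, θ, η) : Triple d) + t • ((0, e, 0) : Triple d))
      (0, e, 0) 0 :=
    hasDerivAt_add_smul _ _
  have hd : HasFDerivAt (kinetic M) (fderiv ℝ (kinetic M) (r, θ, η))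
      (((r, θ, η) : Triple d) + (0 : ℝ) • ((0, e, 0) : Triple d)) := by
    rw [zero_smul, add_zero]
    exact (differentiableAt_kinetic hr hθ).hasFDerivAt
  have h1 := hd.comp_hasDerivAt (0 : ℝ) hline
  have hO : IsOpen (Set.Ioi M.RM ×ˢ M.U : Set (Base d)) := isOpen_Ioi.prod M.isOpen_U
  have hmem : ((r, θ) : Base d) ∈ (Set.Ioi M.RM ×ˢ M.U : Set (Base d)) := ⟨hr, hθ⟩
  have hbase : HasDerivAt (fun t : ℝ => ((r, θ) : Base d) + t • ((0, e) : Base d)) (0, e) 0 :=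
    hasDerivAt_add_smul _ _
  have hA : ∀ l m, HasDerivAt (fun t : ℝ => M.g r (θ + t • e) l m)
      (fderiv ℝ (fun y : Base d => M.g y.1 y.2 l m) (r, θ) (0, e)) 0 := fun l m => by
    have h2 : HasFDerivAt (fun y : Base d => M.g y.1 y.2 l m)
        (fderiv ℝ (fun y : Base d => M.g y.1 y.2 l m) (r, θ))
        (((r, θ) : Base d) + (0 : ℝ) • ((0, e) : Base d)) := by
      rw [zero_smul, add_zero]
      exact (((M.g_smooth l m).contDiffAt (hO.mem_nhds hmem)).differentiableAt
        (by simp)).hasFDerivAt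
    refine (h2.comp_hasDerivAt (0 : ℝ) hbase).congr_of_eventuallyEq
      (Filter.Eventually.of_forall fun t => ?_)
    simp
  have hB : ∀ j k, DifferentiableAt ℝ (fun t : ℝ => (M.g r (θ + t • e))⁻¹ j k) 0 := fun j k => by
    have h2 : ContDiffOn ℝ ∞ (fun y : Base d => (M.g y.1 y.2)⁻¹ j k) (Set.Ioi M.RM ×ˢ M.U) :=
      contDiffOn_inv_matrix (A := fun x : Base d => M.g x.1 x.2) M.g_smooth
        (fun x hx => (M.g_posDef _ hx.1 _ hx.2).det_pos.ne') j k
    have h3 : DifferentiableAt ℝ (fun y : Base d => (M.g y.1 y.2)⁻¹ j k)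
        (((r, θ) : Base d) + (0 : ℝ) • ((0, e) : Base d)) := by
      rw [zero_smul, add_zero]
      exact ((h2.contDiffAt (hO.mem_nhds hmem)).differentiableAt (by simp))
    refine (h3.comp (0 : ℝ) hbase.differentiableAt).congr_of_eventuallyEq
      (Filter.Eventually.of_forall fun t => ?_)
    simp
  set y : Fin d → ℝ → ℝ := fun j t => ∑ k, (M.g r (θ + t • e))⁻¹ j k * η k with hy
  have hyd : ∀ j, HasDerivAt (y j) (deriv (y j) 0) 0 := fun j =>
    (DifferentiableAt.fun_sum fun k _ => (hB j k).mul_const (η k)).hasDerivAt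
  have hy0 : ∀ j, y j 0 = u j := fun j => by
    simp only [hy, zero_smul, add_zero]
    exact inv_mulVec_eq hr hθ hu j
  have hθe : ∀ᶠ t in 𝓝 (0 : ℝ), θ + t • e ∈ M.U := by
    have hc : Continuous fun t : ℝ => θ + t • e := by fun_prop
    exact hc.continuousAt.eventually_mem (M.isOpen_U.mem_nhds (by simpa using hθ))
  have hAy : ∀ l, ∑ m, (fderiv ℝ (fun y : Base d => M.g y.1 y.2 l m) (r, θ) (0, e) * u m
      + M.g r θ l m * deriv (y m) 0) = 0 := fun l => by
    have h2 : HasDerivAt (fun t : ℝ => ∑ m, M.g r (θ + t • e) l m * y m t)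
        (∑ m, (fderiv ℝ (fun y : Base d => M.g y.1 y.2 l m) (r, θ) (0, e) * y m 0
          + M.g r (θ + (0 : ℝ) • e) l m * deriv (y m) 0)) 0 :=
      HasDerivAt.fun_sum fun m _ => (hA l m).mul (hyd m)
    have h3 : (fun t : ℝ => ∑ m, M.g r (θ + t • e) l m * y m t) =ᶠ[𝓝 0] fun _ => η l := by
      filter_upwards [hθe] with t ht
      have hdet : IsUnit (M.g r (θ + t • e)).det := (M.g_posDef r hr _ ht).det_pos.ne'.isUnit
      have h4 : (M.g r (θ + t • e)).mulVec ((M.g r (θ + t • e))⁻¹.mulVec fun k => η k)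
          = fun k => η k := by
        rw [Matrix.mulVec_mulVec, Matrix.mul_nonsing_inv _ hdet, Matrix.one_mulVec]
      exact congrFun h4 l
    have h5 := (h2.congr_of_eventuallyEq h3.symm).unique (hasDerivAt_const (0 : ℝ) (η l))
    simpa [hy0] using h5
  have h2 : HasDerivAt (fun t : ℝ => (r ^ 2)⁻¹ * ∑ j, η j * y j t)
      ((r ^ 2)⁻¹ * ∑ j, η j * deriv (y j) 0) 0 :=
    (HasDerivAt.fun_sum fun j _ => (hyd j).const_mul (η j)).const_mul _
  have h3 := h1.unique (h2.congr_of_eventuallyEq (Filter.Eventually.of_forall fun t => by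
    simp only [kinetic, hy, Function.comp_apply, Prod.fst_add, Prod.snd_add, Prod.smul_fst,
      Prod.smul_snd, smul_zero, add_zero, Finset.mul_sum]
    refine Finset.sum_congr rfl fun j _ => Finset.sum_congr rfl fun k _ => ?_
    ring))
  rw [h3, neg_mul, ← mul_neg]
  congr 1
  have h4 : ∑ j, η j * deriv (y j) 0 = ∑ l, u l * ∑ m, M.g r θ l m * deriv (y m) 0 := by
    simp only [hu, Finset.sum_mul, Finset.mul_sum]
    rw [Finset.sum_comm]
    refine Finset.sum_congr rfl fun j _ => Finset.sum_congr rfl fun k _ => ?_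
    rw [g_symm hr hθ]
    ring
  rw [h4, ← Finset.sum_neg_distrib]
  refine Finset.sum_congr rfl fun l _ => ?_
  have h5 := hAy l
  rw [Finset.sum_add_distrib] at h5
  have h6 : ∑ m, M.g r θ l m * deriv (y m) 0
      = -∑ m, fderiv ℝ (fun y : Base d => M.g y.1 y.2 l m) (r, θ) (0, e) * u m := by linarith
  rw [h6, mul_neg, Finset.mul_sum]
  congr 1
  refine Finset.sum_congr rfl fun m _ => ?_
  ring

/-- The Hamiltonian vector field in terms of the angular part of the symbol. -/
theorem hamField_symbolP_one {ρ : ℝ} (hr : M.RM < r) (hθ : θ ∈ M.U) :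
    hamField (symbolP M 1) (r, θ, ρ, η) = (2 * ρ,
      WithLp.toLp 2 fun a => fderiv ℝ (kinetic M) (r, θ, η) (0, 0, unitVec a),
      -fderiv ℝ (kinetic M) (r, θ, η) (1, 0, 0),
      WithLp.toLp 2 fun a => -fderiv ℝ (kinetic M) (r, θ, η) (0, unitVec a, 0)) := by
  have hd := (differentiableAt_kinetic (x := (r, θ, η)) hr hθ).hasFDerivAt
  simp only [hamField, symbolP_one]
  refine Prod.ext ?_ (Prod.ext ?_ (Prod.ext ?_ ?_))
  · simp
  · ext a
    simp only [gradient_apply]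
    have h1 : HasFDerivAt (fun η : Ang d => ((r, θ, η) : Triple d))
        ((0 : Ang d →L[ℝ] ℝ).prod ((0 : Ang d →L[ℝ] Ang d).prod (ContinuousLinearMap.id ℝ _))) η :=
      (hasFDerivAt_const r η).prodMk ((hasFDerivAt_const θ η).prodMk (hasFDerivAt_id η))
    have h2 := (HasFDerivAt.comp (g := kinetic M) η hd h1).const_add (ρ ^ 2)
    have h3 := h2.fderiv
    simp only [Function.comp_def] at h3
    rw [h3]
    simp
  · simp only
    have h1 : HasDerivAt (fun r : ℝ => ((r, θ, η) : Triple d)) (1, 0, 0) r :=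
      (hasDerivAt_id r).prodMk (hasDerivAt_const r (θ, η))
    have h2 := (HasFDerivAt.comp_hasDerivAt (l := kinetic M) r hd h1).const_add (ρ ^ 2)
    exact congrArg Neg.neg h2.deriv
  · ext a
    simp only [PiLp.neg_apply, gradient_apply]
    have h1 : HasFDerivAt (fun θ : Ang d => ((r, θ, η) : Triple d))
        ((0 : Ang d →L[ℝ] ℝ).prod ((ContinuousLinearMap.id ℝ _).prod (0 : Ang d →L[ℝ] Ang d))) θ :=
      (hasFDerivAt_const r θ).prodMk ((hasFDerivAt_id θ).prodMk (hasFDerivAt_const η θ))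
    have h2 := (HasFDerivAt.comp (g := kinetic M) θ hd h1).const_add (ρ ^ 2)
    have h3 := h2.fderiv
    simp only [Function.comp_def] at h3
    rw [h3]
    simp

theorem clm_triple_eq (T : Triple d →L[ℝ] ℝ) (x : Triple d) :
    T x = x.1 * T (1, 0, 0) + ∑ a, x.2.1 a * T (0, unitVec a, 0)
      + ∑ a, x.2.2 a * T (0, 0, unitVec a) := by
  have hsum : ∀ y : Ang d, y = ∑ a, y a • unitVec a := fun y => by
    ext b
    simp [unitVec, Finset.sum_apply, Pi.single_apply]
  have h1 : T (0, x.2.1, 0) = ∑ a, x.2.1 a * T (0, unitVec a, 0) := by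
    have := map_sum (T.comp ((ContinuousLinearMap.inr ℝ ℝ (Ang d × Ang d)).comp
      (ContinuousLinearMap.inl ℝ (Ang d) (Ang d)))) (fun a => x.2.1 a • unitVec a) Finset.univ
    rw [← hsum x.2.1] at this
    simpa using this
  have h2 : T (0, 0, x.2.2) = ∑ a, x.2.2 a * T (0, 0, unitVec a) := by
    have := map_sum (T.comp ((ContinuousLinearMap.inr ℝ ℝ (Ang d × Ang d)).comp
      (ContinuousLinearMap.inr ℝ (Ang d) (Ang d)))) (fun a => x.2.2 a • unitVec a) Finset.univ
    rw [← hsum x.2.2] at this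
    simpa using this
  rw [← h1, ← h2, ← smul_eq_mul, ← map_smul, ← map_add, ← map_add]
  congr 1
  simp

/-- Conservation of energy gives the equation for the radial momentum. -/
theorem hasDerivAt_of_energy {R : ℝ → ℝ} {Θ H : ℝ → Ang d} {s : ℝ}
    (hr : M.RM < R s) (hθ : Θ s ∈ M.U) (hlt : kinetic M (R s, Θ s, H s) < 1)
    (hR : HasDerivAt R (2 * √(1 - kinetic M (R s, Θ s, H s))) s)
    (hΘ : HasDerivAt Θ (WithLp.toLp 2 fun a =>
      fderiv ℝ (kinetic M) (R s, Θ s, H s) (0, 0, unitVec a)) s)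
    (hH : HasDerivAt H (WithLp.toLp 2 fun a =>
      -fderiv ℝ (kinetic M) (R s, Θ s, H s) (0, unitVec a, 0)) s) :
    HasDerivAt (fun s => (R s, Θ s, √(1 - kinetic M (R s, Θ s, H s)), H s))
      (hamField (symbolP M 1) (R s, Θ s, √(1 - kinetic M (R s, Θ s, H s)), H s)) s := by
  rw [hamField_symbolP_one hr hθ]
  have hd := (differentiableAt_kinetic (x := (R s, Θ s, H s)) hr hθ).hasFDerivAt
  have hpos : 0 < 1 - kinetic M (R s, Θ s, H s) := by linarith
  have h1 := HasFDerivAt.comp_hasDerivAt (l := kinetic M) s hd (hR.prodMk (hΘ.prodMk hH))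
  have h2 := (h1.const_sub 1).sqrt hpos.ne'
  refine hR.prodMk (hΘ.prodMk (HasDerivAt.prodMk ?_ hH))
  refine h2.congr_deriv ?_
  rw [clm_triple_eq]
  have hs : 0 < √(1 - kinetic M (R s, Θ s, H s)) := Real.sqrt_pos.2 hpos
  simp only [Function.comp_apply]
  -- By Hamilton's equations the angular and momentum parts of the derivative of the energy cancel;
  -- only the radial part drives ρ.
  have h3 : ∑ a, -fderiv ℝ (kinetic M) (R s, Θ s, H s) (0, unitVec a, 0)
        * fderiv ℝ (kinetic M) (R s, Θ s, H s) (0, 0, unitVec a)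
      = -∑ a, fderiv ℝ (kinetic M) (R s, Θ s, H s) (0, 0, unitVec a)
        * fderiv ℝ (kinetic M) (R s, Θ s, H s) (0, unitVec a, 0) := by
    rw [← Finset.sum_neg_distrib]
    exact Finset.sum_congr rfl fun a _ => by ring
  rw [h3]
  field_simp
  ring

end Kinetic

end ConicScattering

/-! ### Time along a ray and its scattering limit. -/

namespace ConicScattering

variable {d : ℕ} {M : ConicChart d}

section RadialTime

variable {L : ℝ → ℝ} {r₀ : ℝ}

/-- The radius of a geodesic ray as a function of time. -/
theorem exists_radius_of_time (hL : Continuous L) (hL0 : ∀ t, 0 ≤ L t) (hr₀ : 0 < r₀) :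
    ∃ R : ℝ → ℝ, R 0 = r₀ ∧ (∀ s, 0 ≤ s → r₀ ≤ R s) ∧ Tendsto R atTop atTop ∧
      (∀ s, 0 ≤ s → HasDerivAt R (2 * (1 + (r₀ / R s) ^ 2 * L (r₀ / R s))⁻¹) s) ∧
      ∀ s, 0 ≤ s → 2 * s = R s - r₀ + r₀ * ∫ t in (r₀ / R s)..1, L t := by
  -- This is the speed as a function of the radius u, so that half its primitive is time. The
  -- maximum with `r₀` extends it to the whole line with values at least 1, which makes time an
  -- increasing bijection of ℝ whose inverse is the radius.
  set f : ℝ → ℝ := fun u => 1 + (r₀ / max u r₀) ^ 2 * L (r₀ / max u r₀) with hf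
  have hmax : ∀ u, max u r₀ ≠ 0 := fun u => (hr₀.trans_le (le_max_right _ _)).ne'
  have hq : Continuous fun u => r₀ / max u r₀ := continuous_const.div (by fun_prop) hmax
  have hfc : Continuous f := by
    have := hL.comp hq
    exact continuous_const.add ((hq.pow 2).mul this)
  have hf1 : ∀ u, 1 ≤ f u := fun u => by
    have := mul_nonneg (sq_nonneg (r₀ / max u r₀)) (hL0 (r₀ / max u r₀))
    simp only [hf]
    linarith
  set T : ℝ → ℝ := fun x => (∫ u in r₀..x, f u) / 2 with hT
  have hTd : ∀ x, HasDerivAt T (f x / 2) x := fun x =>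
    (hfc.integral_hasStrictDerivAt r₀ x).hasDerivAt.div_const 2
  have hTc : Continuous T := continuous_iff_continuousAt.2 fun x => (hTd x).continuousAt
  have hTmono : StrictMono T := strictMono_of_deriv_pos fun x => by
    rw [(hTd x).deriv]
    have := hf1 x
    linarith
  have hTr : T r₀ = 0 := by simp [hT]
  have hge : ∀ x y, x ≤ y → (y - x) / 2 ≤ T y - T x := by
    intro x y hxy
    have h1 : MonotoneOn (fun x => T x - x / 2) Set.univ := by
      refine monotoneOn_of_deriv_nonneg convex_univ (by fun_prop) ?_ ?_
      · intro x _
        exact ((hTd x).sub ((hasDerivAt_id x).div_const 2)).differentiableAt.differentiableWithinAt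
      · intro x _
        have h2 : HasDerivAt (fun x => T x - x / 2) (f x / 2 - 1 / 2) x :=
          (hTd x).sub ((hasDerivAt_id x).div_const 2)
        rw [h2.deriv]
        have := hf1 x
        linarith
    have h3 := h1 (Set.mem_univ x) (Set.mem_univ y) hxy
    simp only at h3
    linarith
  have htop : Tendsto T atTop atTop := by
    refine tendsto_atTop_mono' atTop (f₁ := fun x => (x - r₀) / 2) ?_ ?_
    · filter_upwards [eventually_ge_atTop r₀] with x hx
      have := hge r₀ x hx
      linarith
    · exact (tendsto_atTop_add_const_right atTop (-r₀) tendsto_id).atTop_div_const two_pos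
  have hbot : Tendsto T atBot atBot := by
    refine tendsto_atBot_mono' (f₂ := T) (f₁ := fun x => (x - r₀) / 2) atBot ?_ ?_
    · filter_upwards [eventually_le_atBot r₀] with x hx
      have := hge x r₀ hx
      linarith
    · exact (tendsto_atBot_add_const_right atBot (-r₀) tendsto_id).atBot_div_const two_pos
  set e := hTmono.orderIsoOfSurjective T (hTc.surjective htop hbot) with he
  have hTe : ∀ s, T (e.symm s) = s := fun s => e.apply_symm_apply s
  have hle : ∀ s, 0 ≤ s → r₀ ≤ e.symm s := fun s hs => by
    rw [← hTmono.le_iff_le, hTe, hTr]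
    exact hs
  have hfeq : ∀ u, r₀ ≤ u → f u = 1 + (r₀ / u) ^ 2 * L (r₀ / u) := fun u hu => by
    simp only [hf, max_eq_left hu]
  refine ⟨e.symm, ?_, hle, e.symm.tendsto_atTop, fun s hs => ?_, fun s hs => ?_⟩
  · rw [← hTmono.injective.eq_iff, hTe, hTr]
  · have h1 := HasDerivAt.of_local_left_inverse (e.symm.continuous.continuousAt (x := s))
      (hTd (e.symm s)) (by have := hf1 (e.symm s); positivity)
      (Filter.Eventually.of_forall hTe)
    refine h1.congr_deriv ?_
    rw [hfeq _ (hle s hs), inv_div]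
    rfl
  · set x := e.symm s with hx
    have hxr := hle s hs
    have hLd : ∀ y, HasDerivAt (fun y => ∫ t in y..1, L t) (-L y) y := fun y =>
      (intervalIntegral.integral_hasDerivAt_left (hL.intervalIntegrable _ _)
        (hL.stronglyMeasurableAtFilter _ _) hL.continuousAt)
    -- An explicit primitive of the speed, found by the substitution t = r₀/u.
    have h1 : ∀ u ∈ Set.uIcc r₀ x, HasDerivAt
        (fun u => u + r₀ * ∫ t in (r₀ / u)..1, L t) (f u) u := by
      intro u hu
      rw [Set.uIcc_of_le hxr] at hu
      have hu0 : u ≠ 0 := (hr₀.trans_le hu.1).ne'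
      have h2 : HasDerivAt (fun u => r₀ / u) (-r₀ / u ^ 2) u := by
        simpa [div_eq_mul_inv] using (hasDerivAt_inv hu0).const_mul r₀
      have h3 := (hasDerivAt_id u).add (((hLd (r₀ / u)).comp u h2).const_mul r₀)
      refine h3.congr_deriv ?_
      rw [hfeq u hu.1]
      field_simp
    have h2 := intervalIntegral.integral_eq_sub_of_hasDerivAt h1 (hfc.intervalIntegrable _ _)
    have h3 : T x = s := hTe s
    simp only [hT, h2] at h3
    rw [div_self hr₀.ne', intervalIntegral.integral_same] at h3
    linarith

end RadialTime

variable {r₀ : ℝ} {θ ϑ : Ang d} {v : ℝ → Fin d → ℝ} {c : Fin d → ℝ}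

/-- The Lagrangian is (speed - 1)/τ², written so as to be regular at τ = 0. -/
theorem speedAt_eq_one_add {r τ : ℝ} (hx : pathAt ϑ v τ ∈ M.U) (hτ : τ ∈ Set.Icc (0 : ℝ) 1)
    (hr : M.RM < r) : 1 + τ ^ 2 * lagrAt M r ϑ v τ = speedAt M r ϑ v τ := by
  have h1 := speedAt_sq (v := v) hx hτ hr
  have h2 := one_le_speedAt (v := v) hx hτ hr
  rw [lagrAt]
  generalize speedAt M r ϑ v τ = S at *
  have h3 : 1 + S ≠ 0 := by linarith
  have h4 : τ ^ 2 * quadAt M r ϑ v τ = S ^ 2 - 1 := by linarith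
  rw [← mul_assoc, h4]
  field_simp
  ring

/-- The covector at time `τ` in terms of the velocity. -/
theorem neg_mul_momAt_eq {τ : ℝ} (hτ : τ ≠ 0) (l : Fin d) :
    -r₀ * momAt M r₀ ϑ v l τ = ∑ m, M.g (r₀ / τ) (pathAt ϑ v τ) l m
      * (-r₀ * (speedAt M r₀ ϑ v τ)⁻¹ * v τ m) := by
  simp only [momAt, coefAt, hτ, if_false, Finset.sum_mul, Finset.mul_sum]
  refine Finset.sum_congr rfl fun m _ => ?_
  ring

/-- The kinetic energy is τ²q/S² with S² = 1 + τ²q, so setting ρ = 1/S puts the ray on the energy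
surface p = 1. -/
theorem kinetic_path {τ : ℝ} (hx : pathAt ϑ v τ ∈ M.U) (hτ0 : 0 < τ) (hτ1 : τ ≤ 1)
    (hr : M.RM < r₀) {H : Ang d} (hH : ∀ l, H l = -r₀ * momAt M r₀ ϑ v l τ) :
    kinetic M (r₀ / τ, pathAt ϑ v τ, H) = 1 - (speedAt M r₀ ϑ v τ)⁻¹ ^ 2 := by
  have hr0 := M.RM_pos.trans hr
  have hrτ : M.RM < r₀ / τ := by
    rw [lt_div_iff₀ hτ0]
    exact (mul_le_of_le_one_right M.RM_pos.le hτ1).trans_lt hr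
  have h1 := speedAt_sq (v := v) hx ⟨hτ0.le, hτ1⟩ hr
  have h2 := one_le_speedAt (v := v) hx ⟨hτ0.le, hτ1⟩ hr
  have h3 := sum_momAt_mul (M := M) (r := r₀) (ϑ := ϑ) (v := v) τ
  rw [kinetic_eq hrτ hx (u := fun m => -r₀ * (speedAt M r₀ ϑ v τ)⁻¹ * v τ m)
    fun l => (hH l).trans (neg_mul_momAt_eq hτ0.ne' l)]
  have h4 : ∑ j, H j * (-r₀ * (speedAt M r₀ ϑ v τ)⁻¹ * v τ j)
      = r₀ ^ 2 * (speedAt M r₀ ϑ v τ)⁻¹ * ∑ j, momAt M r₀ ϑ v j τ * v τ j := by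
    rw [Finset.mul_sum]
    refine Finset.sum_congr rfl fun j _ => ?_
    rw [hH]
    ring
  rw [h4, h3]
  generalize speedAt M r₀ ϑ v τ = S at *
  have h5 : S ≠ 0 := by linarith
  field_simp
  linarith

/-- Geodesic rays scatter to their asymptotic data. -/
theorem IsAsymptoticPath.isScatteringLimit (h : IsAsymptoticPath M r₀ θ ϑ v c)
    (hr : M.RM < r₀) :
    IsScatteringLimit M 1 1
      (r₀, θ, (speedAt M r₀ ϑ v 1)⁻¹, WithLp.toLp 2 fun l => -r₀ * momAt M r₀ ϑ v l 1)
      (r₀ * (1 - ∫ t in (0 : ℝ)..1, lagrAt M r₀ ϑ v t), ϑ, 1, WithLp.toLp 2 fun l => -r₀ * c l) := by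
  have hr0 := M.RM_pos.trans hr
  have hspeed : ContinuousOn (speedAt M r₀ ϑ v) (Set.Icc 0 1) :=
    (continuousOn_const.add ((continuousOn_id.pow 2).mul h.quad_cont)).sqrt
  have hlagr : ContinuousOn (lagrAt M r₀ ϑ v) (Set.Icc 0 1) := by
    refine h.quad_cont.mul ((continuousOn_const.add hspeed).inv₀ fun t ht => ?_)
    have := one_le_speedAt (h.mem t ht) ht hr
    simp only [Pi.add_apply]
    linarith
  -- The Lagrangian and the forces are controlled on [0, 1] only; they are continued by their end
  -- values to have functions continuous on the whole line.
  set L : ℝ → ℝ := Set.IccExtend zero_le_one ((Set.Icc (0 : ℝ) 1).domRestrict (lagrAt M r₀ ϑ v))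
    with hLdef
  have hL : Continuous L := hlagr.domRestrict.Icc_extend'
  have hLeq : Set.EqOn L (lagrAt M r₀ ϑ v) (Set.Icc 0 1) := fun t ht =>
    Set.IccExtend_of_mem _ _ ht
  have hL0 : ∀ t, 0 ≤ L t := fun t => by
    have ht := (Set.projIcc (0 : ℝ) 1 zero_le_one t).2
    have h1 := one_le_speedAt (v := v) (h.mem _ ht) ht hr
    exact mul_nonneg (quadAt_nonneg (h.mem _ ht) ht hr) (inv_nonneg.2 (by linarith))
  set F : Fin d → ℝ → ℝ := fun l =>
    Set.IccExtend zero_le_one ((Set.Icc (0 : ℝ) 1).domRestrict (forceAt M r₀ ϑ v l)) with hFdef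
  have hF : ∀ l, Continuous (F l) := fun l => (h.force_cont l).domRestrict.Icc_extend'
  have hFeq : ∀ l, Set.EqOn (F l) (forceAt M r₀ ϑ v l) (Set.Icc 0 1) := fun l t ht =>
    Set.IccExtend_of_mem _ _ ht
  set P : Fin d → ℝ → ℝ := fun l τ => -r₀ * (c l + ∫ t in (0 : ℝ)..τ, F l t) with hPdef
  have hP : ∀ l τ, HasDerivAt (P l) (-r₀ * F l τ) τ := fun l τ =>
    (((hF l).integral_hasStrictDerivAt 0 τ).hasDerivAt.const_add (c l)).const_mul (-r₀)
  have hPeq : ∀ l, ∀ τ ∈ Set.Icc (0 : ℝ) 1, P l τ = -r₀ * momAt M r₀ ϑ v l τ := fun l τ hτ => by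
    rw [h.eqn l τ hτ, hPdef]
    simp only
    congr 2
    refine intervalIntegral.integral_congr fun t ht => ?_
    rw [Set.uIcc_of_le hτ.1] at ht
    exact hFeq l ⟨ht.1, ht.2.trans hτ.2⟩
  obtain ⟨R, hR0, hRge, hRtop, hRd, hRs⟩ := exists_radius_of_time hL hL0 hr0
  set τ : ℝ → ℝ := fun s => r₀ / R s with hτdef
  have hRpos : ∀ s, 0 ≤ s → 0 < R s := fun s hs => hr0.trans_le (hRge s hs)
  have hτ0 : ∀ s, 0 ≤ s → 0 < τ s := fun s hs => div_pos hr0 (hRpos s hs)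
  have hτ1 : ∀ s, 0 ≤ s → τ s ≤ 1 := fun s hs => (div_le_one (hRpos s hs)).2 (hRge s hs)
  have hτmem : ∀ s, 0 ≤ s → τ s ∈ Set.Icc (0 : ℝ) 1 := fun s hs => ⟨(hτ0 s hs).le, hτ1 s hs⟩
  have hRτ : ∀ s, 0 ≤ s → r₀ / τ s = R s := fun s hs => div_div_cancel₀ hr0.ne'
  have hS : ∀ s, 0 ≤ s → 1 + τ s ^ 2 * L (τ s) = speedAt M r₀ ϑ v (τ s) := fun s hs => by
    rw [hLeq (hτmem s hs)]
    exact speedAt_eq_one_add (h.mem _ (hτmem s hs)) (hτmem s hs) hr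
  set Θ : ℝ → Ang d := fun s => pathAt ϑ v (τ s) with hΘdef
  set H : ℝ → Ang d := fun s => WithLp.toLp 2 fun l => P l (τ s) with hHdef
  have hkin : ∀ s, 0 ≤ s → kinetic M (R s, Θ s, H s) = 1 - (speedAt M r₀ ϑ v (τ s))⁻¹ ^ 2 :=
    fun s hs => by
      rw [← hRτ s hs]
      exact kinetic_path (h.mem _ (hτmem s hs)) (hτ0 s hs) (hτ1 s hs) hr
        fun l => hPeq l _ (hτmem s hs)
  have hSpos : ∀ s, 0 ≤ s → 0 < (speedAt M r₀ ϑ v (τ s))⁻¹ := fun s hs =>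
    inv_pos.2 (one_pos.trans_le (one_le_speedAt (h.mem _ (hτmem s hs)) (hτmem s hs) hr))
  have hρ : ∀ s, 0 ≤ s → √(1 - kinetic M (R s, Θ s, H s)) = (speedAt M r₀ ϑ v (τ s))⁻¹ :=
    fun s hs => by rw [hkin s hs, sub_sub_cancel, Real.sqrt_sq (hSpos s hs).le]
  refine ⟨fun s => (R s, Θ s, √(1 - kinetic M (R s, Θ s, H s)), H s), ⟨?_, fun s hs => ?_⟩, ?_⟩
  · have h1 : τ 0 = 1 := by simp only [hτdef, hR0, div_self hr0.ne']
    simp only [hρ 0 le_rfl]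
    rw [h1, hR0]
    refine Prod.ext rfl (Prod.ext ?_ (Prod.ext rfl ?_))
    · simp only [hΘdef, h1]
      exact h.endpoint
    · simp only [hHdef, h1]
      congr 1
      funext l
      exact hPeq l 1 ⟨zero_le_one, le_rfl⟩
  · rw [one_mul] at hs
    have hmem : Θ s ∈ M.U := h.mem _ (hτmem s hs)
    have hRM : M.RM < R s := hr.trans_le (hRge s hs)
    refine ⟨⟨?_, hmem⟩, ?_⟩
    · simpa using hRM
    have hu : ∀ l, H s l = ∑ m, M.g (R s) (Θ s) l m
        * (-r₀ * (speedAt M r₀ ϑ v (τ s))⁻¹ * v (τ s) m) := fun l => by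
      rw [← hRτ s hs]
      exact (hPeq l _ (hτmem s hs)).trans (neg_mul_momAt_eq (hτ0 s hs).ne' l)
    have hRd' : HasDerivAt R (2 * (speedAt M r₀ ϑ v (τ s))⁻¹) s := by
      rw [← hS s hs]
      exact hRd s hs
    have hτd : HasDerivAt τ (-r₀ / R s ^ 2 * (2 * (speedAt M r₀ ϑ v (τ s))⁻¹)) s := by
      have h2 : HasDerivAt (fun u => r₀ / u) (-r₀ / R s ^ 2) (R s) := by
        simpa [div_eq_mul_inv] using (hasDerivAt_inv (hRpos s hs).ne').const_mul r₀
      exact h2.comp s hRd'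
    have hΘs : Θ s = pathAt ϑ v (τ s) := rfl
    have hRne := (hRpos s hs).ne'
    -- It is enough to verify the equations for radius, angle and angular momentum; the one for ρ
    -- follows from conservation of energy.
    refine (hasDerivAt_of_energy hRM hmem ?_ ?_ ?_ ?_).hasDerivWithinAt
    · rw [hkin s hs]
      have := pow_pos (hSpos s hs) 2
      linarith
    · rw [hρ s hs]
      exact hRd'
    · have h2 := (hasDerivAt_pathAt h.cont ϑ (τ s)).scomp s hτd
      refine h2.congr_deriv ?_
      ext a
      simp only [fderiv_kinetic_momentum hRM hmem hu, unitVec, PiLp.smul_apply, smul_eq_mul]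
      simp
      field_simp
    · have h2 : HasDerivAt H (WithLp.toLp 2 fun l => -r₀ * F l (τ s)
          * (-r₀ / R s ^ 2 * (2 * (speedAt M r₀ ϑ v (τ s))⁻¹))) s :=
        hasDerivAt_toLp fun l => (hP l (τ s)).comp s hτd
      refine h2.congr_deriv ?_
      ext a
      simp only [fderiv_kinetic_angle hRM hmem hu, hFeq a (hτmem s hs), forceAt, dcoefAt,
        (hτ0 s hs).ne', if_false, hRτ s hs, ← hΘs]
      have h3 : ∑ l, ∑ m, fderiv ℝ (fun y : Base d => M.g y.1 y.2 l m) (R s, Θ s) (0, unitVec a)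
          * (-r₀ * (speedAt M r₀ ϑ v (τ s))⁻¹ * v (τ s) m)
          * (-r₀ * (speedAt M r₀ ϑ v (τ s))⁻¹ * v (τ s) l)
          = r₀ ^ 2 * (speedAt M r₀ ϑ v (τ s))⁻¹ ^ 2 * ∑ l, ∑ m,
            fderiv ℝ (fun y : Base d => M.g y.1 y.2 l m) (R s, Θ s) (0, unitVec a)
              * v (τ s) m * v (τ s) l := by
        simp only [Finset.mul_sum]
        refine Finset.sum_congr rfl fun l _ => Finset.sum_congr rfl fun m _ => ?_
        ring
      rw [h3]
      ring
  · set sl : ℝ → ℝ := fun t => (1 + t ^ 2 * L t)⁻¹ with hsl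
    have hne : ∀ t, 1 + t ^ 2 * L t ≠ 0 := fun t => by
      have := mul_nonneg (sq_nonneg t) (hL0 t)
      linarith
    have hsc : Continuous sl := by
      refine Continuous.inv₀ ?_ hne
      fun_prop
    -- `G` is the point carried back by the free flow, as a function of τ. Eliminating R and s turns
    -- R - 2sρ into an expression continuous at τ = 0, so the limit s → ∞ is the value `G 0`.
    set G : ℝ → Phase d := fun t => (r₀ * t * L t * sl t + sl t * (r₀ - r₀ * ∫ u in t..1, L u),
      pathAt ϑ v t, sl t, WithLp.toLp 2 fun l => P l t) with hG
    have hGc : ContinuousAt G 0 := by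
      have h1 : ContinuousAt (fun t => ∫ u in t..1, L u) 0 :=
        (intervalIntegral.integral_hasDerivAt_left (hL.intervalIntegrable _ _)
        (hL.stronglyMeasurableAtFilter _ _) hL.continuousAt).continuousAt
      refine ContinuousAt.prodMk ?_ ((hasDerivAt_pathAt h.cont ϑ 0).continuousAt.prodMk
        (hsc.continuousAt.prodMk (hasDerivAt_toLp fun l => hP l 0).continuousAt))
      exact (((continuousAt_const.mul continuousAt_id).mul hL.continuousAt).mul
        hsc.continuousAt).add (hsc.continuousAt.mul (continuousAt_const.sub
          (continuousAt_const.mul h1)))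
    have hG0 : G 0 = (r₀ * (1 - ∫ t in (0 : ℝ)..1, lagrAt M r₀ ϑ v t), ϑ, 1,
        WithLp.toLp 2 fun l => -r₀ * c l) := by
      have h1 : ∫ t in (0 : ℝ)..1, L t = ∫ t in (0 : ℝ)..1, lagrAt M r₀ ϑ v t := by
        refine intervalIntegral.integral_congr fun t ht => ?_
        rw [Set.uIcc_of_le zero_le_one] at ht
        exact hLeq ht
      simp [hG, hsl, hPdef, pathAt_zero, h1, mul_sub]
    have hτt : Tendsto τ atTop (𝓝 0) := hRtop.const_div_atTop r₀
    rw [← hG0]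
    refine (hGc.tendsto.comp hτt).congr' ?_
    filter_upwards [eventually_ge_atTop 0] with s hs
    simp only [Function.comp_apply, one_mul, freeFlow, hG]
    rw [hρ s hs, ← hS s hs]
    refine Prod.ext ?_ rfl
    simp only
    have h2 := hRs s hs
    have h3 : (R s - r₀ + r₀ * ∫ t in (r₀ / R s)..1, L t)
        = R s - r₀ + r₀ * ∫ t in (τ s)..1, L t := rfl
    rw [h3] at h2
    have h4 : R s + 2 * -s * (1 + τ s ^ 2 * L (τ s))⁻¹
        = R s - (2 * s) * sl (τ s) := by simp only [hsl]; ring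
    rw [h4, h2]
    have h5 : R s * τ s = r₀ := by
      simp only [hτdef]
      exact mul_div_cancel₀ _ (hRpos s hs).ne'
    have h6 : sl (τ s) * (1 + τ s ^ 2 * L (τ s)) = 1 := inv_mul_cancel₀ (hne _)
    generalize sl (τ s) = o at *
    generalize (∫ t in (τ s)..1, L t) = I at *
    -- The divergent parts cancel: R(1 - ρ) = Rρτ²L = r₀τLρ, because Rτ = r₀.
    have h7 : R s = R s * (o * (1 + τ s ^ 2 * L (τ s))) := by rw [h6, mul_one]
    have h8 : R s - R s * o = r₀ * τ s * L (τ s) * o := by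
      rw [← h5]
      linear_combination h7
    linear_combination -h8

end ConicScattering

/-! ### Reduction to ε = 1 and energy one by scaling. -/

namespace ConicScattering

variable {d : ℕ} {M : ConicChart d}

section Scaling

/-- Simultaneous rescaling of the radius and of the momenta. -/
def scalePhase (ε β : ℝ) : Phase d →L[ℝ] Phase d :=
  (ε • ContinuousLinearMap.fst ℝ ℝ (Ang d × ℝ × Ang d)).prod
    (((ContinuousLinearMap.fst ℝ (Ang d) (ℝ × Ang d)).prod
      ((β • ContinuousLinearMap.fst ℝ ℝ (Ang d) ∘L ContinuousLinearMap.snd ℝ (Ang d) (ℝ × Ang d)).prod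
        ((ε * β) • ContinuousLinearMap.snd ℝ ℝ (Ang d) ∘L
          ContinuousLinearMap.snd ℝ (Ang d) (ℝ × Ang d)))) ∘L
      ContinuousLinearMap.snd ℝ ℝ (Ang d × ℝ × Ang d))

theorem scalePhase_apply (ε β : ℝ) (z : Phase d) :
    scalePhase ε β z = (ε * z.1, z.2.1, β * z.2.2.1, (ε * β) • z.2.2.2) := rfl

theorem symbolP_scalePhase {ε : ℝ} (hε : ε ≠ 0) (β : ℝ) (z : Phase d) :
    symbolP M ε (scalePhase ε β z) = β ^ 2 * symbolP M 1 z := by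
  simp only [symbolP, scalePhase_apply, mul_div_cancel_left₀ _ hε, div_one, PiLp.smul_apply,
    smul_eq_mul]
  have h : ∀ j k, (M.g z.1 z.2.1)⁻¹ j k * (ε * β * z.2.2.2 j) * (ε * β * z.2.2.2 k)
      = (ε * β) ^ 2 * ((M.g z.1 z.2.1)⁻¹ j k * z.2.2.2 j * z.2.2.2 k) := fun j k => by ring
  simp only [h, ← Finset.mul_sum]
  field_simp

theorem gradient_const_mul_comp_smul (a c : ℝ) (f : Ang d → ℝ) (x : Ang d) :
    gradient (fun y => a * f (c • y)) x = (a * c) • gradient f (c • x) := by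
  ext l
  rw [PiLp.smul_apply, gradient_apply, gradient_apply]
  have h1 : fderiv ℝ (fun y => a * f (c • y)) x = a • fderiv ℝ (fun y => f (c • y)) x :=
    congrFun (fderiv_const_smul_field (f := fun y : Ang d => f (c • y)) a) x
  rw [h1, fderiv_comp_smul]
  simp [mul_assoc]

theorem deriv_const_mul_comp_mul (a c : ℝ) (f : ℝ → ℝ) (x : ℝ) :
    deriv (fun y => a * f (c * y)) x = a * c * deriv f (c * x) := by
  rw [deriv_const_mul_field, deriv_comp_mul_left, smul_eq_mul, mul_assoc]

/-- Homogeneity of the symbol makes the rescaling conjugate the two flows up to the constant time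
factor β/ε. -/
theorem hamField_scalePhase {ε β : ℝ} (hε : ε ≠ 0) (hβ : β ≠ 0) (z : Phase d) :
    hamField (symbolP M ε) (scalePhase ε β z)
      = (β / ε) • scalePhase ε β (hamField (symbolP M 1) z) := by
  have key : ∀ r θ ρ η, symbolP M ε (r, θ, ρ, η)
      = β ^ 2 * symbolP M 1 (ε⁻¹ * r, θ, β⁻¹ * ρ, (ε * β)⁻¹ • η) := fun r θ ρ η => by
    rw [← symbolP_scalePhase hε, scalePhase_apply]
    simp only [mul_inv_cancel_left₀ hε, mul_inv_cancel_left₀ hβ,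
      smul_inv_smul₀ (mul_ne_zero hε hβ)]
  simp only [hamField, scalePhase_apply, Prod.smul_mk, key]
  have e1 : ε⁻¹ * (ε * z.1) = z.1 := inv_mul_cancel_left₀ hε _
  have e2 : β⁻¹ * (β * z.2.2.1) = z.2.2.1 := inv_mul_cancel_left₀ hβ _
  have e3 : (ε * β)⁻¹ • (ε * β) • z.2.2.2 = z.2.2.2 := inv_smul_smul₀ (mul_ne_zero hε hβ) _
  refine Prod.ext ?_ (Prod.ext ?_ (Prod.ext ?_ ?_))
  · simp only [e1, e3]
    rw [deriv_const_mul_comp_mul (β ^ 2) β⁻¹ (fun ρ => symbolP M 1 (z.1, z.2.1, ρ, z.2.2.2)), e2]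
    simp only [smul_eq_mul]
    field_simp
  · simp only [e1, e2]
    rw [gradient_const_mul_comp_smul (β ^ 2) (ε * β)⁻¹
      (fun η => symbolP M 1 (z.1, z.2.1, z.2.2.1, η)), e3]
    congr 1
    field_simp
  · simp only [e2, e3]
    rw [deriv_const_mul_comp_mul (β ^ 2) ε⁻¹
      (fun r => symbolP M 1 (r, z.2.1, z.2.2.1, z.2.2.2)), e1]
    simp only [smul_eq_mul]
    field_simp
  · simp only [e1, e2, e3]
    have h := gradient_const_mul_comp_smul (β ^ 2) 1
      (fun θ => symbolP M 1 (z.1, θ, z.2.2.1, z.2.2.2)) z.2.1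
    simp only [one_smul, mul_one] at h
    rw [h, smul_smul, smul_neg]
    congr 2
    field_simp

/-- A negative β reverses momenta and time together, so incoming rays are outgoing rays run
backwards and need no separate argument. -/
theorem IsScatteringLimit.scale {ε β σ : ℝ} {z w : Phase d} (h : IsScatteringLimit M 1 1 z w)
    (hε : 0 < ε) (hσ : σ = 1 ∨ σ = -1) (hβ : 0 < σ * β) :
    IsScatteringLimit M ε σ (scalePhase ε β z) (scalePhase ε β w) := by
  obtain ⟨γ, ⟨h0, hγ⟩, hlim⟩ := h
  have hβ0 : β ≠ 0 := fun h => by simp [h] at hβ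
  have hσσ : σ * σ = 1 := by rcases hσ with rfl | rfl <;> norm_num
  have htime : ∀ s, 0 ≤ σ * s → 0 ≤ 1 * (β / ε * s) := fun s hs => by
    have h1 : β * s = (σ * β) * (σ * s) := by linear_combination (-β * s) * hσσ
    have h2 : 1 * (β / ε * s) = (σ * β) * (σ * s) / ε := by rw [← h1]; ring
    rw [h2]
    positivity
  refine ⟨fun s => scalePhase ε β (γ (β / ε * s)), ⟨by simp [h0], fun s hs => ?_⟩, ?_⟩
  · obtain ⟨hmem, hd⟩ := hγ _ (htime s hs)
    refine ⟨⟨?_, hmem.2⟩, ?_⟩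
    · have := hmem.1
      rw [one_mul] at this
      exact mul_lt_mul_of_pos_left this hε
    · rw [hamField_scalePhase hε.ne' hβ0, ← map_smul]
      have h1 : HasDerivAt (fun s : ℝ => β / ε * s) (β / ε) s := by
        simpa using (hasDerivAt_id s).const_mul (β / ε)
      exact (scalePhase ε β).hasFDerivAt.comp_hasDerivWithinAt s
        (hd.scomp s h1.hasDerivWithinAt fun t ht => htime t ht)
  · have h1 : Tendsto (fun t : ℝ => σ * β / ε * t) atTop atTop :=
      tendsto_id.const_mul_atTop (by positivity)
    have h2 := ((scalePhase ε β).continuous.tendsto w).comp (hlim.comp h1)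
    refine h2.congr fun t => ?_
    have h3 : β / ε * (σ * t) = 1 * (σ * β / ε * t) := by ring
    simp only [Function.comp_apply, h3, freeFlow, scalePhase_apply]
    refine Prod.ext ?_ rfl
    simp only
    field_simp

end Scaling

end ConicScattering

/-! ### Strongly outgoing and incoming points lie on rays. -/

namespace ConicScattering

open BoundedContinuousFunction

variable {d : ℕ} {M : ConicChart d} {K V : Set (Ang d)} {b ρ η : ℝ} {w : Par d → Vel M K}

theorem norm_ang_le_sum (x : Ang d) : ‖x‖ ≤ ∑ a, |x a| := by
  have h : x = ∑ a, x a • unitVec a := by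
    ext b
    simp [unitVec, Finset.sum_apply, Pi.single_apply]
  conv_lhs => rw [h]
  refine (norm_sum_le _ _).trans (Finset.sum_le_sum fun a _ => ?_)
  rw [norm_smul, unitVec, PiLp.norm_single, norm_one, mul_one, Real.norm_eq_abs]

/-- The parameters of the problems with fixed end point and variable asymptotic angle. -/
def angleParam (μ : ℝ) (k : Ang d) : Par d := (μ, 0, 0, k)

theorem angleParam_mem {μ β : ℝ} {k : Ang d} (hμ : |μ| < β) (hk : ‖k‖ < β) :
    angleParam μ k ∈ Metric.ball (0 : Par d) β := by
  have hβ : 0 < β := (abs_nonneg _).trans_lt hμ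
  rw [mem_ball_zero_iff]
  refine max_lt hμ (max_lt ?_ (max_lt ?_ hk)) <;> simpa [angleParam] using hβ

namespace SolutionFamily

/-- Small momenta at the end point are realized by a unique choice of asymptotic angle. -/
theorem exists_endMom_eq (S : SolutionFamily M K b ρ η w) (hK : IsCompact K) (hKU : K ⊆ M.U)
    (hVK : V ⊆ K) : ∃ κ > 0, ∀ r θ, 2 * M.RM < r → r ^ (-M.ν) < κ → θ ∈ V →
      ∀ m : Fin d → ℝ, (∀ l, |m l| ≤ κ) →
      ∃ ϑ, (r, θ, ϑ) ∈ paramDomain M V η ∧ ∀ l, famVal 0 (endMom w l) (r, θ, ϑ) = m l := by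
  choose c hc using exists_gbar_inv (M := M) (K := K) hK hKU
  -- The end momentum is multiplied by -ḡ⁻¹ so that its derivative in k at the origin is the
  -- identity, for every base point at once.
  set F : Par d → Vel M K := fun p a => -∑ l, c a l * endMom w l p with hF
  have h0 : (0 : Par d) ∈ Metric.ball 0 η := Metric.mem_ball_self S.pos
  have hFs : ContDiffOn ℝ ∞ F (Metric.ball 0 η) := contDiffOn_pi.2 fun a =>
    (ContDiffOn.sum fun l _ => contDiffOn_const.mul (S.contDiffOn_endMom l)).neg
  have hFa : ContDiffAt ℝ ∞ F 0 := hFs.contDiffAt (Metric.isOpen_ball.mem_nhds h0)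
  have hFd : HasStrictFDerivAt F (fderiv ℝ F 0) 0 := hFa.hasStrictFDerivAt (by simp)
  have hdet : ∀ j : PathIdx M K, IsUnit (M.gbar j.1.1.2).det := fun j =>
    (M.gbar_posDef _ (hKU j.1.2.2)).det_pos.ne'.isUnit
  have hF' : ∀ (k : Ang d) a j, fderiv ℝ F 0 ((0, 0, 0, k) : Par d) a j = k a := by
    intro k a j
    have h1 : HasFDerivAt (fun p => -∑ l, c a l * endMom w l p) (-∑ l,
        (ContinuousLinearMap.mul ℝ (Alg M K) (c a l)).comp (fderiv ℝ (endMom w l) 0)) 0 := by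
      refine (HasFDerivAt.fun_sum fun l _ => ?_).neg
      exact (ContinuousLinearMap.mul ℝ (Alg M K) (c a l)).hasFDerivAt.comp (0 : Par d)
        (((S.contDiffOn_endMom l).contDiffAt
          (Metric.isOpen_ball.mem_nhds h0)).differentiableAt (by simp)).hasFDerivAt
    have h2 := (hasFDerivAt_pi'.1 hFd.hasFDerivAt a).unique h1
    have h3 := congrArg (fun T : Par d →L[ℝ] Alg M K => T ((0, 0, 0, k) : Par d) j) h2
    simp only [ContinuousLinearMap.comp_apply, ContinuousLinearMap.proj_apply] at h3
    rw [h3]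
    simp only [_root_.neg_apply, _root_.sum_apply, ContinuousLinearMap.comp_apply,
      ContinuousLinearMap.mul_apply', BoundedContinuousFunction.neg_apply,
      BoundedContinuousFunction.sum_apply, BoundedContinuousFunction.mul_apply,
      S.fderiv_endMom h0 rfl, S.fderiv_infMom h0 rfl rfl, hc]
    have h4 : ((M.gbar j.1.1.2)⁻¹ * M.gbar j.1.1.2).mulVec (fun m => k m) a = k a := by
      rw [Matrix.nonsing_inv_mul _ (hdet j), Matrix.one_mulVec]
    rw [← Matrix.mulVec_mulVec] at h4
    simp only [Matrix.mulVec, dotProduct] at h4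
    rw [← h4, ← Finset.sum_neg_distrib]
    refine Finset.sum_congr rfl fun l _ => ?_
    rw [← mul_neg, ← Finset.sum_neg_distrib]
    congr 1
    refine Finset.sum_congr rfl fun m _ => ?_
    simp
  -- This precision is needed in each coordinate: summed over d coordinates the error is at most
  -- 1/2, which leaves the identity with a margin of 1/2.
  have hc0 : (0 : NNReal) < 1 / (2 * (d + 1)) := by positivity
  obtain ⟨s, hs, happ⟩ := hFd.approximates_deriv_on_nhds (Or.inr hc0)
  obtain ⟨β', hβ', hball'⟩ := Metric.mem_nhds_iff.1 hs
  set β := min β' η with hβdef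
  have hβ : 0 < β := lt_min hβ' S.pos
  have hball : Metric.ball (0 : Par d) β ⊆ s :=
    (Metric.ball_subset_ball (min_le_left _ _)).trans hball'
  set C : ℝ := 1 + ∑ a, ∑ l, ‖c a l‖ with hC
  have hCpos : 0 < C := by positivity
  refine ⟨min β (β / (4 * C)), lt_min hβ (by positivity), fun r θ hr hrν hθ m hm => ?_⟩
  have hrpos : 0 < r := by
    have := M.RM_pos
    linarith
  set μ := r ^ (-M.ν) with hμ
  have hμabs : |μ| < β := by
    rw [abs_of_pos (Real.rpow_pos_of_pos hrpos _)]
    exact hrν.trans_le (min_le_left _ _)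
  set i : Idx M K := ⟨(r, θ), hr, hVK hθ⟩ with hi
  set f : Ang d → Ang d := fun k => WithLp.toLp 2 fun a => F (angleParam μ k) a (i, 1) with hf
  have hfapp : ApproximatesLinearOn f (ContinuousLinearMap.id ℝ (Ang d))
      (Metric.closedBall 0 (β / 2)) (1 / 2) := by
    intro k hk k' hk'
    rw [mem_closedBall_zero_iff] at hk hk'
    have h1 := happ _ (hball (angleParam_mem hμabs (hk.trans_lt (half_lt_self hβ)))) _
      (hball (angleParam_mem hμabs (hk'.trans_lt (half_lt_self hβ))))
    have hsub : angleParam μ k - angleParam μ k' = ((0, 0, 0, k - k') : Par d) := by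
      simp [angleParam]
    have hn : ‖((0, 0, 0, k - k') : Par d)‖ = ‖k - k'‖ := by simp [Prod.norm_def]
    rw [hsub, hn] at h1
    have h2 : ∀ a, |(f k - f k' - (k - k')) a|
        ≤ ((1 / (2 * (d + 1)) : NNReal) : ℝ) * ‖k - k'‖ := fun a => by
      refine le_trans ?_ h1
      refine le_trans ?_ (norm_le_pi_norm _ a)
      refine le_trans ?_ (BoundedContinuousFunction.norm_coe_le_norm _ (i, 1))
      simp only [Pi.sub_apply, BoundedContinuousFunction.sub_apply, hF', Real.norm_eq_abs]
      simp [hf]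
    refine (norm_ang_le_sum _).trans ((Finset.sum_le_sum fun a _ => h2 a).trans ?_)
    rw [Finset.sum_const, Finset.card_univ, Fintype.card_fin, nsmul_eq_mul, ← mul_assoc]
    refine mul_le_mul_of_nonneg_right ?_ (norm_nonneg _)
    push_cast
    rw [mul_one_div, div_le_div_iff₀ (by positivity) (by positivity)]
    linarith
  have hf0 : f 0 = 0 := by
    ext a
    have h1 : angleParam μ 0 ∈ Metric.ball (0 : Par d) η :=
      Metric.ball_subset_ball (min_le_right _ _) (angleParam_mem hμabs (by rwa [norm_zero]))
    simp [hf, hF, S.endMom_diag h1 rfl]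
  -- The quantitative inverse function theorem covers the ball of radius (1 - 1/2) · β/2 = β/4; the
  -- threshold β/(4C) on the momenta places the target `t` inside it.
  have hsurj := hfapp.surjOn_closedBall_of_nonlinearRightInverse (ε := β / 2) (b := 0)
    { toFun := id, nnnorm := 1, bound' := by simp, right_inv' := fun _ => rfl }
    (by positivity) subset_rfl
  rw [hf0] at hsurj
  set t : Ang d := WithLp.toLp 2 fun a => -∑ l, c a l (i, 1) * m l with ht
  have htm : t ∈ Metric.closedBall (0 : Ang d)
      ((((1 : NNReal) : ℝ)⁻¹ - ((1 / 2 : NNReal) : ℝ)) * (β / 2)) := by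
    rw [mem_closedBall_zero_iff]
    refine (norm_ang_le_sum _).trans ?_
    have h1 : ∀ a, |t a| ≤ ∑ l, ‖c a l‖ * (β / (4 * C)) := fun a => by
      simp only [ht, abs_neg]
      refine (Finset.abs_sum_le_sum_abs _ _).trans (Finset.sum_le_sum fun l _ => ?_)
      rw [abs_mul]
      exact mul_le_mul ((c a l).norm_coe_le_norm _) ((hm l).trans (min_le_right _ _))
        (abs_nonneg _) (norm_nonneg _)
    refine (Finset.sum_le_sum fun a _ => h1 a).trans ?_
    simp only [← Finset.sum_mul]
    have h2 : (∑ a, ∑ l, ‖c a l‖) * (β / (4 * C)) ≤ C * (β / (4 * C)) :=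
      mul_le_mul_of_nonneg_right (by rw [hC]; linarith) (by positivity)
    have h3 : C * (β / (4 * C)) = β / 4 := by field_simp
    push_cast
    linarith
  obtain ⟨k, hk, hkt⟩ := hsurj htm
  rw [mem_closedBall_zero_iff] at hk
  have hkβ : ‖k‖ < β := hk.trans_lt (half_lt_self hβ)
  have hdom : (r, θ, θ + k) ∈ paramDomain M V η :=
    ⟨hr, (hrν.trans_le (min_le_left _ _)).trans_le (min_le_right _ _), hθ,
      by simpa using hkβ.trans_le (min_le_right _ _)⟩
  refine ⟨θ + k, hdom, fun l => ?_⟩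
  have hval : ∀ l, famVal 0 (endMom w l) (r, θ, θ + k) = endMom w l (angleParam μ k) (i, 1) :=
    fun l => by
      rw [famVal_of_mem hVK _ _ hdom, pow_zero, one_mul]
      simp [basePar, angleParam, baseIdx, hi, hμ]
  rw [hval]
  have h1 : ∀ a, ∑ l, (M.gbar θ)⁻¹ a l * endMom w l (angleParam μ k) (i, 1)
      = ∑ l, (M.gbar θ)⁻¹ a l * m l := fun a => by
    have h2 := congrArg (fun x : Ang d => x a) hkt
    simp only [hf, hF, ht, BoundedContinuousFunction.neg_apply,
      BoundedContinuousFunction.sum_apply, BoundedContinuousFunction.mul_apply, hc,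
      neg_inj] at h2
    exact h2
  have h3 : (M.gbar θ)⁻¹.mulVec (fun l => endMom w l (angleParam μ k) (i, 1))
      = (M.gbar θ)⁻¹.mulVec m := funext h1
  have h4 := congrArg (M.gbar θ).mulVec h3
  rw [Matrix.mulVec_mulVec, Matrix.mulVec_mulVec, Matrix.mul_nonsing_inv _ (hdet (i, 1)),
    Matrix.one_mulVec, Matrix.one_mulVec] at h4
  exact congrFun h4 l

end SolutionFamily

/-- Upper bound on the metric over a compact set of angles. -/
theorem exists_metric_bound (hK : IsCompact K) (hKU : K ⊆ M.U) (R : ℝ) (hR : M.RM < R) :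
    ∃ C > 0, ∀ r θ, R < r → θ ∈ K → ∀ m : Fin d → ℝ,
      ∑ l, ∑ n, M.g r θ l n * m n * m l ≤ C * ∑ l, m l ^ 2 := by
  have hR0 := M.RM_pos.trans hR
  have h1 : ∀ l n, ∃ C, ∀ r θ, R < r → θ ∈ K → |M.g r θ l n| ≤ C := fun l n => by
    obtain ⟨C₁, hC₁⟩ := M.decay K hK hKU l n 0 []
    obtain ⟨C₂, hC₂⟩ := hK.bddAbove_image ((M.gbar_smooth l n).continuousOn.mono hKU).norm
    refine ⟨|C₁| * R ^ (-M.ν) + C₂, fun r θ hr hθ => ?_⟩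
    have h2 := hC₁ r (hR.trans hr) θ hθ
    have h3 : |M.gbar θ l n| ≤ C₂ := hC₂ ⟨θ, hθ, rfl⟩
    simp only [basePartial, List.replicate_zero, List.map_nil, List.append_nil, iterPartial_nil,
      Nat.cast_zero, sub_zero] at h2
    have h4 : C₁ * r ^ (-M.ν) ≤ |C₁| * R ^ (-M.ν) :=
      mul_le_mul (le_abs_self _) (Real.rpow_le_rpow_of_nonpos hR0 hr.le (by
        have := M.ν_pos
        linarith)) (Real.rpow_nonneg (hR0.trans hr).le _) (abs_nonneg _)
    have h5 : M.g r θ l n = (M.g r θ l n - M.gbar θ l n) + M.gbar θ l n := by ring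
    rw [h5]
    exact (abs_add_le _ _).trans (add_le_add (h2.trans h4) h3)
  choose C hC using h1
  refine ⟨1 + ∑ l, ∑ n, |C l n|, by positivity, fun r θ hr hθ m => ?_⟩
  have hsq : ∀ l, m l ^ 2 ≤ ∑ l, m l ^ 2 := fun l =>
    Finset.single_le_sum (f := fun l => m l ^ 2) (fun l _ => sq_nonneg _) (Finset.mem_univ l)
  have h2 : ∀ l n, M.g r θ l n * m n * m l ≤ |C l n| * ∑ l, m l ^ 2 := fun l n => by
    have h3 : |m n * m l| ≤ ∑ l, m l ^ 2 := by
      rw [abs_mul]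
      have := hsq l
      have := hsq n
      nlinarith [sq_abs (m l), sq_abs (m n), sq_nonneg (|m l| - |m n|)]
    rw [mul_assoc]
    refine (le_abs_self _).trans ?_
    rw [abs_mul]
    exact mul_le_mul ((hC l n r θ hr hθ).trans (le_abs_self _)) h3 (abs_nonneg _) (abs_nonneg _)
  refine (Finset.sum_le_sum fun l _ => Finset.sum_le_sum fun n _ => h2 l n).trans ?_
  simp only [← Finset.sum_mul]
  refine mul_le_mul_of_nonneg_right (by linarith) (Finset.sum_nonneg fun l _ => sq_nonneg _)

/-- The momentum is controlled by the kinetic energy. -/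
theorem sum_sq_le_kinetic {C r : ℝ} {θ H : Ang d} (hr : M.RM < r) (hθ : θ ∈ M.U)
    (hC : 0 < C)
    (hb : ∀ m : Fin d → ℝ, ∑ l, ∑ n, M.g r θ l n * m n * m l ≤ C * ∑ l, m l ^ 2) :
    ∑ l, (H l / r) ^ 2 ≤ C * kinetic M (r, θ, H) := by
  have hr0 := M.RM_pos.trans hr
  set u : Fin d → ℝ := (M.g r θ)⁻¹.mulVec fun l => H l with hu
  have hdet : IsUnit (M.g r θ).det := (M.g_posDef r hr θ hθ).det_pos.ne'.isUnit
  have hgu : ∀ l, H l = ∑ m, M.g r θ l m * u m := fun l => by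
    have h1 : (M.g r θ).mulVec u = fun l => H l := by
      rw [hu, Matrix.mulVec_mulVec, Matrix.mul_nonsing_inv _ hdet, Matrix.one_mulVec]
    exact (congrFun h1 l).symm
  rw [kinetic_eq hr hθ hgu]
  -- An upper bound g ≤ C gives |H|² ≤ C ⟨H, g⁻¹H⟩. It is obtained by testing positivity of g on H -
  -- C u with u = g⁻¹H, where g(H, H) ≤ C|H|² absorbs half of the cross term.
  have hpos := (M.g_posDef r hr θ hθ).posSemidef.dotProduct_mulVec_nonneg (fun l => H l - C * u l)
  simp only [dotProduct, Matrix.mulVec, Pi.star_apply, star_trivial] at hpos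
  have hexp : ∑ l, (H l - C * u l) * ∑ m, M.g r θ l m * (H m - C * u m)
      = (∑ l, ∑ m, M.g r θ l m * H m * H l) - 2 * C * ∑ l, H l ^ 2
        + C ^ 2 * ∑ l, H l * u l := by
    have e1 : ∀ l, ∑ m, M.g r θ l m * (H m - C * u m)
        = (∑ m, M.g r θ l m * H m) - C * H l := fun l => by
      rw [hgu l, Finset.mul_sum, ← Finset.sum_sub_distrib]
      exact Finset.sum_congr rfl fun m _ => by ring
    have e2 : ∑ l, u l * ∑ m, M.g r θ l m * H m = ∑ l, H l ^ 2 := by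
      simp only [Finset.mul_sum]
      rw [Finset.sum_comm]
      refine Finset.sum_congr rfl fun m _ => ?_
      rw [sq]
      nth_rewrite 3 [hgu m]
      rw [Finset.mul_sum]
      refine Finset.sum_congr rfl fun l _ => ?_
      rw [g_symm hr hθ]
      ring
    have e3 : ∑ l, H l * ∑ m, M.g r θ l m * H m = ∑ l, ∑ m, M.g r θ l m * H m * H l := by
      refine Finset.sum_congr rfl fun l _ => ?_
      rw [Finset.mul_sum]
      exact Finset.sum_congr rfl fun m _ => by ring
    have e4 : ∀ G : Fin d → ℝ, ∑ l, (H l - C * u l) * (G l - C * H l)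
        = (∑ l, H l * G l) - C * (∑ l, u l * G l) - C * (∑ l, H l ^ 2)
          + C ^ 2 * ∑ l, H l * u l := fun G => by
      have e5 : ∀ l, (H l - C * u l) * (G l - C * H l)
          = H l * G l - C * (u l * G l) - C * H l ^ 2 + C ^ 2 * (H l * u l) := fun l => by ring
      simp only [e5, Finset.sum_add_distrib, Finset.sum_sub_distrib, ← Finset.mul_sum]
    simp only [e1]
    rw [e4, e2, e3]
    ring
  rw [hexp] at hpos
  have hbH := hb fun l => H l
  have h2 : ∑ l, H l ^ 2 ≤ C * ∑ l, H l * u l := by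
    have h3 : 0 ≤ C * (C * (∑ l, H l * u l) - ∑ l, H l ^ 2) := by nlinarith
    have := nonneg_of_mul_nonneg_right h3 hC
    linarith
  have h3 : ∑ l, (H l / r) ^ 2 = (r ^ 2)⁻¹ * ∑ l, H l ^ 2 := by
    rw [Finset.mul_sum]
    exact Finset.sum_congr rfl fun l _ => by rw [div_pow]; ring
  rw [h3]
  have h4 := mul_le_mul_of_nonneg_left h2 (inv_nonneg.2 (sq_nonneg r))
  linarith

end ConicScattering

/-! ### The rescaled generating function and its derivatives. -/

namespace ConicScattering

variable {d : ℕ} {M : ConicChart d} {K V : Set (Ang d)} {b ρ η : ℝ} {w : Par d → Vel M K}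

theorem gradient_const_mul (a : ℝ) (f : Ang d → ℝ) (x : Ang d) :
    gradient (fun y => a * f y) x = a • gradient f x := by
  simpa using gradient_const_mul_comp_smul a 1 f x

namespace SolutionFamily

theorem two_mul_RM_gt {x : Triple d} (hx : x ∈ paramDomain M V η) : M.RM < x.1 := by
  have := hx.1
  have := M.RM_pos
  linarith

/-- The starting point of the ray with data `x`. -/
def startPoint (w : Par d → Vel M K) (x : Triple d) : Phase d :=
  (x.1, x.2.1, famVal 0 (endInvSpeed w) x,
    WithLp.toLp 2 fun l => -x.1 * famVal 0 (endMom w l) x)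

/-- The scattering data of the ray with data `x`. -/
def limitPoint (w : Par d → Vel M K) (x : Triple d) : Phase d :=
  (psi w x, x.2.2, 1, WithLp.toLp 2 fun l => -x.1 * famVal 0 (infMom w l) x)

theorem isScatteringLimit_startPoint (S : SolutionFamily M K b ρ η w) (hVK : V ⊆ K)
    {x : Triple d} (hx : x ∈ paramDomain M V η) :
    IsScatteringLimit M 1 1 (startPoint w x) (limitPoint w x) := by
  have h := (S.isAsymptoticPath_pathVel hVK hx).isScatteringLimit (two_mul_RM_gt hx)
  simp only [startPoint, limitPoint, S.endInvSpeed_eq_speedAt hVK hx, S.endMom_eq_momAt hVK hx,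
    S.psi_eq_integral hVK hx]
  exact h

theorem endInvSpeed_pos (S : SolutionFamily M K b ρ η w) (hVK : V ⊆ K)
    {x : Triple d} (hx : x ∈ paramDomain M V η) : 0 < famVal 0 (endInvSpeed w) x := by
  have hone : (1 : ℝ) ∈ Set.Icc (0 : ℝ) 1 := ⟨zero_le_one, le_rfl⟩
  rw [S.endInvSpeed_eq_speedAt hVK hx]
  exact inv_pos.2 (one_pos.trans_le (one_le_speedAt
    ((S.isAsymptoticPath_pathVel hVK hx).mem 1 hone) hone (two_mul_RM_gt hx)))

/-- Once the components are identified with the derivatives of ψ, this is the eikonal equation: S⁻²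
from the radial part and 1 - S⁻² from the angular part. -/
theorem symbolP_startPoint (S : SolutionFamily M K b ρ η w) (hVK : V ⊆ K)
    {x : Triple d} (hx : x ∈ paramDomain M V η) : symbolP M 1 (startPoint w x) = 1 := by
  have hone : (1 : ℝ) ∈ Set.Icc (0 : ℝ) 1 := ⟨zero_le_one, le_rfl⟩
  have hpath := S.isAsymptoticPath_pathVel hVK hx
  have h := kinetic_path (H := (startPoint w x).2.2.2) (hpath.mem 1 hone) one_pos le_rfl
    (two_mul_RM_gt hx) (fun l => by simp only [startPoint, S.endMom_eq_momAt hVK hx])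
  rw [div_one, hpath.endpoint] at h
  rw [symbolP_one]
  have h1 : (startPoint w x).2.2.1 = (speedAt M x.1 x.2.2 (pathVel w hVK hx) 1)⁻¹ :=
    S.endInvSpeed_eq_speedAt hVK hx
  have h2 : kinetic M ((startPoint w x).1, (startPoint w x).2.1, (startPoint w x).2.2.2)
      = 1 - (speedAt M x.1 x.2.2 (pathVel w hVK hx) 1)⁻¹ ^ 2 := h
  rw [h1, h2]
  ring

/-- The generating function of the rescaled problem. -/
def psiEps (w : Par d → Vel M K) (ε : ℝ) (x : Triple d) : ℝ := ε * psi w (x.1 / ε, x.2)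

section Derivatives

variable {ε r : ℝ} {θ ϑ : Ang d}

theorem hasFDerivAt_psi (S : SolutionFamily M K b ρ η w) (hV : IsOpen V) (hVK : V ⊆ K)
    {x : Triple d} (hx : x ∈ paramDomain M V η) : HasFDerivAt (psi w) (fderiv ℝ (psi w) x) x :=
  (((S.contDiffOn_psi hV hVK).contDiffAt
    ((isOpen_paramDomain hV).mem_nhds hx)).differentiableAt (by simp)).hasFDerivAt

theorem deriv_psiEps (S : SolutionFamily M K b ρ η w) (hV : IsOpen V) (hVK : V ⊆ K)
    (hε : ε ≠ 0) (hx : (r / ε, θ, ϑ) ∈ paramDomain M V η) :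
    deriv (fun r => psiEps w ε (r, θ, ϑ)) r = famVal 0 (endInvSpeed w) (r / ε, θ, ϑ) := by
  have h1 : HasDerivAt (fun r : ℝ => ((r / ε, θ, ϑ) : Triple d)) (1 / ε, 0, 0) r :=
    ((hasDerivAt_id r).div_const ε).prodMk (hasDerivAt_const r (θ, ϑ))
  have h2 := (HasFDerivAt.comp_hasDerivAt (l := psi w) r (S.hasFDerivAt_psi hV hVK hx)
    h1).const_mul ε
  have h3 : ((1 / ε, 0, 0) : Triple d) = (1 / ε) • ((1, 0, 0) : Triple d) := by simp
  rw [h3, map_smul, S.fderiv_psi_radial hV hVK hx, smul_eq_mul, ← mul_assoc,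
    mul_one_div_cancel hε, one_mul] at h2
  exact h2.deriv

theorem gradient_psiEps_start (S : SolutionFamily M K b ρ η w) (hV : IsOpen V) (hVK : V ⊆ K)
    (hε : ε ≠ 0) (hx : (r / ε, θ, ϑ) ∈ paramDomain M V η) (l : Fin d) :
    gradient (fun θ => psiEps w ε (r, θ, ϑ)) θ l
      = -r * famVal 0 (endMom w l) (r / ε, θ, ϑ) := by
  have h1 : HasFDerivAt (fun θ : Ang d => ((r / ε, θ, ϑ) : Triple d))
      ((0 : Ang d →L[ℝ] ℝ).prod ((ContinuousLinearMap.id ℝ _).prod (0 : Ang d →L[ℝ] Ang d))) θ :=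
    (hasFDerivAt_const _ θ).prodMk ((hasFDerivAt_id θ).prodMk (hasFDerivAt_const ϑ θ))
  have h2 := (HasFDerivAt.comp (g := psi w) θ (S.hasFDerivAt_psi hV hVK hx) h1).const_mul ε
  have h3 := h2.fderiv
  simp only [Function.comp_def] at h3
  rw [gradient_apply]
  simp only [psiEps]
  rw [h3]
  simp only [_root_.smul_apply, ContinuousLinearMap.comp_apply,
    ContinuousLinearMap.prod_apply, _root_.zero_apply,
    ContinuousLinearMap.id_apply, S.fderiv_psi_angular hV hVK hx]
  simp [unitVec]
  field_simp

theorem gradient_psiEps_limit (S : SolutionFamily M K b ρ η w) (hV : IsOpen V) (hVK : V ⊆ K)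
    (hε : ε ≠ 0) (hx : (r / ε, θ, ϑ) ∈ paramDomain M V η) (l : Fin d) :
    gradient (fun ϑ => psiEps w ε (r, θ, ϑ)) ϑ l
      = r * famVal 0 (infMom w l) (r / ε, θ, ϑ) := by
  have h1 : HasFDerivAt (fun ϑ : Ang d => ((r / ε, θ, ϑ) : Triple d))
      ((0 : Ang d →L[ℝ] ℝ).prod ((0 : Ang d →L[ℝ] Ang d).prod (ContinuousLinearMap.id ℝ _))) ϑ :=
    (hasFDerivAt_const _ ϑ).prodMk ((hasFDerivAt_const θ ϑ).prodMk (hasFDerivAt_id ϑ))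
  have h2 := (HasFDerivAt.comp (g := psi w) ϑ (S.hasFDerivAt_psi hV hVK hx) h1).const_mul ε
  have h3 := h2.fderiv
  simp only [Function.comp_def] at h3
  rw [gradient_apply]
  simp only [psiEps]
  rw [h3]
  simp only [_root_.smul_apply, ContinuousLinearMap.comp_apply,
    ContinuousLinearMap.prod_apply, _root_.zero_apply,
    ContinuousLinearMap.id_apply, S.fderiv_psi_angular hV hVK hx]
  simp [unitVec]
  field_simp

/-- Together with `finalPoint_psiEps`, this transports all assertions on ψ_ε and ϱ to ε = ϱ = 1
through `scalePhase`. -/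
theorem initialPoint_psiEps (S : SolutionFamily M K b ρ η w) (hV : IsOpen V) (hVK : V ⊆ K)
    (hε : ε ≠ 0) (hx : (r / ε, θ, ϑ) ∈ paramDomain M V η) (ϱ : ℝ) :
    initialPoint (psiEps w ε) r θ ϱ ϑ = scalePhase ε ϱ (startPoint w (r / ε, θ, ϑ)) := by
  simp only [initialPoint, phase, scalePhase_apply, startPoint]
  refine Prod.ext ?_ (Prod.ext rfl (Prod.ext ?_ ?_))
  · exact (mul_div_cancel₀ r hε).symm
  · simp only
    rw [deriv_const_mul_field, S.deriv_psiEps hV hVK hε hx]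
  · simp only
    rw [gradient_const_mul]
    ext l
    rw [PiLp.smul_apply, S.gradient_psiEps_start hV hVK hε hx]
    simp only [PiLp.smul_apply, smul_eq_mul]
    field_simp

theorem finalPoint_psiEps (S : SolutionFamily M K b ρ η w) (hV : IsOpen V) (hVK : V ⊆ K)
    (hε : ε ≠ 0) (hx : (r / ε, θ, ϑ) ∈ paramDomain M V η) (ϱ : ℝ) :
    finalPoint (psiEps w ε) r θ ϱ ϑ = scalePhase ε ϱ (limitPoint w (r / ε, θ, ϑ)) := by
  simp only [finalPoint, phase, scalePhase_apply, limitPoint]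
  refine Prod.ext ?_ (Prod.ext rfl (Prod.ext ?_ ?_))
  · simp [psiEps]
  · simp
  · simp only
    rw [gradient_const_mul]
    ext l
    rw [PiLp.neg_apply, PiLp.smul_apply, S.gradient_psiEps_limit hV hVK hε hx]
    simp only [PiLp.smul_apply, smul_eq_mul]
    field_simp

theorem contDiffOn_psiEps (S : SolutionFamily M K b ρ η w) (hV : IsOpen V) (hVK : V ⊆ K)
    {D : Set (Triple d)} (hD : ∀ x ∈ D, (x.1 / ε, x.2) ∈ paramDomain M V η) :
    ContDiffOn ℝ ∞ (psiEps w ε) D := by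
  refine contDiffOn_const.mul ((S.contDiffOn_psi hV hVK).comp ?_ hD)
  exact ((contDiff_fst.div_const ε).prodMk contDiff_snd).contDiffOn

end Derivatives

/-- Every point of a strongly outgoing or incoming region has a scattering limit. -/
theorem exists_isScatteringLimit (S : SolutionFamily M K b ρ η w) (hK : IsCompact K)
    (hKU : K ⊆ M.U) (hVK : V ⊆ K) : ∃ κ β : ℝ, 0 < κ ∧ κ < 1 ∧ 0 < β ∧
      ∀ R, 2 * M.RM < R → R ^ (-M.ν) < β → ∀ ε ∈ Set.Ioc (0 : ℝ) 1, ∀ σ : ℝ, (σ = 1 ∨ σ = -1) →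
      ∀ z ∈ strongRegion M ε σ R V κ, ∃ z', IsScatteringLimit M ε σ z z' := by
  obtain ⟨κs, hκs, hsurj⟩ := S.exists_endMom_eq hK hKU hVK
  obtain ⟨C, hC, hbd⟩ := exists_metric_bound hK hKU (2 * M.RM) (by
    have := M.RM_pos
    linarith)
  have hκpos : 0 < min (1 / 2) (κs / (2 * C + 1)) := lt_min (by norm_num) (by positivity)
  refine ⟨min (1 / 2) (κs / (2 * C + 1)), κs, hκpos, (min_le_left _ _).trans_lt (by norm_num),
    hκs, fun R hR hRν ε hε σ hσ z hz => ?_⟩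
  -- In the strong region at unit energy the kinetic part is at most 1 - (1 - κ²)² ≤ 2κ², so the
  -- momenta divided by the radius have squares at most 2Cκ². The choice of κ makes this at most
  -- κs².
  set κ := min (1 / 2) (κs / (2 * C + 1)) with hκ
  have hκsq : 2 * C * κ ^ 2 ≤ κs ^ 2 := by
    have h1 : κ * (2 * C + 1) ≤ κs := by
      rw [← le_div_iff₀ (by positivity)]
      exact min_le_right _ _
    have h2 : (κ * (2 * C + 1)) ^ 2 ≤ κs ^ 2 := pow_le_pow_left₀ (by positivity) h1 2
    nlinarith [sq_nonneg κ, mul_pos hC hC, mul_nonneg hC.le (sq_nonneg κ)]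
  have hκ2 : κ ^ 2 < 1 := by
    have : κ ≤ 1 / 2 := min_le_left _ _
    nlinarith
  obtain ⟨hzR, hzV, hzκ⟩ := hz
  have hσσ : σ * σ = 1 := by rcases hσ with rfl | rfl <;> norm_num
  have hε0 : ε ≠ 0 := hε.1.ne'
  have hRM := M.RM_pos
  have hR0 : 0 < R := by linarith
  set m := √(symbolP M ε z) with hm
  have hσρ : 0 < σ * z.2.2.1 :=
    (mul_nonneg (by linarith) (Real.sqrt_nonneg _)).trans_lt hzκ
  have hrε : R < z.1 / ε := by
    rw [lt_div_iff₀ hε.1]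
    exact (mul_le_of_le_one_right hR0.le hε.2).trans_lt hzR
  have hr2 : 2 * M.RM < z.1 / ε := hR.trans hrε
  have hrRM : M.RM < z.1 / ε := by linarith
  have hrpos : 0 < z.1 / ε := by linarith
  have hkin_nonneg : ∀ H : Ang d, 0 ≤ kinetic M (z.1 / ε, z.2.1, H) := fun H => by
    have h1 := sum_sq_le_kinetic (H := H) hrRM (hKU (hVK hzV)) hC (hbd _ _ hr2 (hVK hzV))
    have h2 : 0 ≤ ∑ l, (H l / (z.1 / ε)) ^ 2 := Finset.sum_nonneg fun l _ => sq_nonneg _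
    exact nonneg_of_mul_nonneg_right (h2.trans h1) hC
  have hz1 : scalePhase ε 1 (z.1 / ε, z.2.1, z.2.2.1, ε⁻¹ • z.2.2.2) = z := by
    simp [scalePhase_apply, mul_div_cancel₀ z.1 hε0, smul_inv_smul₀ hε0]
  have hppos : 0 < symbolP M ε z := by
    rw [← hz1, symbolP_scalePhase hε0, symbolP_one]
    have h1 := hkin_nonneg (ε⁻¹ • z.2.2.2)
    have h2 : 0 < z.2.2.1 ^ 2 := by
      refine sq_pos_of_ne_zero fun h => ?_
      rw [h, mul_zero] at hσρ
      exact lt_irrefl _ hσρ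
    simp only
    linarith
  have hmpos : 0 < m := Real.sqrt_pos.2 hppos
  have hmsq : m ^ 2 = symbolP M ε z := Real.sq_sqrt hppos.le
  -- Dividing the momenta by σ√p brings the point to energy one with positive radial momentum.
  set β := σ * m with hβ
  have hσβ : 0 < σ * β := by
    rw [hβ, ← mul_assoc, hσσ, one_mul]
    exact hmpos
  have hβ0 : β ≠ 0 := fun h => by simp [h] at hσβ
  have hβsq : β ^ 2 = m ^ 2 := by
    rw [hβ, mul_pow, sq σ, hσσ, one_mul]
  set H : Ang d := (ε * β)⁻¹ • z.2.2.2 with hH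
  set z₀ : Phase d := (z.1 / ε, z.2.1, z.2.2.1 / β, H) with hz₀
  have hz0 : scalePhase ε β z₀ = z := by
    simp only [scalePhase_apply, hz₀, hH, mul_div_cancel₀ _ hε0, mul_div_cancel₀ _ hβ0,
      smul_inv_smul₀ (mul_ne_zero hε0 hβ0)]
  have hp0 : symbolP M 1 z₀ = 1 := by
    have h1 := symbolP_scalePhase (M := M) hε0 β z₀
    rw [hz0, ← hmsq, hβsq] at h1
    have h2 : m ^ 2 ≠ 0 := by positivity
    field_simp at h1
    linarith
  have hρ₀ : 1 - κ ^ 2 < z.2.2.1 / β := by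
    have h1 : z.2.2.1 / β = σ * z.2.2.1 / m := by
      rw [hβ]
      field_simp
      rcases hσ with h | h <;> simp [h, div_neg]
    rw [h1, lt_div_iff₀ hmpos]
    exact hzκ
  have hsq : (z.2.2.1 / β) ^ 2 + kinetic M (z.1 / ε, z.2.1, H) = 1 := by
    rw [symbolP_one] at hp0
    exact hp0
  have hkin : kinetic M (z.1 / ε, z.2.1, H) ≤ 2 * κ ^ 2 := by nlinarith
  have hsum := sum_sq_le_kinetic (H := H) hrRM (hKU (hVK hzV)) hC (hbd _ _ hr2 (hVK hzV))
  have hsmall : ∀ l, |-(H l / (z.1 / ε))| ≤ κs := fun l => by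
    rw [abs_neg]
    refine abs_le_of_sq_le_sq ?_ hκs.le
    have h1 : (H l / (z.1 / ε)) ^ 2 ≤ ∑ l, (H l / (z.1 / ε)) ^ 2 :=
      Finset.single_le_sum (f := fun l => (H l / (z.1 / ε)) ^ 2) (fun l _ => sq_nonneg _)
        (Finset.mem_univ l)
    nlinarith
  have hrν : (z.1 / ε) ^ (-M.ν) < κs :=
    (Real.rpow_le_rpow_of_nonpos hR0 hrε.le (by have := M.ν_pos; linarith)).trans_lt hRν
  obtain ⟨ϑ, hdom, hϑ⟩ := hsurj (z.1 / ε) z.2.1 hr2 hrν hzV (fun l => -(H l / (z.1 / ε))) hsmall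
  have hHeq : (WithLp.toLp 2 fun l => -(z.1 / ε) * famVal 0 (endMom w l) (z.1 / ε, z.2.1, ϑ)
      : Ang d) = H := by
    ext l
    simp only [hϑ]
    rw [neg_mul_neg, mul_div_cancel₀ _ hrpos.ne']
  -- Position and angular momentum agree by the choice of ϑ; the radial momenta agree because both
  -- points have energy one and both radial momenta are positive.
  have hstart : startPoint w (z.1 / ε, z.2.1, ϑ) = z₀ := by
    have h1 := S.symbolP_startPoint hVK hdom
    rw [symbolP_one] at h1
    simp only [startPoint, hHeq] at h1
    simp only [startPoint, hHeq, hz₀]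
    have h2 : famVal 0 (endInvSpeed w) (z.1 / ε, z.2.1, ϑ) = z.2.2.1 / β := by
      refine (sq_eq_sq₀ (S.endInvSpeed_pos hVK hdom).le (by linarith)).1 ?_
      linarith
    rw [h2]
  have hlim := (S.isScatteringLimit_startPoint hVK hdom).scale hε.1 hσ hσβ
  rw [hstart, hz0] at hlim
  exact ⟨_, hlim⟩

end SolutionFamily

end ConicScattering

/-! ### Symbol estimates. -/

namespace ConicScattering

open BoundedContinuousFunction

section IterPartial

variable {X : Type*} [NormedAddCommGroup X] [NormedSpace ℝ X]

theorem iterPartial_sum {ι : Type*} {s : Finset ι} {f : ι → X → ℝ} {O : Set X} (hO : IsOpen O)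
    (hf : ∀ i ∈ s, ContDiffOn ℝ ∞ (f i) O) (L : List X) :
    Set.EqOn (iterPartial L (fun x => ∑ i ∈ s, f i x))
      (fun x => ∑ i ∈ s, iterPartial L (f i) x) O := by
  induction L with
  | nil => exact fun _ _ => rfl
  | cons v L ih =>
    intro x hx
    have h1 := Filter.eventuallyEq_of_mem (hO.mem_nhds hx) ih
    simp only [iterPartial_cons, h1.fderiv_eq]
    rw [fderiv_fun_sum fun i hi => ((contDiffOn_iterPartial hO (hf i hi) _).contDiffAt
      (hO.mem_nhds hx)).differentiableAt (by simp)]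
    simp

end IterPartial

variable {d : ℕ} {M : ConicChart d} {K V : Set (Ang d)} {b ρ η : ℝ}

theorem isOpen_Theta {R δ : ℝ} (hV : IsOpen V) : IsOpen (Theta R V δ) := by
  have h1 : IsOpen {x : Triple d | R < x.1} := isOpen_lt continuous_const continuous_fst
  have h2 : IsOpen {x : Triple d | x.2.1 ∈ V} := hV.preimage (by fun_prop)
  have h3 : IsOpen {x : Triple d | ‖x.2.1 - x.2.2‖ < δ} := isOpen_lt (by fun_prop) continuous_const
  exact h1.inter (h2.inter h3)

section Symbols

variable {D : Set (Triple d)} {μ : ℝ}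

theorem IsSymbol.sum {ι : Type*} {s : Finset ι} {a : ι → ℝ → Triple d → ℝ} (hD : IsOpen D)
    (ha : ∀ i ∈ s, IsSymbol D μ (a i)) : IsSymbol D μ (fun ε x => ∑ i ∈ s, a i ε x) := by
  refine ⟨fun ε hε => ContDiffOn.sum fun i hi => (ha i hi).1 ε hε, fun j α β => ?_⟩
  have h := fun i : s => (ha i i.2).2 j α β
  choose C hC using h
  refine ⟨∑ i : s, C i, fun ε hε x hx => ?_⟩
  rw [triplePartial, iterPartial_sum hD (fun i hi => (ha i hi).1 ε hε) _ hx, Finset.sum_mul]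
  beta_reduce
  rw [← Finset.sum_coe_sort s]
  refine (Finset.abs_sum_le_sum_abs _ _).trans (Finset.sum_le_sum fun i _ => ?_)
  exact hC i ε hε x hx

/-- The multi-index of a sequence of coordinate indices. -/
def multiIndex {m : ℕ} (τ : Fin m → Fin d) (i : Fin d) : ℕ := (Finset.univ.filter fun k => τ k = i).card

theorem prod_comp_eq_multiIndex {m : ℕ} (τ : Fin m → Fin d) (y : Fin d → ℝ) :
    ∏ k, y (τ k) = ∏ i, y i ^ multiIndex τ i := by
  rw [← Finset.prod_fiberwise Finset.univ τ]
  refine Finset.prod_congr rfl fun i _ => ?_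
  rw [multiIndex, ← Finset.prod_const]
  refine Finset.prod_congr rfl fun k hk => ?_
  rw [(Finset.mem_filter.1 hk).2]

theorem multiIndex_mem {m : ℕ} (τ : Fin m → Fin d) :
    multiIndex τ ∈ Finset.piAntidiag Finset.univ m := by
  rw [Finset.mem_piAntidiag]
  refine ⟨?_, fun i _ => Finset.mem_univ i⟩
  change ∑ i, (Finset.univ.filter fun k => τ k = i).card = m
  rw [← Finset.card_eq_sum_card_fiberwise (f := τ) (s := Finset.univ) fun k _ => Finset.mem_univ _]
  simp

/-- Hadamard's lemma produces sums over sequences of indices; terms with the same multi-index are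
collected. -/
theorem isSymbolPow_of_sum {m : ℕ} {f : ℝ → Triple d → ℝ} (hD : IsOpen D)
    {a : (Fin m → Fin d) → ℝ → Triple d → ℝ} (ha : ∀ τ, IsSymbol D μ (a τ))
    (hf : ∀ ε ∈ Set.Ioc (0 : ℝ) 1, ∀ x ∈ D,
      f ε x = ∑ τ, a τ ε x * ∏ k, (x.2.2 (τ k) - x.2.1 (τ k))) : IsSymbolPow D μ m f := by
  refine ⟨fun γ ε x => ∑ τ with multiIndex τ = γ, a τ ε x,
    fun γ _ => IsSymbol.sum hD fun τ _ => ha τ, fun ε hε x hx => ?_⟩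
  rw [hf ε hε x hx, ← Finset.sum_fiberwise_of_maps_to (g := multiIndex)
    fun τ _ => multiIndex_mem τ]
  refine Finset.sum_congr rfl fun γ _ => ?_
  rw [Finset.sum_mul]
  refine Finset.sum_congr rfl fun τ hτ => ?_
  rw [prod_comp_eq_multiIndex τ fun i => x.2.2 i - x.2.1 i, (Finset.mem_filter.1 hτ).2]

end Symbols

section FamilySymbols

theorem norm_evalCLM_le (j : PathIdx M K) :
    ‖(evalCLM ℝ j : Alg M K →L[ℝ] ℝ)‖ ≤ 1 :=
  ContinuousLinearMap.opNorm_le_bound _ zero_le_one fun x => by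
    rw [one_mul]
    exact x.norm_coe_le_norm j

theorem paramDomain_mono {δ : ℝ} (h : δ ≤ η) : paramDomain M V δ ⊆ paramDomain M V η :=
  fun _ hx => ⟨hx.1, hx.2.1.trans_le h, hx.2.2.1, hx.2.2.2.trans_le h⟩

theorem div_mem_paramDomain {R δ ε : ℝ} (hR : 2 * M.RM < R) (hRδ : R ^ (-M.ν) < δ)
    (hε : ε ∈ Set.Ioc (0 : ℝ) 1) {x : Triple d} (hx : x ∈ Theta R V δ) :
    (x.1 / ε, x.2) ∈ paramDomain M V δ := by
  have hRM := M.RM_pos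
  have hR0 : 0 < R := by linarith
  have hrε : R < x.1 / ε := by
    rw [lt_div_iff₀ hε.1]
    exact (mul_le_of_le_one_right hR0.le hε.2).trans_lt hx.1
  refine ⟨hR.trans hrε, ?_, hx.2.1, ?_⟩
  · exact (Real.rpow_le_rpow_of_nonpos hR0 hrε.le (by
      have := M.ν_pos
      linarith)).trans_lt hRδ
  · rw [norm_sub_rev]
    exact hx.2.2

/-- The linear change of data for the problem rescaled by `ε`, at radius `r`. -/
def rescaledDilation (r ε : ℝ) : Triple d →L[ℝ] Par d :=
  (dilation (r / ε)).comp ((ε⁻¹ • ContinuousLinearMap.fst ℝ ℝ (Ang d × Ang d)).prod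
    (ContinuousLinearMap.snd ℝ ℝ (Ang d × Ang d)))

/-- Relative displacements of the radius do not see ε, which is why the constants are independent of
it. -/
theorem rescaledDilation_apply {r ε : ℝ} (hε : ε ≠ 0) (e : Triple d) :
    rescaledDilation r ε e = (0, r⁻¹ * e.1, e.2) := by
  simp only [rescaledDilation, ContinuousLinearMap.comp_apply, dilation_apply,
    ContinuousLinearMap.prod_apply, _root_.smul_apply,
    ContinuousLinearMap.coe_fst', ContinuousLinearMap.coe_snd', smul_eq_mul]
  congr 2
  field_simp

/-- Homogeneous families define symbols. -/
theorem Consistent.isSymbol {q n : ℕ} {A E : Par d → Alg M K} (hA : Consistent η q A)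
    (hE : ContDiffOn ℝ ∞ E (Metric.ball 0 η))
    (hAE : ∀ p ∈ Metric.ball (0 : Par d) η, A p = p.1 ^ n • E p)
    (hV : IsOpen V) (hVK : V ⊆ K) {R δ : ℝ} (hR : 2 * M.RM < R) (hRδ : R ^ (-M.ν) < δ)
    (hδ : δ < η) :
    IsSymbol (Theta R V δ) (q - n * M.ν) fun ε x => ε ^ q * famVal q A (x.1 / ε, x.2) := by
  have hAs : ContDiffOn ℝ ∞ A (Metric.ball 0 η) := by
    have h : ContDiffOn ℝ ∞ (fun p : Par d => p.1 ^ n) (Metric.ball 0 η) := by fun_prop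
    exact (h.smul hE).congr hAE
  have hdom : ∀ ε ∈ Set.Ioc (0 : ℝ) 1, ∀ x ∈ Theta R V δ,
      (x.1 / ε, x.2) ∈ paramDomain M V δ := fun ε hε x hx => div_mem_paramDomain hR hRδ hε hx
  have hRM := M.RM_pos
  have hR0 : 0 < R := by linarith
  refine ⟨fun ε hε => ?_, fun j α β => ?_⟩
  · refine contDiffOn_const.mul ((hA.contDiffOn_famVal hAs hV hVK).comp ?_
      fun x hx => paramDomain_mono hδ.le (hdom ε hε x hx))
    exact ((contDiff_fst.div_const ε).prodMk contDiff_snd).contDiffOn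
  -- Each direction is stored with its scale: c for the radial ones, to be taken as 1/r, and 1 for
  -- the angular ones. The scales multiply to r^{-j}, while the directions themselves do not depend
  -- on the point.
  set dirs : ℝ → List (ℝ × Par d) := fun c => List.replicate j (c, ((0, 1, 0, 0) : Par d))
    ++ α.map (fun i => ((1 : ℝ), ((0, 0, unitVec i, 0) : Par d)))
    ++ β.map (fun i => ((1 : ℝ), ((0, 0, 0, unitVec i) : Par d))) with hdirs
  have hdirs_snd : ∀ c, (dirs c).map Prod.snd = (dirs 1).map Prod.snd := fun c => by
    simp [hdirs, Function.comp_def]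
  have hdirs_fst : ∀ c, ((dirs c).map Prod.fst).prod = c ^ j := fun c => by
    simp [hdirs, Function.comp_def]
  obtain ⟨C, hC⟩ := exists_bound_iterPartial_clm_comp Metric.isOpen_ball hE
    (isCompact_closedBall (0 : Par d) δ) (Metric.closedBall_subset_ball hδ)
    ((dirs 1).map Prod.snd)
  refine ⟨|C|, fun ε hε x hx => ?_⟩
  have hε0 := hε.1.ne'
  have hx0 : 0 < x.1 := hR0.trans hx.1
  set y : Triple d := (x.1 / ε, x.2) with hy
  have hyδ : y ∈ paramDomain M V δ := hdom ε hε x hx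
  have hyη := paramDomain_mono hδ.le hyδ
  set T := rescaledDilation (d := d) x.1 ε with hT
  set c : Par d := basePar M y - T x with hc
  set φ : Alg M K →L[ℝ] ℝ := evalCLM ℝ (baseIdx hVK hyη, (1 : unitInterval)) with hφ
  set a₀ : ℝ := x.1 ^ q * (y.1 ^ (-M.ν)) ^ n with ha₀
  have hTsub : ∀ x' : Triple d, T x' + c
      = basePar M y + dilation y.1 ((x'.1 / ε, x'.2) - y) := fun x' => by
    rw [hc, add_sub, add_comm (T x'), ← add_sub, ← map_sub, hT,
      rescaledDilation_apply hε0, dilation_apply, hy]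
    congr 2
    simp only [Prod.fst_sub]
    field_simp
    rfl
  have hopen : IsOpen (Theta R V δ ∩ (fun x' => T x' + c) ⁻¹' Metric.ball (0 : Par d) η) :=
    (isOpen_Theta hV).inter (Metric.isOpen_ball.preimage (by fun_prop))
  have hbase : T x + c ∈ Metric.ball (0 : Par d) η := by
    rw [hc, add_sub_cancel]
    exact basePar_mem hyη
  -- Near x the function is a constant times an evaluation of `E` at a parameter affine in x', the
  -- component μ being frozen; ε^q (x.1/ε)^q gives the factor x.1^q.
  have hcongr : Set.EqOn (fun x' : Triple d => ε ^ q * famVal q A (x'.1 / ε, x'.2))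
      (fun x' => a₀ * φ (E (T x' + c)))
      (Theta R V δ ∩ (fun x' => T x' + c) ⁻¹' Metric.ball (0 : Par d) η) := by
    rintro x' ⟨hx', hp⟩
    have hp' : T x' + c ∈ Metric.ball (0 : Par d) η := hp
    have h1 : (T x' + c).1 = y.1 ^ (-M.ν) := by
      rw [hTsub, dilation_apply, basePar]
      simp
    simp only
    rw [hA.famVal_eq hVK hyη (paramDomain_mono hδ.le (hdom ε hε x' hx')) (by rwa [← hTsub]),
      ← hTsub, hAE _ hp', h1]
    simp only [hφ, evalCLM_apply, BoundedContinuousFunction.smul_apply, smul_eq_mul, ha₀]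
    rw [← mul_assoc, ← mul_pow, ← mul_assoc]
    congr 3
    simp only [hy]
    field_simp
  have hφE : ContDiffOn ℝ ∞ (fun p => φ (E p)) (Metric.ball 0 η) :=
    φ.contDiff.comp_contDiffOn hE
  have hmem : x ∈ Theta R V δ ∩ (fun x' => T x' + c) ⁻¹' Metric.ball (0 : Par d) η := ⟨hx, hbase⟩
  have hO' : IsOpen ((fun x' => T x' + c) ⁻¹' Metric.ball (0 : Par d) η) :=
    Metric.isOpen_ball.preimage (by fun_prop)
  have hmul := iterPartial_const_mul hO' (hφE.comp (T.contDiff.add contDiff_const).contDiffOn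
    fun _ h => h) a₀ (List.replicate j ((1, 0, 0) : Triple d)
      ++ α.map (fun i => ((0, unitVec i, 0) : Triple d))
      ++ β.map (fun i => ((0, 0, unitVec i) : Triple d))) hbase
  have haff := iterPartial_comp_affine Metric.isOpen_ball hφE T c
    (List.replicate j ((1, 0, 0) : Triple d) ++ α.map (fun i => ((0, unitVec i, 0) : Triple d))
      ++ β.map (fun i => ((0, 0, unitVec i) : Triple d))) hbase
  have hmap : (List.replicate j ((1, 0, 0) : Triple d)
      ++ α.map (fun i => ((0, unitVec i, 0) : Triple d))
      ++ β.map (fun i => ((0, 0, unitVec i) : Triple d))).map T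
      = (dirs x.1⁻¹).map fun a => a.1 • a.2 := by
    simp [hdirs, hT, Function.comp_def, rescaledDilation_apply hε0]
  have hsm := iterPartial_map_smul Metric.isOpen_ball hφE Prod.fst Prod.snd (dirs x.1⁻¹) hbase
  simp only [Function.comp_def] at haff hsm hmul
  rw [triplePartial, iterPartial_congr hopen hcongr _ hmem, hmul, haff, hmap, hsm, hdirs_fst, hdirs_snd]
  have hpt : T x + c ∈ Metric.closedBall (0 : Par d) δ := by
    rw [hc, add_sub_cancel]
    exact Metric.ball_subset_closedBall (basePar_mem hyδ)
  have hbd := (hC φ (norm_evalCLM_le _) _ hpt).trans (le_abs_self C)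
  -- The rescaled radius r/ε is at least r, so its negative powers are bounded by those of r.
  have hμ : (y.1 ^ (-M.ν)) ^ n ≤ (x.1 ^ (-M.ν)) ^ n := by
    refine pow_le_pow_left₀ (Real.rpow_nonneg (paramDomain_pos hyη).le _) ?_ n
    refine Real.rpow_le_rpow_of_nonpos hx0 ?_ (by have := M.ν_pos; linarith)
    rw [hy]
    simp only
    rw [le_div_iff₀ hε.1]
    exact mul_le_of_le_one_right hx0.le hε.2
  have hexp : x.1 ^ ((q : ℝ) - n * M.ν - j) = x.1 ^ q * (x.1 ^ (-M.ν)) ^ n * x.1⁻¹ ^ j := by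
    rw [← Real.rpow_natCast (x.1 ^ (-M.ν)), ← Real.rpow_mul hx0.le, ← Real.rpow_natCast x.1 q,
      ← Real.rpow_neg_one x.1, ← Real.rpow_natCast (x.1 ^ (-1 : ℝ)), ← Real.rpow_mul hx0.le,
      ← Real.rpow_add hx0, ← Real.rpow_add hx0]
    congr 1
    ring
  have hypos := paramDomain_pos hyη
  have ha₀pos : 0 ≤ a₀ := by rw [ha₀]; positivity
  rw [abs_mul a₀, abs_mul (x.1⁻¹ ^ j), abs_of_nonneg ha₀pos, abs_of_nonneg (by positivity : (0 : ℝ) ≤ x.1⁻¹ ^ j),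
    hexp]
  have h1 : a₀ ≤ x.1 ^ q * (x.1 ^ (-M.ν)) ^ n :=
    mul_le_mul_of_nonneg_left hμ (by positivity)
  calc a₀ * (x.1⁻¹ ^ j * |iterPartial ((dirs 1).map Prod.snd) (fun p => φ (E p)) (T x + c)|)
      ≤ (x.1 ^ q * (x.1 ^ (-M.ν)) ^ n) * (x.1⁻¹ ^ j * |C|) := by gcongr
    _ = |C| * (x.1 ^ q * (x.1 ^ (-M.ν)) ^ n * x.1⁻¹ ^ j) := by ring

end FamilySymbols

end ConicScattering

/-! ### Hadamard's lemma and expansions at the diagonal. -/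

namespace ConicScattering

open BoundedContinuousFunction

variable {d : ℕ} {M : ConicChart d} {K V : Set (Ang d)} {b ρ η : ℝ} {w : Par d → Vel M K}

section Hadamard

variable {Y : Type} [NormedAddCommGroup Y] [NormedSpace ℝ Y]

/-- The segment of data whose asymptotic angle joins the starting angle to the given one. -/
def lineK (t : ℝ) (p : Par d) : Par d :=
  (p.1, p.2.1, p.2.2.1, p.2.2.1 + t • (p.2.2.2 - p.2.2.1))

/-- The partial derivatives in the asymptotic angle. -/
def dK (m : Fin d) (A : Par d → Y) (p : Par d) : Y := fderiv ℝ A p (0, 0, 0, unitVec m)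

/-- The average along a segment. -/
def avgK (A : Par d → Y) (p : Par d) : Y := ∫ t in (0 : ℝ)..1, A (lineK t p)

theorem lineK_one (p : Par d) : lineK 1 p = p := by simp [lineK]

theorem lineK_zero_diag (p : Par d) : (lineK 0 p).2.2.1 = (lineK 0 p).2.2.2 := by simp [lineK]

theorem lineK_mem {p : Par d} (hp : p ∈ Metric.ball 0 η) {t : ℝ} (ht : t ∈ Set.Icc (0 : ℝ) 1) :
    lineK t p ∈ Metric.ball 0 η := by
  rw [mem_ball_zero_iff] at hp ⊢
  obtain ⟨h1, h2⟩ := max_lt_iff.1 hp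
  obtain ⟨h2, h3⟩ := max_lt_iff.1 h2
  obtain ⟨h3, h4⟩ := max_lt_iff.1 h3
  refine max_lt h1 (max_lt h2 (max_lt h3 ?_))
  exact mem_ball_zero_iff.1 ((convex_ball (0 : Ang d) η).add_smul_sub_mem
    (mem_ball_zero_iff.2 h3) (mem_ball_zero_iff.2 h4) ht)

theorem contDiff_lineK : ContDiff ℝ ∞ fun q : Par d × ℝ => lineK q.2 q.1 := by
  unfold lineK
  fun_prop

theorem contDiff_lineK_const (t : ℝ) : ContDiff ℝ ∞ (lineK t : Par d → Par d) := by
  unfold lineK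
  fun_prop

theorem continuousOn_comp_lineK {A : Par d → Y} (hA : ContDiffOn ℝ ∞ A (Metric.ball 0 η))
    {p : Par d} (hp : p ∈ Metric.ball 0 η) :
    ContinuousOn (fun t => A (lineK t p)) (Set.Icc 0 1) := by
  refine hA.continuousOn.comp ?_ fun t ht => lineK_mem hp ht
  exact (contDiff_lineK.continuous.comp (by fun_prop : Continuous fun t : ℝ => (p, t))).continuousOn

theorem contDiffOn_comp_lineK_zero {A : Par d → Y} (hA : ContDiffOn ℝ ∞ A (Metric.ball 0 η)) :
    ContDiffOn ℝ ∞ (fun p => A (lineK 0 p)) (Metric.ball 0 η) :=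
  hA.comp (contDiff_lineK_const 0).contDiffOn fun _ hp => lineK_mem hp ⟨le_rfl, zero_le_one⟩

theorem contDiffOn_dK {A : Par d → Y} (hA : ContDiffOn ℝ ∞ A (Metric.ball 0 η)) (m : Fin d) :
    ContDiffOn ℝ ∞ (dK m A) (Metric.ball 0 η) :=
  (hA.fderiv_of_isOpen Metric.isOpen_ball (by simp)).clm_apply contDiffOn_const

theorem contDiffOn_avgK [CompleteSpace Y] {A : Par d → Y}
    (hA : ContDiffOn ℝ ∞ A (Metric.ball 0 η)) : ContDiffOn ℝ ∞ (avgK A) (Metric.ball 0 η) :=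
  contDiffOn_integral_unitInterval (F := fun q : Par d × ℝ => A (lineK q.2 q.1))
    (Metric.isOpen_ball.preimage contDiff_lineK.continuous) Metric.isOpen_ball
    (hA.comp contDiff_lineK.contDiffOn fun _ h => h) fun _ hp _ ht => lineK_mem hp ht

/-- Integration of the derivative along the segment that moves the asymptotic angle from θ to ϑ. -/
theorem eq_add_sum_avgK [CompleteSpace Y] {A : Par d → Y}
    (hA : ContDiffOn ℝ ∞ A (Metric.ball 0 η)) {p : Par d} (hp : p ∈ Metric.ball 0 η) :
    A p = A (lineK 0 p) + ∑ m, (p.2.2.2 m - p.2.2.1 m) • avgK (dK m A) p := by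
  have hderiv : ∀ t ∈ Set.uIcc (0 : ℝ) 1, HasDerivAt (fun t => A (lineK t p))
      (∑ m, (p.2.2.2 m - p.2.2.1 m) • dK m A (lineK t p)) t := by
    intro t ht
    rw [Set.uIcc_of_le zero_le_one] at ht
    have h1 : HasFDerivAt A (fderiv ℝ A (lineK t p)) (lineK t p) :=
      ((hA.contDiffAt (Metric.isOpen_ball.mem_nhds (lineK_mem hp ht))).differentiableAt
        (by simp)).hasFDerivAt
    have h2 : HasDerivAt (fun t : ℝ => p.2.2.1 + t • (p.2.2.2 - p.2.2.1))
        (p.2.2.2 - p.2.2.1) t := by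
      simpa using ((hasDerivAt_id t).smul_const (p.2.2.2 - p.2.2.1)).const_add p.2.2.1
    have h3 : HasDerivAt (fun t => lineK t p) (0, 0, 0, p.2.2.2 - p.2.2.1) t :=
      (hasDerivAt_const t p.1).prodMk ((hasDerivAt_const t p.2.1).prodMk
        ((hasDerivAt_const t p.2.2.1).prodMk h2))
    refine (HasFDerivAt.comp_hasDerivAt (l := A) t h1 h3).congr_deriv ?_
    have h4 : ((0, 0, 0, p.2.2.2 - p.2.2.1) : Par d)
        = ∑ m, (p.2.2.2 m - p.2.2.1 m) • ((0, 0, 0, unitVec m) : Par d) := by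
      have h5 : p.2.2.2 - p.2.2.1 = ∑ m, (p.2.2.2 m - p.2.2.1 m) • (unitVec m : Ang d) := by
        ext i
        simp [unitVec, Pi.single_apply]
      refine Prod.ext ?_ (Prod.ext ?_ (Prod.ext ?_ ?_)) <;>
        simp [Prod.fst_sum, Prod.snd_sum, ← h5]
    rw [h4, map_sum]
    simp only [map_smul, dK]
  have hcont : ∀ m : Fin d, ContinuousOn
      (fun t => (p.2.2.2 m - p.2.2.1 m) • dK m A (lineK t p)) (Set.uIcc 0 1) := by
    intro m
    rw [Set.uIcc_of_le zero_le_one]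
    exact (continuousOn_comp_lineK (contDiffOn_dK hA m) hp).const_smul _
  have hint := fun m => (hcont m).intervalIntegrable (μ := MeasureTheory.volume)
  have h := intervalIntegral.integral_eq_sub_of_hasDerivAt hderiv
    (continuousOn_finsetSum _ fun m _ => hcont m).intervalIntegrable
  rw [intervalIntegral.integral_finsetSum fun m _ => hint m, lineK_one] at h
  simp only [intervalIntegral.integral_smul] at h
  simp only [avgK]
  rw [h]
  abel

/-- A smooth function which vanishes where the first parameter does is divisible by it. -/
theorem exists_eq_smul [CompleteSpace Y] {F : Par d → Y}
    (hF : ContDiffOn ℝ ∞ F (Metric.ball 0 η))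
    (h0 : ∀ p ∈ Metric.ball (0 : Par d) η, p.1 = 0 → F p = 0) :
    ∃ E : Par d → Y, ContDiffOn ℝ ∞ E (Metric.ball 0 η) ∧
      ∀ p ∈ Metric.ball (0 : Par d) η, F p = p.1 • E p := by
  set L : Par d × ℝ → Par d := fun q => (q.2 * q.1.1, q.1.2) with hL
  have hLs : ContDiff ℝ ∞ L := by
    rw [hL]
    fun_prop
  have hLmem : ∀ p ∈ Metric.ball (0 : Par d) η, ∀ t ∈ Set.Icc (0 : ℝ) 1,
      L (p, t) ∈ Metric.ball (0 : Par d) η := by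
    intro p hp t ht
    rw [mem_ball_zero_iff] at hp ⊢
    obtain ⟨h1, h2⟩ := max_lt_iff.1 hp
    refine max_lt ?_ h2
    simp only [hL]
    rw [norm_mul, Real.norm_of_nonneg ht.1]
    exact (mul_le_of_le_one_left (norm_nonneg _) ht.2).trans_lt h1
  have hF' : ContDiffOn ℝ ∞ (fun p => fderiv ℝ F p (1, 0)) (Metric.ball 0 η) :=
    (hF.fderiv_of_isOpen Metric.isOpen_ball (by simp)).clm_apply contDiffOn_const
  refine ⟨fun p => ∫ t in (0 : ℝ)..1, fderiv ℝ F (L (p, t)) (1, 0),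
    contDiffOn_integral_unitInterval (F := fun q => fderiv ℝ F (L q) (1, 0))
      (Metric.isOpen_ball.preimage hLs.continuous) Metric.isOpen_ball
      (hF'.comp hLs.contDiffOn fun _ h => h) hLmem, fun p hp => ?_⟩
  have hderiv : ∀ t ∈ Set.uIcc (0 : ℝ) 1, HasDerivAt (fun t => F (L (p, t)))
      (p.1 • fderiv ℝ F (L (p, t)) (1, 0)) t := by
    intro t ht
    rw [Set.uIcc_of_le zero_le_one] at ht
    have h1 : HasFDerivAt F (fderiv ℝ F (L (p, t))) (L (p, t)) :=
      ((hF.contDiffAt (Metric.isOpen_ball.mem_nhds (hLmem p hp t ht))).differentiableAt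
        (by simp)).hasFDerivAt
    have h2 : HasDerivAt (fun t : ℝ => t * p.1) p.1 t := by
      simpa using (hasDerivAt_id t).mul_const p.1
    have h3 : HasDerivAt (fun t => L (p, t)) (p.1, 0) t := h2.prodMk (hasDerivAt_const t p.2)
    refine (HasFDerivAt.comp_hasDerivAt (l := F) t h1 h3).congr_deriv ?_
    rw [← map_smul]
    simp
  have hcont : ContinuousOn (fun t => p.1 • fderiv ℝ F (L (p, t)) (1, 0)) (Set.Icc 0 1) := by
    refine ContinuousOn.const_smul (hF'.continuousOn.comp ?_ fun t ht => hLmem p hp t ht) _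
    exact (hLs.continuous.comp (by fun_prop : Continuous fun t : ℝ => (p, t))).continuousOn
  have h := intervalIntegral.integral_eq_sub_of_hasDerivAt hderiv (by
    rw [← Set.uIcc_of_le zero_le_one] at hcont
    exact hcont.intervalIntegrable)
  have hz : F (L (p, 0)) = 0 := by
    refine h0 _ (hLmem p hp 0 ⟨le_rfl, zero_le_one⟩) ?_
    simp [hL]
  have h1 : L (p, 1) = p := by simp [hL]
  rw [intervalIntegral.integral_smul, hz, h1, sub_zero] at h
  exact h.symm

end Hadamard

section ConsistentFamilies

variable {q : ℕ} {A : Par d → Alg M K}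

/-- The actual angle at time t of the segment is an affine combination of the actual θ and ϑ, hence
does not depend on the base point used to express it. -/
theorem Consistent.comp_lineK (hA : Consistent η q A) {t : ℝ} (ht : t ∈ Set.Icc (0 : ℝ) 1) :
    Consistent η q fun p => A (lineK t p) := by
  intro i i' p p' hp hp' hμ hμ' hr hθ hϑ
  refine hA i i' _ _ (lineK_mem hp ht) (lineK_mem hp' ht) hμ hμ' hr hθ ?_
  have h : ∀ (i : Idx M K) (p : Par d), i.1.2 + (lineK t p).2.2.2
      = (1 - t) • (i.1.2 + p.2.2.1) + t • (i.1.2 + p.2.2.2) := fun i p => by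
    simp only [lineK]
    module
  rw [h, h, hθ, hϑ]

theorem Consistent.avgK (hA : Consistent η q A) (hAs : ContDiffOn ℝ ∞ A (Metric.ball 0 η)) :
    Consistent η q (avgK A) := by
  intro i i' p p' hp hp' hμ hμ' hr hθ hϑ
  have hev : ∀ (i : Idx M K) (p : Par d), p ∈ Metric.ball 0 η →
      ConicScattering.avgK A p (i, 1) = ∫ t in (0 : ℝ)..1, A (lineK t p) (i, 1) := fun i p hp => by
    have hc := continuousOn_comp_lineK hAs hp
    rw [← Set.uIcc_of_le zero_le_one] at hc
    exact ((evalCLM ℝ (i, (1 : unitInterval)) : Alg M K →L[ℝ] ℝ).intervalIntegral_comp_comm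
      hc.intervalIntegrable).symm
  rw [hev i p hp, hev i' p' hp', ← intervalIntegral.integral_const_mul,
    ← intervalIntegral.integral_const_mul]
  refine intervalIntegral.integral_congr fun t ht => ?_
  rw [Set.uIcc_of_le zero_le_one] at ht
  exact hA.comp_lineK ht i i' p p' hp hp' hμ hμ' hr hθ hϑ

/-- A derivative in the asymptotic angle is taken along the same actual direction from every base
point, so the difference quotients agree. -/
theorem Consistent.dK (hA : Consistent η q A) (hAs : ContDiffOn ℝ ∞ A (Metric.ball 0 η))
    (m : Fin d) : Consistent η q (dK m A) := by
  intro i i' p p' hp hp' hμ hμ' hr hθ hϑ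
  set e : Par d := (0, 0, 0, unitVec m) with he
  have hev : ∀ (i : Idx M K) (p : Par d), p ∈ Metric.ball 0 η →
      HasDerivAt (fun t : ℝ => i.1.1 ^ q * A (p + t • e) (i, 1))
        (i.1.1 ^ q * ConicScattering.dK m A p (i, 1)) 0 := fun i p hp => by
    have h1 : HasFDerivAt A (fderiv ℝ A p) (p + (0 : ℝ) • e) := by
      rw [zero_smul, add_zero]
      exact ((hAs.contDiffAt (Metric.isOpen_ball.mem_nhds hp)).differentiableAt
        (by simp)).hasFDerivAt
    have h2 := HasFDerivAt.comp_hasDerivAt (l := A) (0 : ℝ) h1 (hasDerivAt_add_smul p e)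
    exact ((evalCLM ℝ (i, (1 : unitInterval)) :
      Alg M K →L[ℝ] ℝ).hasFDerivAt.comp_hasDerivAt (0 : ℝ) h2).const_mul _
  have hmem : ∀ p : Par d, p ∈ Metric.ball 0 η →
      ∀ᶠ t in 𝓝 (0 : ℝ), p + t • e ∈ Metric.ball 0 η := fun p hp => by
    have hc : Continuous fun t : ℝ => p + t • e := by fun_prop
    refine hc.continuousAt.eventually_mem (Metric.isOpen_ball.mem_nhds ?_)
    simpa using hp
  refine (hev i p hp).unique ((hev i' p' hp').congr_of_eventuallyEq ?_)
  filter_upwards [hmem p hp, hmem p' hp'] with t ht ht'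
  refine hA i i' _ _ ht ht' ?_ ?_ ?_ ?_ ?_
  · simpa [he] using hμ
  · simpa [he] using hμ'
  · simpa [he] using hr
  · simpa [he] using hθ
  · simp only [he, Prod.snd_add, Prod.smul_snd, ← add_assoc, hϑ]

/-- The expansion at the diagonal of a homogeneous family which vanishes there to first order, and
to second order at infinity. -/
theorem Consistent.hasExpansion (hA : Consistent η q A)
    (hAs : ContDiffOn ℝ ∞ A (Metric.ball 0 η))
    (hdiag : ∀ p ∈ Metric.ball (0 : Par d) η, p.2.2.1 = p.2.2.2 → A p = 0)
    (hder : ∀ p ∈ Metric.ball (0 : Par d) η, p.2.2.1 = p.2.2.2 → p.1 = 0 →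
      ∀ m, ConicScattering.dK m A p = 0)
    (hV : IsOpen V) (hVK : V ⊆ K) {R δ : ℝ} (hR : 2 * M.RM < R) (hRδ : R ^ (-M.ν) < δ)
    (hδ : δ < η) {f g : ℝ → Triple d → ℝ}
    (hf : ∀ ε ∈ Set.Ioc (0 : ℝ) 1, ∀ x ∈ Theta R V δ,
      f ε x - g ε x = ε ^ q * famVal q A (x.1 / ε, x.2)) :
    HasExpansion (Theta R V δ) f g (q - M.ν) 1 q 2 := by
  have h01 : (0 : ℝ) ∈ Set.Icc (0 : ℝ) 1 := ⟨le_rfl, zero_le_one⟩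
  -- `B` are the first-order coefficients, evaluated on the diagonal, and `C` the second-order
  -- remainders of two successive expansions.
  set B : Fin d → Par d → Alg M K := fun m p => ConicScattering.dK m A (lineK 0 p) with hB
  set C : Fin d → Fin d → Par d → Alg M K := fun m n =>
    ConicScattering.avgK (ConicScattering.dK n (ConicScattering.avgK (ConicScattering.dK m A)))
    with hC
  have hdKs := fun m => contDiffOn_dK hAs m
  have hdKa := fun m => contDiffOn_avgK (hdKs m)
  have hBs : ∀ m, ContDiffOn ℝ ∞ (B m) (Metric.ball 0 η) := fun m =>
    contDiffOn_comp_lineK_zero (hdKs m)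
  have hBc : ∀ m, Consistent η q (B m) := fun m => (hA.dK hAs m).comp_lineK h01
  have hCs : ∀ m n, ContDiffOn ℝ ∞ (C m n) (Metric.ball 0 η) := fun m n =>
    contDiffOn_avgK (contDiffOn_dK (hdKa m) n)
  have hCc : ∀ m n, Consistent η q (C m n) := fun m n =>
    (((hA.dK hAs m).avgK (hdKs m)).dK (hdKa m) n).avgK (contDiffOn_dK (hdKa m) n)
  -- The first-order coefficients vanish at μ = 0, hence are μ times a smooth family; the factor μ =
  -- r^{-ν} is the gain in the linear term.
  have hE := fun m => exists_eq_smul (hBs m) fun p hp h =>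
    hder _ (lineK_mem hp h01) (lineK_zero_diag p) h m
  choose E hEs hBE using hE
  have hexp : ∀ p ∈ Metric.ball (0 : Par d) η, A p = ∑ m, (p.2.2.2 m - p.2.2.1 m) • (B m p
      + ∑ n, (p.2.2.2 n - p.2.2.1 n) • C m n p) := by
    intro p hp
    rw [eq_add_sum_avgK hAs hp, hdiag _ (lineK_mem hp h01) (lineK_zero_diag p), zero_add]
    refine Finset.sum_congr rfl fun m _ => ?_
    rw [eq_add_sum_avgK (hdKa m) hp]
    congr 2
    have hconst : ∀ t : ℝ, lineK t (lineK 0 p) = lineK 0 p := fun t => by simp [lineK]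
    simp only [hB, ConicScattering.avgK, hconst, intervalIntegral.integral_const, sub_zero,
      one_smul]
  have hsB : ∀ m, IsSymbol (Theta R V δ) (q - M.ν)
      fun ε x => ε ^ q * famVal q (B m) (x.1 / ε, x.2) := fun m => by
    simpa using (hBc m).isSymbol (n := 1) (hEs m) (fun p hp => by rw [hBE m p hp, pow_one])
      hV hVK hR hRδ hδ
  have hsC : ∀ m n, IsSymbol (Theta R V δ) q
      fun ε x => ε ^ q * famVal q (C m n) (x.1 / ε, x.2) := fun m n => by
    simpa using (hCc m n).isSymbol (n := 0) (hCs m n) (fun p hp => by simp) hV hVK hR hRδ hδ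
  refine ⟨fun ε x => ∑ m, ε ^ q * famVal q (B m) (x.1 / ε, x.2) * (x.2.2 m - x.2.1 m),
    fun ε x => ∑ m, ∑ n, ε ^ q * famVal q (C m n) (x.1 / ε, x.2)
      * ((x.2.2 m - x.2.1 m) * (x.2.2 n - x.2.1 n)), ?_, ?_, fun ε hε x hx => ?_⟩
  · refine isSymbolPow_of_sum (isOpen_Theta hV) (fun τ : Fin 1 → Fin d => hsB (τ 0))
      fun ε hε x hx => ?_
    simp only [Fin.prod_univ_one]
    exact ((Equiv.funUnique (Fin 1) (Fin d)).symm.sum_comp fun τ : Fin 1 → Fin d =>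
      ε ^ q * famVal q (B (τ 0)) (x.1 / ε, x.2) * (x.2.2 (τ 0) - x.2.1 (τ 0)))
  · refine isSymbolPow_of_sum (isOpen_Theta hV) (fun τ : Fin 2 → Fin d => hsC (τ 0) (τ 1))
      fun ε hε x hx => ?_
    simp only [Fin.prod_univ_two]
    rw [← Fintype.sum_prod_type']
    exact ((finTwoArrowEquiv (Fin d)).symm.sum_comp fun τ : Fin 2 → Fin d =>
      ε ^ q * famVal q (C (τ 0) (τ 1)) (x.1 / ε, x.2)
        * ((x.2.2 (τ 0) - x.2.1 (τ 0)) * (x.2.2 (τ 1) - x.2.1 (τ 1))))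
  · have hy := paramDomain_mono hδ.le (div_mem_paramDomain hR hRδ hε hx)
    simp only [hf ε hε x hx, famVal_of_mem hVK q _ hy]
    rw [hexp _ (basePar_mem hy), ← Finset.sum_add_distrib]
    simp only [BoundedContinuousFunction.sum_apply, BoundedContinuousFunction.smul_apply,
      BoundedContinuousFunction.add_apply, smul_eq_mul, Finset.mul_sum, basePar, PiLp.sub_apply,
      PiLp.zero_apply, sub_zero]
    refine Finset.sum_congr rfl fun m _ => ?_
    rw [mul_add, mul_add, mul_add, Finset.mul_sum, Finset.mul_sum, Finset.mul_sum]
    congr 1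
    · ring
    · refine Finset.sum_congr rfl fun n _ => ?_
      ring

end ConsistentFamilies

end ConicScattering

/-! ### Expansions of the phase and of its derivatives. -/

namespace ConicScattering

open BoundedContinuousFunction

variable {d : ℕ} {M : ConicChart d} {K V : Set (Ang d)} {b ρ η : ℝ} {w : Par d → Vel M K}

/-- The leading part `∑ ḡ_{lm}(θ) (ϑ - θ)_m` of the momenta at the diagonal. -/
def linMom (M : ConicChart d) (K : Set (Ang d)) (l : Fin d) (p : Par d) : Alg M K :=
  ∑ m, (p.2.2.2 m - p.2.2.1 m) • metr l m (((0, 0, p.2.2.1, p.2.2.1), 0) : Par d × Vel M K)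

theorem dK_eq_of_hasDerivAt {A : Par d → Alg M K} (hA : ContDiffOn ℝ ∞ A (Metric.ball 0 η))
    {p : Par d} (hp : p ∈ Metric.ball 0 η) {m : Fin d} {a : Alg M K}
    (h : HasDerivAt (fun t : ℝ => A (p + t • ((0, 0, 0, unitVec m) : Par d))) a 0) :
    dK m A p = a := by
  have h1 : HasFDerivAt A (fderiv ℝ A p) (p + (0 : ℝ) • ((0, 0, 0, unitVec m) : Par d)) := by
    rw [zero_smul, add_zero]
    exact ((hA.contDiffAt (Metric.isOpen_ball.mem_nhds hp)).differentiableAt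
      (by simp)).hasFDerivAt
  exact (HasFDerivAt.comp_hasDerivAt (l := A) (0 : ℝ) h1 (hasDerivAt_add_smul p _)).unique h

namespace SolutionFamily

theorem unperturbed_mem (S : SolutionFamily M K b ρ η w) {p : Par d}
    (hp : p ∈ Metric.ball 0 η) :
    (((0, 0, p.2.2.1, p.2.2.1), 0) : Par d × Vel M K) ∈ Metric.ball 0 ρ := by
  have hη := S.pos
  rw [mem_ball_zero_iff] at hp ⊢
  have h := ((max_lt_iff.1 (max_lt_iff.1 (max_lt_iff.1 hp).2).2).1).trans_le S.le
  have hρ := hη.trans_le S.le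
  refine max_lt (max_lt ?_ (max_lt ?_ (max_lt h h))) ?_ <;> simpa using hρ

theorem linMom_apply (S : SolutionFamily M K b ρ η w) {p : Par d} (hp : p ∈ Metric.ball 0 η)
    (l : Fin d) (j : PathIdx M K) :
    linMom M K l p j
      = ∑ m, (p.2.2.2 m - p.2.2.1 m) * M.gbar (p.2.2.1 + j.1.1.2) l m := by
  simp only [linMom, BoundedContinuousFunction.sum_apply, BoundedContinuousFunction.smul_apply,
    smul_eq_mul, metr_apply_of_unperturbed S.good (S.unperturbed_mem hp) rfl rfl]

theorem contDiffOn_linMom (S : SolutionFamily M K b ρ η w) (l : Fin d) :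
    ContDiffOn ℝ ∞ (linMom M K l) (Metric.ball 0 η) := by
  refine ContDiffOn.sum fun m _ => ?_
  have h : ContDiffOn ℝ ∞ (fun p : Par d => p.2.2.2 m - p.2.2.1 m) (Metric.ball 0 η) := by
    fun_prop
  have h' : ContDiff ℝ ∞ fun p : Par d =>
      (((0, 0, p.2.2.1, p.2.2.1), 0) : Par d × Vel M K) := by fun_prop
  exact h.smul ((S.good.metr l m).comp h'.contDiffOn fun _ hp => S.unperturbed_mem hp)

theorem consistent_linMom (S : SolutionFamily M K b ρ η w) (l : Fin d) :
    Consistent η 0 (linMom M K l) := by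
  intro i i' p p' hp hp' hμ hμ' hr hθ hϑ
  rw [S.linMom_apply hp, S.linMom_apply hp', add_comm _ i.1.2, add_comm _ i'.1.2, hθ, pow_zero,
    pow_zero, one_mul, one_mul]
  refine Finset.sum_congr rfl fun m _ => ?_
  have h1 : i.1.2 m + p.2.2.1 m = i'.1.2 m + p'.2.2.1 m := by simpa using congrArg (fun x => x m) hθ
  have h2 : i.1.2 m + p.2.2.2 m = i'.1.2 m + p'.2.2.2 m := by simpa using congrArg (fun x => x m) hϑ
  congr 1
  linarith

variable {R δ : ℝ}

/-- The subtracted term (1 + s) · 1 is the radius in homogeneous form. The difference vanishes on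
the diagonal together with its angular derivative, since the momenta vanish there. -/
theorem hasExpansion_psiEps (S : SolutionFamily M K b ρ η w) (hV : IsOpen V) (hVK : V ⊆ K)
    (hR : 2 * M.RM < R) (hRδ : R ^ (-M.ν) < δ) (hδ : δ < η) :
    HasExpansion (Theta R V δ) (psiEps w) (fun _ x => x.1) (1 - M.ν) 1 1 2 := by
  set A : Par d → Alg M K := fun p => psiFam w p - (1 + p.2.1) • 1 with hA
  have hAs : ContDiffOn ℝ ∞ A (Metric.ball 0 η) := by
    have h : ContDiffOn ℝ ∞ (fun p : Par d => 1 + p.2.1) (Metric.ball 0 η) := by fun_prop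
    exact S.contDiffOn_psiFam.sub (h.smul contDiffOn_const)
  have hAc : Consistent η 1 A := by
    intro i i' p p' hp hp' hμ hμ' hr hθ hϑ
    have h := S.consistent_psiFam i i' p p' hp hp' hμ hμ' hr hθ hϑ
    simp only [hA, BoundedContinuousFunction.sub_apply, BoundedContinuousFunction.smul_apply,
      alg_one_apply, smul_eq_mul, mul_one, pow_one, mul_sub, hr] at h ⊢
    rw [h]
  have h := hAc.hasExpansion hAs (fun p hp h => by simp only [hA, S.psiFam_diag hp h, sub_self])
    (fun p hp h _ m => ?_) hV hVK hR hRδ hδ (f := psiEps w) (g := fun _ x => x.1)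
    fun ε hε x hx => ?_
  · simpa using h
  · refine dK_eq_of_hasDerivAt hAs hp ?_
    have h1 : HasFDerivAt (psiFam w) (fderiv ℝ (psiFam w) p)
        (p + (0 : ℝ) • ((0, 0, 0, unitVec m) : Par d)) := by
      rw [zero_smul, add_zero]
      exact ((S.contDiffOn_psiFam.contDiffAt (Metric.isOpen_ball.mem_nhds hp)).differentiableAt
        (by simp)).hasFDerivAt
    have h2 := HasFDerivAt.comp_hasDerivAt (l := psiFam w) (0 : ℝ) h1 (hasDerivAt_add_smul p _)
    rw [S.fderiv_psiFam_diag hp h] at h2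
    simpa [hA, Function.comp_def] using h2.sub_const ((1 + p.2.1) • (1 : Alg M K))
  · have hy := paramDomain_mono hδ.le (div_mem_paramDomain hR hRδ hε hx)
    have hε0 := hε.1.ne'
    simp only [psiEps, psi, famVal_of_mem hVK _ _ hy, hA, BoundedContinuousFunction.sub_apply,
      BoundedContinuousFunction.smul_apply, alg_one_apply, smul_eq_mul, basePar]
    field_simp
    ring

theorem hasExpansion_deriv_psiEps (S : SolutionFamily M K b ρ η w) (hV : IsOpen V) (hVK : V ⊆ K)
    (hR : 2 * M.RM < R) (hRδ : R ^ (-M.ν) < δ) (hδ : δ < η) :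
    HasExpansion (Theta R V δ) (fun ε x => deriv (fun r => psiEps w ε (r, x.2.1, x.2.2)) x.1)
      (fun _ _ => 1) (-M.ν) 1 0 2 := by
  set A : Par d → Alg M K := fun p => endInvSpeed w p - 1 with hA
  have hAs : ContDiffOn ℝ ∞ A (Metric.ball 0 η) := S.contDiffOn_endInvSpeed.sub contDiffOn_const
  have hAc : Consistent η 0 A := by
    intro i i' p p' hp hp' hμ hμ' hr hθ hϑ
    have h := S.consistent_endInvSpeed i i' p p' hp hp' hμ hμ' hr hθ hϑ
    simp only [hA, BoundedContinuousFunction.sub_apply, alg_one_apply, pow_zero, one_mul] at h ⊢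
    rw [h]
  have h := hAc.hasExpansion hAs (fun p hp h => by simp only [hA, S.endInvSpeed_diag hp h, sub_self])
    (fun p hp h _ m => ?_) hV hVK hR hRδ hδ
    (f := fun ε x => deriv (fun r => psiEps w ε (r, x.2.1, x.2.2)) x.1) (g := fun _ _ => 1)
    fun ε hε x hx => ?_
  · simpa using h
  · simp only [dK, hA, fderiv_sub_const, S.fderiv_endInvSpeed hp h, _root_.zero_apply]
  · have hy := paramDomain_mono hδ.le (div_mem_paramDomain hR hRδ hε hx)
    rw [S.deriv_psiEps hV hVK hε.1.ne' hy]
    simp only [famVal_of_mem hVK _ _ hy, hA, BoundedContinuousFunction.sub_apply, alg_one_apply,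
      pow_zero, one_mul]

/-- The expansion of the momenta. -/
theorem hasExpansion_of_momentum (S : SolutionFamily M K b ρ η w) (hV : IsOpen V) (hVK : V ⊆ K)
    (hR : 2 * M.RM < R) (hRδ : R ^ (-M.ν) < δ) (hδ : δ < η) {B : Par d → Alg M K} {l : Fin d}
    (hB : Consistent η 0 B) (hBs : ContDiffOn ℝ ∞ B (Metric.ball 0 η))
    (hB0 : ∀ p ∈ Metric.ball (0 : Par d) η, p.2.2.1 = p.2.2.2 → B p = 0)
    (hB1 : ∀ p ∈ Metric.ball (0 : Par d) η, p.2.2.1 = p.2.2.2 → p.1 = 0 → ∀ (e : Par d)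
      (j : PathIdx M K), fderiv ℝ B p e j
        = ∑ m, M.gbar (p.2.2.2 + j.1.1.2) l m * (e.2.2.1 m - e.2.2.2 m))
    {f g : ℝ → Triple d → ℝ} (c : ℝ)
    (hf : ∀ ε ∈ Set.Ioc (0 : ℝ) 1, ∀ x ∈ Theta R V δ,
      f ε x = c * (x.1 * famVal 0 B (x.1 / ε, x.2)))
    (hg : ∀ ε x, g ε x = -c * (x.1 * ∑ m, M.gbar x.2.1 l m * (x.2.2 m - x.2.1 m))) :
    HasExpansion (Theta R V δ) f g (1 - M.ν) 1 1 2 := by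
  set A : Par d → Alg M K := fun p => (c * (1 + p.2.1)) • (B p + linMom M K l p) with hA
  have hAs : ContDiffOn ℝ ∞ A (Metric.ball 0 η) := by
    have h : ContDiffOn ℝ ∞ (fun p : Par d => c * (1 + p.2.1)) (Metric.ball 0 η) := by fun_prop
    exact h.smul (hBs.add (S.contDiffOn_linMom l))
  have hAc : Consistent η 1 A := by
    intro i i' p p' hp hp' hμ hμ' hr hθ hϑ
    have h := hB i i' p p' hp hp' hμ hμ' hr hθ hϑ
    have h' := S.consistent_linMom l i i' p p' hp hp' hμ hμ' hr hθ hϑ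
    rw [pow_zero, pow_zero, one_mul, one_mul] at h h'
    simp only [hA, BoundedContinuousFunction.add_apply, BoundedContinuousFunction.smul_apply,
      smul_eq_mul, pow_one, h, h']
    linear_combination (c * (B p' (i', 1) + linMom M K l p' (i', 1))) * hr
  have h := hAc.hasExpansion hAs (fun p hp h => ?_) (fun p hp h hμ m => ?_) hV hVK hR hRδ hδ
    (f := f) (g := g) fun ε hε x hx => ?_
  · simpa using h
  · simp [hA, hB0 p hp h, linMom, h]
  · have h1 : HasFDerivAt B (fderiv ℝ B p) (p + (0 : ℝ) • ((0, 0, 0, unitVec m) : Par d)) := by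
      rw [zero_smul, add_zero]
      exact ((hBs.contDiffAt (Metric.isOpen_ball.mem_nhds hp)).differentiableAt
        (by simp)).hasFDerivAt
    have h2 := HasFDerivAt.comp_hasDerivAt (l := B) (0 : ℝ) h1 (hasDerivAt_add_smul p _)
    have hc : ∀ n : Fin d, HasDerivAt (fun t : ℝ => p.2.2.2 n + t * (unitVec m : Ang d) n
        - p.2.2.1 n) ((unitVec m : Ang d) n) 0 := fun n => by
      simpa using (((hasDerivAt_id (0 : ℝ)).mul_const ((unitVec m : Ang d) n)).const_add
        (p.2.2.2 n)).sub_const (p.2.2.1 n)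
    have h3 := HasDerivAt.fun_sum (u := Finset.univ) fun n _ =>
      (hc n).smul_const (metr l n (((0, 0, p.2.2.1, p.2.2.1), 0) : Par d × Vel M K))
    have h4 := (h2.add h3).const_smul (c * (1 + p.2.1))
    -- At μ = 0 the derivative of the momentum in ϑ is -ḡ, which `linMom` compensates; this is the
    -- first-order cancellation required by `Consistent.hasExpansion`.
    have h5 : fderiv ℝ B p (0, 0, 0, unitVec m) + ∑ n, (unitVec m : Ang d) n •
        metr l n (((0, 0, p.2.2.1, p.2.2.1), 0) : Par d × Vel M K) = 0 := by
      ext j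
      have hmetr : ∀ n, metr l n (((0, 0, p.2.2.1, p.2.2.1), 0) : Par d × Vel M K) j
          = M.gbar (p.2.2.2 + j.1.1.2) l n := fun n => by
        rw [metr_apply_of_unperturbed S.good (S.unperturbed_mem hp) rfl rfl, ← h]
      simp only [BoundedContinuousFunction.add_apply, hB1 p hp h hμ,
        BoundedContinuousFunction.sum_apply, BoundedContinuousFunction.smul_apply, smul_eq_mul,
        hmetr, ← Finset.sum_add_distrib, BoundedContinuousFunction.coe_zero, Pi.zero_apply]
      refine Finset.sum_eq_zero fun n _ => ?_
      simp
      ring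
    rw [h5, smul_zero] at h4
    refine dK_eq_of_hasDerivAt hAs hp (h4.congr_of_eventuallyEq (Eventually.of_forall fun t => ?_))
    simp [hA, linMom]
  · have hy := paramDomain_mono hδ.le (div_mem_paramDomain hR hRδ hε hx)
    have hε0 := hε.1.ne'
    have hlin : linMom M K l (basePar M (x.1 / ε, x.2)) (baseIdx hVK hy, 1)
        = ∑ m, M.gbar x.2.1 l m * (x.2.2 m - x.2.1 m) := by
      rw [S.linMom_apply (basePar_mem hy)]
      simp [basePar, baseIdx, mul_comm]
    rw [hf ε hε x hx, hg, famVal_of_mem hVK _ _ hy, famVal_of_mem hVK _ _ hy]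
    simp only [hA, BoundedContinuousFunction.add_apply, BoundedContinuousFunction.smul_apply, hlin,
      smul_eq_mul]
    have hs : (basePar M (x.1 / ε, x.2)).2.1 = 0 := rfl
    rw [hs]
    field_simp
    ring

theorem hasExpansion_gradient_start (S : SolutionFamily M K b ρ η w) (hV : IsOpen V)
    (hVK : V ⊆ K) (hR : 2 * M.RM < R) (hRδ : R ^ (-M.ν) < δ) (hδ : δ < η) (l : Fin d) :
    HasExpansion (Theta R V δ)
      (fun ε x => gradient (fun θ => psiEps w ε (x.1, θ, x.2.2)) x.2.1 l)
      (fun _ x => x.1 * ∑ m, M.gbar x.2.1 l m * (x.2.2 m - x.2.1 m)) (1 - M.ν) 1 1 2 := by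
  refine S.hasExpansion_of_momentum hV hVK hR hRδ hδ (S.consistent_endMom l)
    (S.contDiffOn_endMom l) (fun p hp h => S.endMom_diag hp h l)
    (fun p hp h hμ e j => by rw [S.fderiv_endMom hp h, S.fderiv_infMom hp h hμ]) (-1)
    (fun ε hε x hx => ?_) fun ε x => by ring
  rw [S.gradient_psiEps_start hV hVK hε.1.ne'
    (paramDomain_mono hδ.le (div_mem_paramDomain hR hRδ hε hx))]
  ring

theorem hasExpansion_gradient_limit (S : SolutionFamily M K b ρ η w) (hV : IsOpen V)
    (hVK : V ⊆ K) (hR : 2 * M.RM < R) (hRδ : R ^ (-M.ν) < δ) (hδ : δ < η) (l : Fin d) :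
    HasExpansion (Theta R V δ)
      (fun ε x => gradient (fun ϑ => psiEps w ε (x.1, x.2.1, ϑ)) x.2.2 l)
      (fun _ x => -(x.1 * ∑ m, M.gbar x.2.1 l m * (x.2.2 m - x.2.1 m))) (1 - M.ν) 1 1 2 := by
  refine S.hasExpansion_of_momentum hV hVK hR hRδ hδ (S.consistent_infMom l)
    (S.contDiffOn_infMom l) (fun p hp h => S.infMom_diag hp h l)
    (fun p hp h hμ e j => S.fderiv_infMom hp h hμ l e j) 1 (fun ε hε x hx => ?_)
    fun ε x => by ring
  rw [S.gradient_psiEps_limit hV hVK hε.1.ne'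
    (paramDomain_mono hδ.le (div_mem_paramDomain hR hRδ hε hx)), one_mul]

/-- Continuity at the origin in the sup norm makes the bound uniform in the base point. It places
the starting points of the rays in the strong region. -/
theorem exists_radius_endInvSpeed (S : SolutionFamily M K b ρ η w) {c : ℝ} (hc : 0 < c) :
    ∃ δ > 0, δ ≤ η ∧ ∀ p ∈ Metric.ball (0 : Par d) δ, ∀ j, 1 - c < endInvSpeed w p j := by
  have h0 : (0 : Par d) ∈ Metric.ball 0 η := Metric.mem_ball_self S.pos
  have hcont := (S.contDiffOn_endInvSpeed.continuousOn).continuousAt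
    (Metric.isOpen_ball.mem_nhds h0)
  obtain ⟨δ, hδ, h⟩ := Metric.continuousAt_iff.1 hcont c hc
  refine ⟨min δ η, lt_min hδ S.pos, min_le_right _ _, fun p hp j => ?_⟩
  have h1 := h (lt_of_lt_of_le hp (min_le_left _ _))
  rw [S.endInvSpeed_diag h0 rfl, dist_eq_norm] at h1
  have h2 := (norm_coe_le_norm (endInvSpeed w p - 1) j).trans_lt h1
  rw [BoundedContinuousFunction.sub_apply, alg_one_apply, Real.norm_eq_abs] at h2
  linarith [(abs_lt.1 h2).1]

end SolutionFamily

end ConicScattering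

end

/-! ### Assembly of the theorem. -/

open ConicScattering in
theorem theorem5 (d : ℕ) (M : ConicChart d) (V : Set (Ang d))
    (hVopen : IsOpen V) (hVconvex : Convex ℝ V)
    (hVcompact : IsCompact (closure V)) (hVsub : closure V ⊆ M.U)
    (R₁ δ₁ : ℝ) (hδ₁ : 0 < δ₁) :
    ∃ R δ κ : ℝ, R₁ < R ∧ M.RM < R ∧ 0 < δ ∧ δ < δ₁ ∧ 0 < κ ∧ κ < 1 ∧
    ∃ ψ : ℝ → Triple d → ℝ,
      (∀ ε ∈ Set.Ioc (0 : ℝ) 1,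
        ContDiffOn ℝ ∞ (ψ ε) (Theta R V δ) ∧
        -- the eikonal equation
        (∀ r θ ϑ, (r, θ, ϑ) ∈ Theta R V δ → ∀ ϱ : ℝ,
          symbolP M ε (initialPoint (ψ ε) r θ ϱ ϑ) = ϱ ^ 2) ∧
        -- generation of the outgoing and incoming classical scattering maps
        (∀ σ : ℝ, (σ = 1 ∨ σ = -1) →
          (∀ z ∈ strongRegion M ε σ R V κ, ∃ w, IsScatteringLimit M ε σ z w) ∧
          (∀ r θ ϑ, (r, θ, ϑ) ∈ Theta R V δ → ∀ ϱ : ℝ, 0 < σ * ϱ →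
            initialPoint (ψ ε) r θ ϱ ϑ ∈ strongRegion M ε σ R V κ ∧
            IsScatteringLimit M ε σ (initialPoint (ψ ε) r θ ϱ ϑ)
              (finalPoint (ψ ε) r θ ϱ ϑ)))) ∧
      -- the expansions of `ψ`, `∂_r ψ`, `∂_θ ψ` and `∂_ϑ ψ`, uniformly in `ε`
      HasExpansion (Theta R V δ) ψ (fun _ x => x.1) (1 - M.ν) 1 1 2 ∧
      HasExpansion (Theta R V δ) (fun ε x => deriv (fun r => ψ ε (r, x.2.1, x.2.2)) x.1)
        (fun _ _ => 1) (-M.ν) 1 0 2 ∧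
      (∀ l : Fin d,
        HasExpansion (Theta R V δ)
          (fun ε x => gradient (fun θ => ψ ε (x.1, θ, x.2.2)) x.2.1 l)
          (fun _ x => x.1 * ∑ m, M.gbar x.2.1 l m * (x.2.2 m - x.2.1 m))
          (1 - M.ν) 1 1 2) ∧
      (∀ l : Fin d,
        HasExpansion (Theta R V δ)
          (fun ε x => gradient (fun ϑ => ψ ε (x.1, x.2.1, ϑ)) x.2.2 l)
          (fun _ x => -(x.1 * ∑ m, M.gbar x.2.1 l m * (x.2.2 m - x.2.1 m)))
          (1 - M.ν) 1 1 2) := by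
  have hVK : V ⊆ closure V := subset_closure
  obtain ⟨b, ρ, η, w, S⟩ := exists_solutionFamily hVcompact hVsub
  obtain ⟨κ, β, hκ, hκ1, hβ, hscat⟩ := S.exists_isScatteringLimit hVcompact hVsub hVK
  -- The inverse speed is the ratio of |∂_rφ| to √p, so it has to exceed 1 - κ², with the κ of the
  -- strong region already fixed.
  obtain ⟨δ₂, hδ₂, hδ₂η, hspeed⟩ := S.exists_radius_endInvSpeed (pow_pos hκ 2)
  obtain ⟨δ, hδ, hδlt⟩ := exists_between (lt_min hδ₁ hδ₂)
  obtain ⟨hδδ₁, hδδ₂⟩ := lt_min_iff.1 hδlt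
  have hδη : δ < η := hδδ₂.trans_le hδ₂η
  -- The parameter μ of any radius beyond R is below R^{-ν}, so a large R makes it admissible both
  -- for the solution family and for the reachability of the strong region.
  obtain ⟨R, hRmin, hR₁, hR⟩ := (((tendsto_rpow_neg_atTop M.ν_pos).eventually_lt_const
    (lt_min hδ hβ)).and ((eventually_gt_atTop R₁).and (eventually_gt_atTop (2 * M.RM)))).exists
  obtain ⟨hRδ, hRβ⟩ := lt_min_iff.1 hRmin
  have hRM := M.RM_pos
  have hdom : ∀ ε ∈ Set.Ioc (0 : ℝ) 1, ∀ x ∈ Theta R V δ, (x.1 / ε, x.2) ∈ paramDomain M V η :=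
    fun ε hε x hx => paramDomain_mono hδη.le (div_mem_paramDomain hR hRδ hε hx)
  refine ⟨R, δ, κ, hR₁, by linarith, hδ, hδδ₁, hκ, hκ1, SolutionFamily.psiEps w, fun ε hε => ?_,
    S.hasExpansion_psiEps hVopen hVK hR hRδ hδη, S.hasExpansion_deriv_psiEps hVopen hVK hR hRδ hδη,
    S.hasExpansion_gradient_start hVopen hVK hR hRδ hδη,
    S.hasExpansion_gradient_limit hVopen hVK hR hRδ hδη⟩
  have hε0 := hε.1.ne'
  have heik : ∀ r θ ϑ, (r, θ, ϑ) ∈ Theta R V δ → ∀ ϱ : ℝ,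
      symbolP M ε (initialPoint (SolutionFamily.psiEps w ε) r θ ϱ ϑ) = ϱ ^ 2 := fun r θ ϑ hx ϱ => by
    have hy := hdom ε hε _ hx
    rw [S.initialPoint_psiEps hVopen hVK hε0 hy, symbolP_scalePhase hε0,
      S.symbolP_startPoint hVK hy, mul_one]
  refine ⟨S.contDiffOn_psiEps hVopen hVK (hdom ε hε), heik, fun σ hσ =>
    ⟨hscat R hR hRβ ε hε σ hσ, fun r θ ϑ hx ϱ hϱ => ?_⟩⟩
  have hy := hdom ε hε _ hx
  refine ⟨⟨hx.1, hx.2.1, ?_⟩, ?_⟩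
  · rw [heik r θ ϑ hx ϱ, Real.sqrt_sq_eq_abs]
    have habs : |ϱ| = σ * ϱ := by
      rcases hσ with rfl | rfl
      · rw [one_mul] at hϱ ⊢
        exact abs_of_pos hϱ
      · rw [neg_one_mul] at hϱ ⊢
        exact abs_of_neg (by linarith)
    have hyδ := paramDomain_mono hδδ₂.le (div_mem_paramDomain hR hRδ hε hx)
    have h1 := hspeed _ (basePar_mem hyδ) (baseIdx hVK hy, 1)
    have h2 := S.initialPoint_psiEps hVopen hVK hε0 hy ϱ
    have h3 : famVal 0 (SolutionFamily.endInvSpeed w) (r / ε, θ, ϑ)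
        = SolutionFamily.endInvSpeed w (basePar M (r / ε, θ, ϑ)) (baseIdx hVK hy, 1) := by
      rw [famVal_of_mem hVK _ _ hy, pow_zero, one_mul]
    rw [h2]
    simp only [scalePhase_apply, SolutionFamily.startPoint, h3]
    rw [habs]
    calc (1 - κ ^ 2) * (σ * ϱ) < _ * (σ * ϱ) := mul_lt_mul_of_pos_right h1 hϱ
      _ = _ := by ring
  · rw [S.initialPoint_psiEps hVopen hVK hε0 hy, S.finalPoint_psiEps hVopen hVK hε0 hy]
    exact (S.isScatteringLimit_startPoint hVK hy).scale hε.1 hσ hϱ
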